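/- **Proposition.** Work in $\mathbb R^2$ with origin $o$, unit disc $B^2$, unit circle $S^1$, and let $V$ denote area and $[\cdot]$ convex hull. Let $\alpha\in(0,\pi/2)$, $$a=(\cos\alpha,-\sin\alpha),\qquad b=(1/\cos\alpha,0),\qquad c=(\cos\alpha,\sin\alpha),\qquad Q=[o,a,b,c],$$ and let $I$ be the closed counterclockwise arc of $S^1$ from $c$ to $-a$. Consider the $o$-symmetric convex bodies $K\subset\mathbb R^2$ with $a,c\in\partial K$ and $I,-I\subset\partial K$, and put $C=K\cap Q$ and $C^*=K^*\cap Q$, where $K^*=\{y:\langle x,y\rangle\le 1\ \text{for all } x\in K\}$. Fix $v\in(\cos\alpha\sin\alpha,\tan\alpha)$. Among all these $K$ with $V(C)=v$, the maximum of $V(C^*)$ exists and is attained in the following cases; in each case a $K$ with $V(C)=v$ of the described form exists, and every such $K$ is a maximizer. 1. If $v<\alpha$: $\partial C$ is the union of $[o,a]$, $[o,c]$ and an elliptic arc contained in $B^2$ that joins $a$ to $c$ in the positive (counterclockwise) sense, the ellipse having centre $o$. 2. If $v=\alpha$: $C=B^2\cap Q$. 3. If $v>\alpha$: $\partial C$ is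 the union of $[o,a]$, $[o,c]$, two nondegenerate segments of equal length $[a,a']\subset\operatorname{aff}\{a,b\}$ and $[c,c']\subset\operatorname{aff}\{c,b\}$, and an elliptic arc that joins $a'$ to $c'$ in the positive sense, the ellipse having centre $o$ and having $\operatorname{aff}\{a,b\}$ and $\operatorname{aff}\{b,c\}$ as supporting lines. -/

import Mathlib

open Set
open scoped RealInnerProductSpace Pointwise

noncomputable section

namespace Deltoid

/-- The Euclidean plane `ℝ²`. -/
abbrev Plane : Type := EuclideanSpace ℝ (Fin 2)

/-- The point of the unit circle `S¹` at angle `θ`. -/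
def circlePt (θ : ℝ) : Plane := !₂[Real.cos θ, Real.sin θ]

/-- The vertex `a = (cos α, -sin α)`. -/
def ptA (α : ℝ) : Plane := !₂[Real.cos α, -Real.sin α]

/-- The vertex `b = (1 / cos α, 0)`. -/
def ptB (α : ℝ) : Plane := !₂[1 / Real.cos α, 0]

/-- The vertex `c = (cos α, sin α)`. -/
def ptC (α : ℝ) : Plane := !₂[Real.cos α, Real.sin α]

/-- The deltoid `Q = [o, a, b, c]`. -/
def Q (α : ℝ) : Set Plane := convexHull ℝ {0, ptA α, ptB α, ptC α}

/-- The counterclockwise closed arc `I` of `S¹` from `c` (angle `α`) to `-a` (angle `π - α`). -/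
def arcI (α : ℝ) : Set Plane := circlePt '' Icc α (Real.pi - α)

/-- The polar body `K* = {y | ⟨x, y⟩ ≤ 1 for all x ∈ K}`. -/
def polarBody (K : Set Plane) : Set Plane := {y | ∀ x ∈ K, ⟪x, y⟫ ≤ 1}

/-- The area of a plane set. -/
def area (S : Set Plane) : ℝ := MeasureTheory.volume.real S

/-- `K` is an `o`-symmetric convex body having `a`, `c` and the arcs `I`, `-I` of `S¹` on its
boundary. -/
structure Admissible (α : ℝ) (K : Set Plane) : Prop where
  convex : Convex ℝ K
  isCompact : IsCompact K
  interior_nonempty : (interior K).Nonempty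
  symmetric : -K = K
  a_mem : ptA α ∈ frontier K
  c_mem : ptC α ∈ frontier K
  arc_subset : arcI α ⊆ frontier K
  neg_arc_subset : -arcI α ⊆ frontier K

/-- The admissible bodies for which `C = K ∩ Q` has area `v`. -/
def admissibleWithArea (α v : ℝ) : Set (Set Plane) :=
  {K | Admissible α K ∧ area (K ∩ Q α) = v}

/-- `K` attains the maximum of the area of `C* = K* ∩ Q` among the admissible bodies for which
`C = K ∩ Q` has area `v`. -/
def IsMaximizer (α v : ℝ) (K : Set Plane) : Prop :=
  K ∈ admissibleWithArea α v ∧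
    IsMaxOn (fun K' => area (polarBody K' ∩ Q α)) (admissibleWithArea α v) K

/-- `E` is an ellipse (the curve) with centre `o`, and `J` is the closed arc of `E` that joins `p`
to `q` in the positive (counterclockwise) sense. A linear map of positive determinant carries `S¹`
to an ellipse with centre `o` and preserves the sense of rotation. -/
def IsEllipticArc (E J : Set Plane) (p q : Plane) : Prop :=
  ∃ L : Plane →ₗ[ℝ] Plane, 0 < LinearMap.det L ∧
    E = L '' Metric.sphere 0 1 ∧
    ∃ θ₁ θ₂ : ℝ, θ₁ < θ₂ ∧ θ₂ < θ₁ + 2 * Real.pi ∧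
      L (circlePt θ₁) = p ∧ L (circlePt θ₂) = q ∧
      J = (fun θ => L (circlePt θ)) '' Icc θ₁ θ₂

/-- The set `l` is a supporting line of `S`. -/
def IsSupportingLine (l S : Set Plane) : Prop :=
  ∃ (u : Plane) (r : ℝ), u ≠ 0 ∧ l = {x | ⟪u, x⟫ = r} ∧
    (∀ x ∈ S, ⟪u, x⟫ ≤ r) ∧ (l ∩ S).Nonempty

/-- The boundary of `C` is the union of `[o, a]`, `[o, c]` and an arc, contained in `B²`, from `a`
to `c` of an ellipse with centre `o`. -/
def IsEllipticSector (α : ℝ) (C : Set Plane) : Prop :=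
  ∃ E J : Set Plane, IsEllipticArc E J (ptA α) (ptC α) ∧
    J ⊆ Metric.closedBall 0 1 ∧
    frontier C = segment ℝ 0 (ptA α) ∪ segment ℝ 0 (ptC α) ∪ J

/-- The boundary of `C` is the union of `[o, a]`, `[o, c]`, two nondegenerate segments `[a, a']`,
`[c, c']` of equal length on the lines `ab` and `cb`, and an arc from `a'` to `c'` of an ellipse
with centre `o` that has the lines `ab` and `cb` as supporting lines. -/
def IsTangentEllipticSector (α : ℝ) (C : Set Plane) : Prop :=
  ∃ (a' c' : Plane) (E J : Set Plane),
    a' ∈ affineSpan ℝ {ptA α, ptB α} ∧ c' ∈ affineSpan ℝ {ptC α, ptB α} ∧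
    a' ≠ ptA α ∧ dist (ptA α) a' = dist (ptC α) c' ∧
    IsEllipticArc E J a' c' ∧
    IsSupportingLine (affineSpan ℝ {ptA α, ptB α} : Set Plane) E ∧
    IsSupportingLine (affineSpan ℝ {ptC α, ptB α} : Set Plane) E ∧
    frontier C = segment ℝ 0 (ptA α) ∪ segment ℝ 0 (ptC α) ∪
      segment ℝ (ptA α) a' ∪ segment ℝ (ptC α) c' ∪ J

end Deltoid

end

namespace Deltoid

open MeasureTheory Filter Topology

/-! For each `β ∈ (0, α]` there are two mutually polar ellipses with centre `o` in axis position: an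
inner one through `a` and `c`, and an outer one touching the lines `ab` and `cb`; both special
points have eccentric angle `±β`. With outer semiaxes `P`, `R` they cut out of `Q` an inner region
of area `β / (P R)` and an outer region of area `P R (β + s)`, where `s = tanGap α β` accounts for
the triangles at `a` and `c`. The claim is that each region is the best partner of the other.

The upper bound comes from symmetrization. Steiner symmetrization of `C` about the axis, together
with averaging `C*` with its mirror image on horizontal lines, keeps the pair polar and loses no
area (`PolarPair.exists_halves`). It remains to treat polar sets `X`, `Y` in the upper half of the
sector. The linear map that turns the outer ellipse into the unit circle places `X` in the angle
`[0, β]`, and there `X` and `Y` satisfy a Blaschke–Santaló inequality with product of radial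
integrals at most `β ^ 2` (`integral_sq_mul_integral_sq_le`, proved by transport). Beyond the angle
`β`, `Y` lies below the tangent at the image of `c`, which gives the constant `s`
(`exists_volume_le_of_polar`). Hence if one set is at least as large as its model region, the other
is at most as large as its own (`PolarPair.le_of_inner_le`, `PolarPair.le_of_outer_le`).

Sharpness follows by a squeeze: a body whose section has the described boundary contains one model
region, and its polar contains the other. The descriptions by elliptic arcs are brought to the
parameter `β` by `IsEllipticArc.exists_stretch`; bodies exist for every `v` because the two area
functions together take all values in `(cos α sin α, tan α)`, by the intermediate value theorem, and
a body with a given model section is cut out by polars (`bodyOf`). -/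

/-! ### A Blaschke–Santaló inequality on an arc shorter than a quarter circle -/

lemma two_mul_le_add_of_mul_eq_sq {u v w : ℝ} (hu : 0 ≤ u) (hv : 0 ≤ v) (h : u * v = w ^ 2) :
    2 * w ≤ u + v := by
  nlinarith [sq_nonneg (u - v), abs_le_of_sq_le_sq' (show (2 * w) ^ 2 ≤ (u + v) ^ 2 by
    nlinarith [sq_nonneg (u - v)]) (by positivity)]

/-- The angle whose tangent is the geometric mean of the tangents of two angles moves at least as
fast as the geometric mean of their speeds, up to the cosine of their difference. -/
lemma exists_hasDerivAt_arctan_sqrt_tan {k e φ : ℝ} {Ψ : ℝ → ℝ} (hk : 0 < k)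
    (hΨ : HasDerivAt Ψ (e ^ 2) φ) (hx : k * Ψ φ ∈ Ioo 0 (Real.pi / 2))
    (hy : k * φ ∈ Ioo 0 (Real.pi / 2)) :
    ∃ D, HasDerivAt (fun t => Real.arctan √(Real.tan (k * Ψ t) * Real.tan (k * t))) D φ ∧
      k * e ≤ D * Real.cos (k * (Ψ φ - φ)) := by
  have cx : 0 < Real.cos (k * Ψ φ) := Real.cos_pos_of_mem_Ioo ⟨by linarith [hx.1, Real.pi_pos], hx.2⟩
  have cy : 0 < Real.cos (k * φ) := Real.cos_pos_of_mem_Ioo ⟨by linarith [hy.1, Real.pi_pos], hy.2⟩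
  have sx : 0 < Real.sin (k * Ψ φ) :=
    Real.sin_pos_of_pos_of_lt_pi hx.1 (by linarith [hx.2, Real.pi_pos])
  have sy : 0 < Real.sin (k * φ) :=
    Real.sin_pos_of_pos_of_lt_pi hy.1 (by linarith [hy.2, Real.pi_pos])
  have h1 : HasDerivAt (fun t => Real.tan (k * Ψ t)) (1 / Real.cos (k * Ψ φ) ^ 2 * (k * e ^ 2)) φ :=
    HasDerivAt.comp φ (h := fun t => k * Ψ t) (Real.hasDerivAt_tan cx.ne') (hΨ.const_mul k)
  have h2 : HasDerivAt (fun t => Real.tan (k * t)) (1 / Real.cos (k * φ) ^ 2 * (k * 1)) φ :=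
    HasDerivAt.comp φ (h := fun t => k * t) (Real.hasDerivAt_tan cy.ne')
      ((hasDerivAt_id φ).const_mul k)
  have tx : 0 < Real.tan (k * Ψ φ) := Real.tan_pos_of_pos_of_lt_pi_div_two hx.1 hx.2
  have ty : 0 < Real.tan (k * φ) := Real.tan_pos_of_pos_of_lt_pi_div_two hy.1 hy.2
  have h3 := ((h1.mul h2).sqrt (mul_pos tx ty).ne').arctan
  refine ⟨_, h3, ?_⟩
  have hz : 0 < √(Real.tan (k * Ψ φ) * Real.tan (k * φ)) := Real.sqrt_pos.2 (mul_pos tx ty)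
  have hz2 : √(Real.tan (k * Ψ φ) * Real.tan (k * φ)) ^ 2 = _ := Real.sq_sqrt (mul_pos tx ty).le
  simp only [Pi.mul_apply]
  rw [mul_sub, Real.cos_sub]
  generalize √(Real.tan (k * Ψ φ) * Real.tan (k * φ)) = z at *
  rw [hz2]
  rw [Real.tan_eq_sin_div_cos, Real.tan_eq_sin_div_cos] at hz2 ⊢
  generalize Real.cos (k * Ψ φ) = a at *
  generalize Real.cos (k * φ) = b at *
  generalize Real.sin (k * Ψ φ) = s at *
  generalize Real.sin (k * φ) = t at *
  -- Arithmetic-geometric mean for the two terms that the product rule gives.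
  have key : 2 * (e * z / (a * b)) ≤ e ^ 2 * t / (a ^ 2 * b) + s / (a * b ^ 2) := by
    apply two_mul_le_add_of_mul_eq_sq (by positivity) (by positivity)
    rw [div_pow, mul_pow, hz2]
    field_simp
  have : (1 / (1 + s / a * (t / b)) *
      ((1 / a ^ 2 * (k * e ^ 2) * (t / b) + s / a * (1 / b ^ 2 * (k * 1))) / (2 * z))) *
      (a * b + s * t) =
      k * (e ^ 2 * t / (a ^ 2 * b) + s / (a * b ^ 2)) * (a * b) / (2 * z) := by
    field_simp
  rw [this, le_div_iff₀ (by positivity)]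
  calc k * e * (2 * z) = k * (2 * (e * z / (a * b))) * (a * b) := by field_simp
    _ ≤ _ := by gcongr

/-- A transport argument. The map `Ψ` carries `m² g² dx` to `f² dx`, so its speed at `u` is `(m g(u)
/ f(Ψ u))²`, and polarity at the pair `(Ψ u, u)` bounds that speed from below. The angle `τ`, a
geometric mean of `Ψ u` and `u` on the tangent scale, then moves with speed at least `k m g²`, while
all its values lie in `[0, π / 2)`. Integration bounds `m ∫ g²` by `β`. -/
lemma integral_sq_mul_integral_sq_le_aux {β : ℝ} (hβ : β ∈ Ioo 0 (Real.pi / 2)) {f g : ℝ → ℝ}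
    (hf : Continuous f) (hg : Continuous g) (hf0 : ∀ x, 0 < f x) (hg0 : ∀ x, 0 < g x)
    {δ : ℝ} (hδ : 0 < δ) (hfδ : ∀ x, δ ≤ f x)
    (hfg : ∀ x ∈ Icc 0 β, ∀ y ∈ Icc 0 β, f x * g y * Real.cos (x - y) ≤ 1) :
    (∫ x in 0..β, f x ^ 2) * (∫ x in 0..β, g x ^ 2) ≤ β ^ 2 := by
  obtain ⟨hβ0, hβ1⟩ := hβ
  set G₁ : ℝ → ℝ := fun u => ∫ x in 0..u, f x ^ 2 with hG₁
  set G₂ : ℝ → ℝ := fun u => ∫ x in 0..u, g x ^ 2 with hG₂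
  have d₁ : ∀ u, HasDerivAt G₁ (f u ^ 2) u := fun u =>
    intervalIntegral.integral_hasDerivAt_right ((hf.pow 2).intervalIntegrable _ _)
      ((hf.pow 2).stronglyMeasurableAtFilter _ _) (hf.pow 2).continuousAt
  have d₂ : ∀ u, HasDerivAt G₂ (g u ^ 2) u := fun u =>
    intervalIntegral.integral_hasDerivAt_right ((hg.pow 2).intervalIntegrable _ _)
      ((hg.pow 2).stronglyMeasurableAtFilter _ _) (hg.pow 2).continuousAt
  have m₁ : StrictMono G₁ := strictMono_of_deriv_pos fun u => by
    rw [(d₁ u).deriv]; exact pow_pos (hf0 u) 2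
  have m₂ : StrictMono G₂ := strictMono_of_deriv_pos fun u => by
    rw [(d₂ u).deriv]; exact pow_pos (hg0 u) 2
  have z₁ : G₁ 0 = 0 := by simp [hG₁]
  have z₂ : G₂ 0 = 0 := by simp [hG₂]
  have c₁ : Continuous G₁ := continuous_iff_continuousAt.2 fun u => (d₁ u).continuousAt
  have c₂ : Continuous G₂ := continuous_iff_continuousAt.2 fun u => (d₂ u).continuousAt
  -- The bound `f ≥ δ` makes `G₁` grow at least linearly, hence onto `ℝ` and invertible.
  have mono : Monotone fun u => G₁ u - δ ^ 2 * u := monotone_of_deriv_nonneg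
    (fun u => ((d₁ u).sub ((hasDerivAt_id u).const_mul (δ ^ 2))).differentiableAt) fun u => by
      have h := ((d₁ u).sub ((hasDerivAt_id u).const_mul (δ ^ 2))).deriv
      have h' : deriv (fun u => G₁ u - δ ^ 2 * u) u = f u ^ 2 - δ ^ 2 * 1 := h
      rw [h']
      nlinarith [hfδ u]
  have hsurj : Function.Surjective G₁ := by
    refine c₁.surjective ?_ ?_
    · refine tendsto_atTop_mono' atTop ?_ (tendsto_id.const_mul_atTop (pow_pos hδ 2))
      filter_upwards [eventually_ge_atTop 0] with u hu
      have := mono hu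
      simp only [z₁, id] at this ⊢; linarith
    · refine tendsto_atBot_mono' atBot ?_ (tendsto_id.const_mul_atBot (pow_pos hδ 2))
      filter_upwards [eventually_le_atBot 0] with u hu
      have := mono hu
      simp only [z₁, id] at this ⊢; linarith
  set E := m₁.orderIsoOfSurjective G₁ hsurj with hE
  have hEG : ∀ u, E u = G₁ u := fun u => rfl
  have T₁ : 0 < G₁ β := z₁ ▸ m₁ hβ0
  have T₂ : 0 < G₂ β := z₂ ▸ m₂ hβ0
  change G₁ β * G₂ β ≤ β ^ 2
  -- The factor `m²` equalizes the total masses, so that `Ψ` maps `(0, β)` into itself.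
  set m : ℝ := √(G₁ β / G₂ β) with hm
  have m0 : 0 < m := Real.sqrt_pos.2 (div_pos T₁ T₂)
  have mm : m ^ 2 = G₁ β / G₂ β := Real.sq_sqrt (div_pos T₁ T₂).le
  set Ψ : ℝ → ℝ := fun u => E.symm (m ^ 2 * G₂ u) with hΨdef
  have hGΨ : ∀ u, G₁ (Ψ u) = m ^ 2 * G₂ u := fun u => E.apply_symm_apply _
  have dΨ : ∀ u, HasDerivAt Ψ ((m * g u / f (Ψ u)) ^ 2) u := by
    intro u
    have h1 : HasDerivAt E.symm (f (Ψ u) ^ 2)⁻¹ (m ^ 2 * G₂ u) :=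
      HasDerivAt.of_local_left_inverse (f := G₁) E.symm.continuous.continuousAt (d₁ _)
        (pow_pos (hf0 _) 2).ne' (Eventually.of_forall fun y => E.apply_symm_apply y)
    refine (h1.comp u ((d₂ u).const_mul (m ^ 2))).congr_deriv ?_
    have := (hf0 (Ψ u)).ne'
    field_simp
  have Ψmem : ∀ u ∈ Ioo 0 β, Ψ u ∈ Ioo 0 β := by
    intro u hu
    constructor
    · rw [← m₁.lt_iff_lt, z₁, hGΨ]
      have := m₂ hu.1
      rw [z₂] at this; positivity
    · rw [← m₁.lt_iff_lt, hGΨ, mm, div_mul_eq_mul_div, div_lt_iff₀ T₂]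
      exact mul_lt_mul_of_pos_left (m₂ hu.2) T₁
  -- Stretching by `k` turns `[0, β]` into a quarter circle. As `k ≥ 1`, it enlarges angle
  -- differences, so the cosine in the polarity condition only decreases.
  set k : ℝ := Real.pi / (2 * β) with hk
  have k1 : 1 ≤ k := by rw [hk, le_div_iff₀ (by positivity)]; linarith
  have kβ : k * β = Real.pi / 2 := by rw [hk]; field_simp
  have kmem : ∀ u ∈ Ioo 0 β, k * u ∈ Ioo 0 (Real.pi / 2) := fun u hu =>
    ⟨mul_pos (by linarith) hu.1, by rw [← kβ]; exact mul_lt_mul_of_pos_left hu.2 (by linarith)⟩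
  set τ : ℝ → ℝ := fun t => Real.arctan √(Real.tan (k * Ψ t) * Real.tan (k * t)) with hτ
  have dτ : ∀ u ∈ Ioo 0 β, ∃ D, HasDerivAt τ D u ∧ k * m * g u ^ 2 ≤ D := by
    intro u hu
    have hv := Ψmem u hu
    obtain ⟨D, hD, hle⟩ := exists_hasDerivAt_arctan_sqrt_tan (by linarith) (dΨ u)
      (kmem _ hv) (kmem _ hu)
    refine ⟨D, hD, ?_⟩
    have hlt : |k * (Ψ u - u)| < Real.pi / 2 := by
      have h1 := kmem _ hv
      have h2 := kmem _ hu
      rw [abs_lt]; constructor <;> nlinarith [h1.1, h1.2, h2.1, h2.2]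
    have hC : 0 < Real.cos (k * (Ψ u - u)) :=
      Real.cos_pos_of_mem_Ioo ⟨(abs_lt.1 hlt).1, (abs_lt.1 hlt).2⟩
    have hCC : Real.cos (k * (Ψ u - u)) ≤ Real.cos (Ψ u - u) := by
      rw [← Real.cos_abs (k * _), ← Real.cos_abs (Ψ u - u)]
      apply Real.cos_le_cos_of_nonneg_of_le_pi (abs_nonneg _) (by linarith [Real.pi_pos])
      rw [abs_mul, abs_of_pos (by linarith : 0 < k)]
      nlinarith [abs_nonneg (Ψ u - u)]
    have h1 := hfg _ ⟨hv.1.le, hv.2.le⟩ _ ⟨hu.1.le, hu.2.le⟩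
    have h2 : m * g u ^ 2 * Real.cos (k * (Ψ u - u)) ≤ m * g u / f (Ψ u) := by
      rw [le_div_iff₀ (hf0 _)]
      have h3 : f (Ψ u) * g u * Real.cos (k * (Ψ u - u)) ≤ 1 :=
        (mul_le_mul_of_nonneg_left hCC (mul_pos (hf0 _) (hg0 _)).le).trans h1
      calc _ = m * g u * (f (Ψ u) * g u * Real.cos (k * (Ψ u - u))) := by ring
        _ ≤ m * g u * 1 := mul_le_mul_of_nonneg_left h3 (mul_pos m0 (hg0 u)).le
        _ = _ := mul_one _
    refine le_of_mul_le_mul_right ?_ hC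
    calc _ = k * (m * g u ^ 2 * Real.cos (k * (Ψ u - u))) := by ring
      _ ≤ k * (m * g u / f (Ψ u)) := mul_le_mul_of_nonneg_left h2 (by linarith)
      _ ≤ _ := hle
  have hmono : MonotoneOn (fun u => τ u - k * m * G₂ u) (Ioo 0 β) := by
    have hd : ∀ u ∈ Ioo 0 β, ∃ D, HasDerivAt (fun u => τ u - k * m * G₂ u) D u ∧ 0 ≤ D := by
      intro u hu
      obtain ⟨D, hD, hle⟩ := dτ u hu
      exact ⟨_, hD.sub ((d₂ u).const_mul (k * m)), by linarith⟩
    refine monotoneOn_of_deriv_nonneg (convex_Ioo _ _) ?_ ?_ ?_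
    · intro u hu
      obtain ⟨D, hD, -⟩ := hd u hu
      exact hD.continuousAt.continuousWithinAt
    · intro u hu
      rw [interior_Ioo] at hu
      obtain ⟨D, hD, -⟩ := hd u hu
      exact hD.differentiableAt.differentiableWithinAt
    · intro u hu
      rw [interior_Ioo] at hu
      obtain ⟨D, hD, h0⟩ := hd u hu
      rwa [hD.deriv]
  have hbound : ∀ u ∈ Ioo 0 β, ∀ w ∈ Ioo 0 β, u ≤ w → k * m * (G₂ w - G₂ u) ≤ Real.pi / 2 := by
    intro u hu w hw huw
    have h1 := hmono hu hw huw
    have h2 : τ w < Real.pi / 2 := Real.arctan_lt_pi_div_two _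
    have h3 : 0 ≤ τ u := Real.arctan_nonneg.2 (Real.sqrt_nonneg _)
    simp only at h1
    linarith
  -- At the ends of `[0, β]` the tangents degenerate, so the bound is taken on `[ε, β - ε]` and `ε`
  -- tends to `0`.
  have hlim : k * m * G₂ β ≤ Real.pi / 2 := by
    have t1 : Tendsto (fun ε : ℝ => k * m * (G₂ (β - ε) - G₂ ε)) (𝓝[>] 0)
        (𝓝 (k * m * (G₂ (β - 0) - G₂ 0))) := by
      refine Tendsto.mono_left ?_ nhdsWithin_le_nhds
      exact Continuous.tendsto (by fun_prop) 0
    rw [z₂, sub_zero, sub_zero] at t1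
    refine le_of_tendsto t1 ?_
    have : Ioo 0 (β / 2) ∈ 𝓝[>] (0 : ℝ) := Ioo_mem_nhdsGT (by positivity)
    filter_upwards [this] with ε hε
    exact hbound ε ⟨hε.1, by linarith [hε.2]⟩ (β - ε) ⟨by linarith [hε.2], by linarith [hε.1]⟩
      (by linarith [hε.2])
  have h5 : m * G₂ β ≤ β := by
    rw [← kβ, mul_assoc] at hlim
    exact le_of_mul_le_mul_left hlim (by linarith)
  have h6 : G₁ β * G₂ β = (m * G₂ β) ^ 2 := by rw [mul_pow, mm]; field_simp
  rw [h6]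
  exact pow_le_pow_left₀ (mul_pos m0 T₂).le h5 2

/-- Two positive continuous radial functions on `[0, β]`, `β < π / 2`, that are polar to each other
satisfy the inequality of Blaschke and Santaló. -/
theorem integral_sq_mul_integral_sq_le {β : ℝ} (hβ : β ∈ Ioo 0 (Real.pi / 2)) {f g : ℝ → ℝ}
    (hf : ContinuousOn f (Icc 0 β)) (hg : ContinuousOn g (Icc 0 β))
    (hf0 : ∀ x ∈ Icc 0 β, 0 < f x) (hg0 : ∀ x ∈ Icc 0 β, 0 < g x)
    (hfg : ∀ x ∈ Icc 0 β, ∀ y ∈ Icc 0 β, f x * g y * Real.cos (x - y) ≤ 1) :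
    (∫ x in 0..β, f x ^ 2) * (∫ x in 0..β, g x ^ 2) ≤ β ^ 2 := by
  have h0 : (0 : ℝ) ≤ β := hβ.1.le
  obtain ⟨x₀, hx₀, hmin⟩ := isCompact_Icc.exists_isMinOn (nonempty_Icc.2 h0) hf
  -- Both functions are continued by constants outside `[0, β]`; compactness supplies the positive
  -- lower bound of `f`.
  have key := integral_sq_mul_integral_sq_le_aux hβ
    (f := IccExtend h0 ((Icc 0 β).domRestrict f)) (g := IccExtend h0 ((Icc 0 β).domRestrict g))
    (hf.domRestrict.Icc_extend') (hg.domRestrict.Icc_extend')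
    (fun x => hf0 _ (projIcc 0 β h0 x).2) (fun x => hg0 _ (projIcc 0 β h0 x).2)
    (hf0 x₀ hx₀) (fun x => hmin (projIcc 0 β h0 x).2) (fun x hx y hy => by
      rw [IccExtend_of_mem _ _ hx, IccExtend_of_mem _ _ hy]
      exact hfg x hx y hy)
  have e : ∀ u : ℝ → ℝ, (∫ x in 0..β, IccExtend h0 ((Icc 0 β).domRestrict u) x ^ 2) =
      ∫ x in 0..β, u x ^ 2 := fun u => intervalIntegral.integral_congr fun x hx => by
    rw [uIcc_of_le h0] at hx
    simp only [IccExtend_of_mem _ _ hx]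
    rfl
  rwa [e, e] at key

/-! ### Areas in polar coordinates -/

/-- The points with angle in `[a, b]` below the radial function `ρ`, stretched by `p` and `q`. -/
def radialRegion (p q a b : ℝ) (ρ : ℝ → ℝ) : Set (ℝ × ℝ) :=
  {z | ∃ ψ ∈ Icc a b, ∃ r ∈ Icc 0 (ρ ψ), z = (p * (r * Real.cos ψ), q * (r * Real.sin ψ))}

lemma isCompact_radialRegion {p q a b : ℝ} {ρ : ℝ → ℝ} (hρ : ContinuousOn ρ (Icc a b))
    (h0 : ∀ x ∈ Icc a b, 0 ≤ ρ x) : IsCompact (radialRegion p q a b ρ) := by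
  have : radialRegion p q a b ρ = (fun z : ℝ × ℝ => (p * (z.2 * ρ z.1 * Real.cos z.1),
      q * (z.2 * ρ z.1 * Real.sin z.1))) '' (Icc a b ×ˢ Icc 0 1) := by
    ext z
    constructor
    · rintro ⟨ψ, hψ, r, hr, rfl⟩
      rcases (h0 ψ hψ).eq_or_lt with h | h
      · refine ⟨(ψ, 0), ⟨hψ, by simp⟩, ?_⟩
        have : r = 0 := le_antisymm (h ▸ hr.2) hr.1
        simp [this]
      · refine ⟨(ψ, r / ρ ψ), ⟨hψ, div_nonneg hr.1 h.le, (div_le_one h).2 hr.2⟩, ?_⟩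
        simp [div_mul_cancel₀ _ h.ne']
    · rintro ⟨⟨ψ, t⟩, ⟨hψ, ht⟩, rfl⟩
      exact ⟨ψ, hψ, t * ρ ψ, ⟨mul_nonneg ht.1 (h0 ψ hψ),
        mul_le_of_le_one_left (h0 ψ hψ) ht.2⟩, rfl⟩
  rw [this]
  refine (isCompact_Icc.prod isCompact_Icc).image_of_continuousOn ?_
  have : ContinuousOn (fun z : ℝ × ℝ => ρ z.1) (Icc a b ×ˢ Icc 0 1) :=
    hρ.comp continuousOn_fst fun z hz => hz.1
  refine ContinuousOn.prodMk ?_ ?_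
  · exact continuousOn_const.mul ((continuousOn_snd.mul this).mul (by fun_prop))
  · exact continuousOn_const.mul ((continuousOn_snd.mul this).mul (by fun_prop))

lemma lintegral_Ioc_ofReal {c : ℝ} (hc : 0 ≤ c) :
    ∫⁻ r in Ioc 0 c, ENNReal.ofReal r = ENNReal.ofReal (c ^ 2 / 2) := by
  rw [← ofReal_integral_eq_lintegral_ofReal, ← intervalIntegral.integral_of_le hc, integral_id]
  · simp
  · exact (continuous_id.intervalIntegrable 0 c).1
  · exact (ae_restrict_iff' measurableSet_Ioc).2 (Eventually.of_forall fun x hx => hx.1.le)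

lemma volume_radialRegion_one {a b : ℝ} (ha : -Real.pi < a) (hab : a ≤ b) (hb : b < Real.pi)
    {ρ : ℝ → ℝ} (hρ : ContinuousOn ρ (Icc a b)) (h0 : ∀ x ∈ Icc a b, 0 ≤ ρ x) :
    volume (radialRegion 1 1 a b ρ) = ENNReal.ofReal ((∫ x in a..b, ρ x ^ 2) / 2) := by
  set S := radialRegion 1 1 a b ρ with hS
  have hm : MeasurableSet S := (isCompact_radialRegion hρ h0).measurableSet
  rw [← lintegral_indicator_one hm, ← lintegral_comp_polarCoord_symm, polarCoord_target]
  -- The angles stay strictly inside `(-π, π)`, where the polar chart is injective, so `θ` and `r`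
  -- are determined by the point.
  have hmem : ∀ r θ : ℝ, 0 < r → θ ∈ Ioo (-Real.pi) Real.pi →
      (polarCoord.symm (r, θ) ∈ S ↔ θ ∈ Icc a b ∧ r ≤ ρ θ) := by
    intro r θ hr hθ
    constructor
    · rintro ⟨ψ, hψ, t, ht, e⟩
      have ht0 : 0 < t := by
        rcases ht.1.eq_or_lt with h | h
        · exfalso
          simp only [polarCoord_symm_apply, ← h, zero_mul, mul_zero, Prod.mk.injEq, mul_eq_zero,
            hr.ne', false_or] at e
          have := Real.sin_sq_add_cos_sq θ
          simp [e.1, e.2] at this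
        · exact h
      have : ((r, θ) : ℝ × ℝ) = (t, ψ) := by
        refine polarCoord.symm.injOn (x₁ := (r, θ)) (x₂ := (t, ψ)) ⟨hr, hθ⟩
          ⟨ht0, lt_of_lt_of_le ha hψ.1, lt_of_le_of_lt hψ.2 hb⟩ ?_
        rw [e]; simp [polarCoord_symm_apply]
      simp only [Prod.mk.injEq] at this
      rw [this.1, this.2]
      exact ⟨hψ, ht.2⟩
    · rintro ⟨h1, h2⟩
      exact ⟨θ, h1, r, ⟨hr.le, h2⟩, by simp [polarCoord_symm_apply]⟩
  rw [Measure.volume_eq_prod, ← Measure.prod_restrict, lintegral_prod_symm]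
  · have h1 : ∀ θ ∈ Ioo (-Real.pi) Real.pi, ∫⁻ r in Ioi 0,
        ENNReal.ofReal r • S.indicator 1 (polarCoord.symm (r, θ)) =
        (Icc a b).indicator (fun θ => ENNReal.ofReal (ρ θ ^ 2 / 2)) θ := by
      intro θ hθ
      by_cases hc : θ ∈ Icc a b
      · rw [indicator_of_mem hc, ← lintegral_Ioc_ofReal (h0 θ hc),
          ← lintegral_indicator measurableSet_Ioi, ← lintegral_indicator measurableSet_Ioc]
        refine lintegral_congr fun r => ?_
        by_cases hr : 0 < r
        · rw [indicator_of_mem (show r ∈ Ioi 0 from hr)]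
          by_cases h2 : r ≤ ρ θ
          · rw [indicator_of_mem ((hmem r θ hr hθ).2 ⟨hc, h2⟩), indicator_of_mem (show r ∈ Ioc 0 (ρ θ) from ⟨hr, h2⟩)]
            simp
          · rw [indicator_of_notMem fun h => h2 ((hmem r θ hr hθ).1 h).2,
              indicator_of_notMem fun h : r ∈ Ioc 0 (ρ θ) => h2 h.2]
            simp
        · rw [indicator_of_notMem (show r ∉ Ioi 0 from hr),
            indicator_of_notMem fun h : r ∈ Ioc 0 (ρ θ) => hr h.1]
      · rw [indicator_of_notMem hc, setLIntegral_congr_fun (g := fun _ => 0) measurableSet_Ioi]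
        · simp
        · intro r hr
          simp only
          rw [indicator_of_notMem fun h => hc ((hmem r θ hr hθ).1 h).1]
          simp
    rw [setLIntegral_congr_fun measurableSet_Ioo h1, lintegral_indicator measurableSet_Icc,
      Measure.restrict_restrict measurableSet_Icc,
      inter_eq_left.2 (Icc_subset_Ioo ha hb),
      ← ofReal_integral_eq_lintegral_ofReal, integral_Icc_eq_integral_Ioc,
      ← intervalIntegral.integral_of_le hab, intervalIntegral.integral_div]
    · exact ContinuousOn.integrableOn_Icc (by fun_prop)
    · exact Eventually.of_forall fun x => by positivity
  · refine Measurable.aemeasurable ?_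
    refine Measurable.smul (ENNReal.measurable_ofReal.comp measurable_fst) ?_
    exact (measurable_one.indicator hm).comp continuous_polarCoord_symm.measurable

theorem volume_radialRegion {p q a b : ℝ} (hp : 0 < p) (hq : 0 < q) (ha : -Real.pi < a)
    (hab : a ≤ b) (hb : b < Real.pi) {ρ : ℝ → ℝ} (hρ : ContinuousOn ρ (Icc a b))
    (h0 : ∀ x ∈ Icc a b, 0 ≤ ρ x) :
    volume (radialRegion p q a b ρ) = ENNReal.ofReal (p * q * (∫ x in a..b, ρ x ^ 2) / 2) := by
  have : radialRegion p q a b ρ =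
      (LinearMap.prodMap (p • LinearMap.id) (q • LinearMap.id) : ℝ × ℝ →ₗ[ℝ] ℝ × ℝ) ''
        radialRegion 1 1 a b ρ := by
    ext z
    constructor
    · rintro ⟨ψ, hψ, r, hr, rfl⟩
      exact ⟨_, ⟨ψ, hψ, r, hr, rfl⟩, by simp⟩
    · rintro ⟨_, ⟨ψ, hψ, r, hr, rfl⟩, rfl⟩
      exact ⟨ψ, hψ, r, hr, by simp⟩
  rw [this, Measure.addHaar_image_linearMap, volume_radialRegion_one ha hab hb hρ h0,
    LinearMap.det_prodMap, ← ENNReal.ofReal_mul (abs_nonneg _)]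
  congr 1
  simp only [LinearMap.det_smul, Module.finrank_self, pow_one, LinearMap.det_id, mul_one]
  rw [abs_of_pos (mul_pos hp hq)]; ring

/-- The angle `arctan (w / u)` serves for `u > 0`; at the origin the angle `0` is chosen, which
keeps the bounds on `ψ`. The clause on signs is what sets in the upper half of the sector need. -/
lemma exists_polar_of_abs_le {u w t : ℝ} (ht : 0 ≤ t) (h : |w| ≤ u * t) (hu : 0 ≤ u) :
    ∃ r ψ : ℝ, 0 ≤ r ∧ |ψ| ≤ Real.arctan t ∧ (0 ≤ w → 0 ≤ ψ) ∧ u = r * Real.cos ψ ∧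
      w = r * Real.sin ψ := by
  rcases hu.eq_or_lt with h0 | h0
  · refine ⟨0, 0, le_rfl, by simpa using ht, fun _ => le_rfl, by simp [← h0], ?_⟩
    rw [← h0, zero_mul] at h
    simpa using h
  · have hc : 0 < Real.cos (Real.arctan (w / u)) := Real.cos_arctan_pos _
    refine ⟨u / Real.cos (Real.arctan (w / u)), Real.arctan (w / u), by positivity, ?_,
      fun hw => Real.arctan_nonneg.2 (by positivity), by field_simp, ?_⟩
    · rw [abs_le, ← Real.arctan_neg]
      rw [abs_le] at h
      constructor <;> apply Real.arctan_mono
      · rw [le_div_iff₀ h0]; linarith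
      · rw [div_le_iff₀ h0]; linarith
    · rw [div_mul_eq_mul_div, mul_div_assoc, ← Real.tan_eq_sin_div_cos, Real.tan_arctan]
      field_simp

lemma integral_inv_cos_sq {β γ : ℝ} (h : β ≤ γ) (h' : γ - β < Real.pi / 2) :
    ∫ x in β..γ, (1 / Real.cos (x - β)) ^ 2 = Real.tan (γ - β) := by
  have hc : ∀ x ∈ uIcc β γ, Real.cos (x - β) ≠ 0 := fun x hx => by
    rw [uIcc_of_le h] at hx
    exact (Real.cos_pos_of_mem_Ioo ⟨by linarith [hx.1, Real.pi_pos], by linarith [hx.2]⟩).ne'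
  rw [intervalIntegral.integral_eq_sub_of_hasDerivAt (f := fun x => Real.tan (x - β))]
  · simp
  · intro x hx
    have := HasDerivAt.comp x (h := fun x => x - β) (Real.hasDerivAt_tan (hc x hx))
      ((hasDerivAt_id x).sub_const β)
    refine this.congr_deriv ?_
    simp
  · refine ContinuousOn.intervalIntegrable ?_
    refine ContinuousOn.pow (ContinuousOn.div₀ continuousOn_const (by fun_prop) hc) 2

/-! ### The parameters of the two polar ellipses -/

/-- The horizontal semiaxis of the ellipse with centre `o` that touches the line `bc` at the point
with eccentric angle `β`. -/
noncomputable def semiX (α β : ℝ) : ℝ := Real.cos β / Real.cos α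

/-- The vertical semiaxis of the ellipse with centre `o` that touches the line `bc` at the point
with eccentric angle `β`. -/
noncomputable def semiY (α β : ℝ) : ℝ := Real.sin β / Real.sin α

/-- The tangent of the angle between the images of `c` and of the point of contact, after the
ellipse is mapped to the unit circle. -/
noncomputable def tanGap (α β : ℝ) : ℝ :=
  Real.sin α ^ 2 * Real.cos β / Real.sin β - Real.cos α ^ 2 * Real.sin β / Real.cos β

/-- The eccentric angle of `c` with respect to the ellipse that touches `bc`. -/
noncomputable def outerAngle (α β : ℝ) : ℝ :=
  Real.arctan (Real.sin α ^ 2 * Real.cos β / (Real.cos α ^ 2 * Real.sin β))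

/-- The condition `β ≤ α` puts the point of contact of the outer ellipse between `b` and `c`, and
the arc of the inner ellipse inside the unit disc; `β = α` is the unit circle itself. -/
structure Angles (α β : ℝ) : Prop where
  pos : 0 < β
  le : β ≤ α
  lt : α < Real.pi / 2

lemma outerAngle_lt (α β : ℝ) : outerAngle α β < Real.pi / 2 := Real.arctan_lt_pi_div_two _

namespace Angles

lemma sinβ {α β : ℝ} (h : Angles α β) : 0 < Real.sin β :=
  Real.sin_pos_of_pos_of_lt_pi h.pos (by linarith [h.le, h.lt, Real.pi_pos])

lemma cosβ {α β : ℝ} (h : Angles α β) : 0 < Real.cos β :=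
  Real.cos_pos_of_mem_Ioo ⟨by linarith [h.pos, Real.pi_pos], by linarith [h.le, h.lt]⟩

lemma sinα {α β : ℝ} (h : Angles α β) : 0 < Real.sin α :=
  Real.sin_pos_of_pos_of_lt_pi (by linarith [h.pos, h.le]) (by linarith [h.lt, Real.pi_pos])

lemma cosα {α β : ℝ} (h : Angles α β) : 0 < Real.cos α :=
  Real.cos_pos_of_mem_Ioo ⟨by linarith [h.pos, h.le, Real.pi_pos], h.lt⟩

lemma semiX_pos {α β : ℝ} (h : Angles α β) : 0 < semiX α β := div_pos h.cosβ h.cosα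

lemma semiY_pos {α β : ℝ} (h : Angles α β) : 0 < semiY α β := div_pos h.sinβ h.sinα

lemma semiX_mul {α β : ℝ} (h : Angles α β) : semiX α β * Real.cos α = Real.cos β := div_mul_cancel₀ _ h.cosα.ne'

lemma semiY_mul {α β : ℝ} (h : Angles α β) : semiY α β * Real.sin α = Real.sin β := div_mul_cancel₀ _ h.sinα.ne'

lemma cosα_le {α β : ℝ} (h : Angles α β) : Real.cos α ≤ Real.cos β :=
  Real.cos_le_cos_of_nonneg_of_le_pi h.pos.le (by linarith [h.lt, Real.pi_pos]) h.le

lemma sinβ_le {α β : ℝ} (h : Angles α β) : Real.sin β ≤ Real.sin α :=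
  Real.sin_le_sin_of_le_of_le_pi_div_two (by linarith [h.pos, Real.pi_pos]) h.lt.le h.le

/-- On the outer ellipse the ray through `c` comes after the point of contact, because `sin β ≤ sin
α` and `cos α ≤ cos β`. -/
lemma le_outerAngle {α β : ℝ} (h : Angles α β) : β ≤ outerAngle α β := by
  have hs := h.sinβ; have hc := h.cosβ; have hsa := h.sinα; have hca := h.cosα
  have h1 : Real.arctan (Real.tan β) ≤ outerAngle α β := by
    apply Real.arctan_mono
    rw [Real.tan_eq_sin_div_cos, div_le_div_iff₀ hc (by positivity)]
    have h2 := pow_le_pow_left₀ hs.le h.sinβ_le 2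
    have h3 := pow_le_pow_left₀ hca.le h.cosα_le 2
    nlinarith [mul_le_mul h2 h3 (by positivity) (by positivity)]
  rwa [Real.arctan_tan (by linarith [h.pos, Real.pi_pos]) (by linarith [h.le, h.lt])] at h1

/-- The subtraction formula for the tangent, with denominators simplified by `sin² α + cos² α = 1`.
It identifies `tanGap` as the length of the tangent of the unit circle from the contact point to the
image of `c`. -/
lemma tan_outerAngle_sub {α β : ℝ} (h : Angles α β) : Real.tan (outerAngle α β - β) = tanGap α β := by
  have hs := h.sinβ; have hc := h.cosβ; have hsa := h.sinα; have hca := h.cosα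
  have hcγ : 0 < Real.cos (outerAngle α β) := Real.cos_arctan_pos _
  have ht : Real.sin (outerAngle α β) =
      Real.cos (outerAngle α β) * (Real.sin α ^ 2 * Real.cos β / (Real.cos α ^ 2 * Real.sin β)) := by
    rw [mul_comm, ← div_eq_iff hcγ.ne', ← Real.tan_eq_sin_div_cos, outerAngle, Real.tan_arctan]
  rw [Real.tan_eq_sin_div_cos, Real.sin_sub, Real.cos_sub, ht, tanGap]
  generalize Real.cos (outerAngle α β) = k at *
  have h1 := Real.sin_sq_add_cos_sq α
  have : k * Real.cos β + k * (Real.sin α ^ 2 * Real.cos β / (Real.cos α ^ 2 * Real.sin β)) *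
      Real.sin β = k * Real.cos β / Real.cos α ^ 2 := by
    field_simp; linarith
  rw [this]
  field_simp

lemma tanGap_nonneg {α β : ℝ} (h : Angles α β) : 0 ≤ tanGap α β := by
  rw [← h.tan_outerAngle_sub]
  exact Real.tan_nonneg_of_nonneg_of_le_pi_div_two (by linarith [h.le_outerAngle])
    (by linarith [outerAngle_lt α β, h.pos])

end Angles

/-! ### The product inequality in the half sector -/

/-- The part of the half-plane `y ≥ 0` between the axis and the ray from `o` through `c`. -/
def halfCone (α : ℝ) : Set (ℝ × ℝ) := {x | 0 ≤ x.2 ∧ x.2 * Real.cos α ≤ x.1 * Real.sin α}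

lemma fst_nonneg_of_mem_halfCone {α : ℝ} (hs : 0 < Real.sin α) (hc : 0 < Real.cos α) {x : ℝ × ℝ}
    (hx : x ∈ halfCone α) : 0 ≤ x.1 :=
  nonneg_of_mul_nonneg_left ((mul_nonneg hx.1 hc.le).trans hx.2) hs

/-- The product inequality for two polar sets in a sector, relative to an elliptical sector. -/
theorem exists_volume_le_of_polar {α β : ℝ} (h : Angles α β) {X Y : Set (ℝ × ℝ)}
    (hX : X ⊆ halfCone α) (hY : Y ⊆ halfCone α)
    (cX : (Real.cos α, Real.sin α) ∈ X) (cY : (Real.cos α, Real.sin α) ∈ Y)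
    (pol : ∀ x ∈ X, ∀ y ∈ Y, x.1 * y.1 + x.2 * y.2 ≤ 1) :
    ∃ x₀ y₀ : ℝ, 0 < x₀ ∧ 0 < y₀ ∧ x₀ * y₀ ≤ β ^ 2 ∧
      volume X ≤ ENNReal.ofReal (x₀ / (2 * (semiX α β * semiY α β))) ∧
      volume Y ≤ ENNReal.ofReal (semiX α β * semiY α β * (y₀ + tanGap α β) / 2) := by
  have hs := h.sinβ; have hc := h.cosβ; have hsa := h.sinα; have hca := h.cosα
  have hP := h.semiX_pos; have hR := h.semiY_pos
  have ePc := h.semiX_mul; have eRs := h.semiY_mul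
  have hβγ := h.le_outerAngle
  have hγ := outerAngle_lt α β
  have hγd : outerAngle α β = Real.arctan _ := rfl
  have htg := h.tan_outerAngle_sub
  generalize outerAngle α β = γ at *
  generalize tanGap α β = s at *
  generalize semiX α β = P at *
  generalize semiY α β = R at *
  have hβ := h.pos
  have hβ2 : β < Real.pi / 2 := by linarith [h.le, h.lt]
  have cos0 : ∀ ψ ∈ Icc 0 β, 0 < Real.cos ψ := fun ψ hψ =>
    Real.cos_pos_of_mem_Ioo ⟨by linarith [hψ.1, Real.pi_pos], by linarith [hψ.2]⟩
  have sin0 : ∀ ψ ∈ Icc 0 β, 0 ≤ Real.sin ψ := fun ψ hψ =>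
    Real.sin_nonneg_of_nonneg_of_le_pi hψ.1 (by linarith [hψ.2, Real.pi_pos])
  -- the support function of the image of `Y`
  have hYb : Y ⊆ Icc ((0 : ℝ), (0 : ℝ)) (1 / Real.cos α, 1 / Real.sin α) := by
    intro y hy
    have h1 := pol _ cX y hy
    have h2 := hY hy
    have h3 := fst_nonneg_of_mem_halfCone hsa hca h2
    have h4 := mul_nonneg hca.le h3
    have h5 := mul_nonneg hsa.le h2.1
    refine ⟨⟨h3, h2.1⟩, ?_, ?_⟩ <;> simp only
    · rw [le_div_iff₀ hca]; linarith
    · rw [le_div_iff₀ hsa]; linarith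
  have hYc : IsCompact (closure Y) :=
    isCompact_Icc.of_isClosed_subset isClosed_closure (closure_minimal hYb isClosed_Icc)
  -- The sets `X` and `Y` carry no regularity. They are replaced by larger sets with continuous
  -- radial functions: `f` for the polar of the image of `Y`, and `g` for the polar of that, within
  -- the angle `[0, β]`.
  set F : ℝ → ℝ × ℝ → ℝ := fun ψ y => y.1 / P * Real.cos ψ + y.2 / R * Real.sin ψ with hF
  have hFc : Continuous ↿F := by
    simp only [hF, Function.HasUncurry.uncurry, id]
    fun_prop
  set H : ℝ → ℝ := fun ψ => sSup (F ψ '' closure Y) with hH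
  have hHc : Continuous H := hYc.continuous_sSup hFc
  have hFH : ∀ ψ, ∀ y ∈ Y, F ψ y ≤ H ψ := fun ψ y hy =>
    le_csSup (hYc.image (hFc.comp (Continuous.prodMk_right ψ))).bddAbove
      ⟨y, subset_closure hy, rfl⟩
  have hH0 : ∀ ψ ∈ Icc 0 β, 0 < H ψ := fun ψ hψ => by
    refine lt_of_lt_of_le ?_ (hFH ψ _ cY)
    have := cos0 ψ hψ; have := sin0 ψ hψ
    positivity
  set f : ℝ → ℝ := fun ψ => 1 / H ψ with hf
  have hfc : ContinuousOn f (Icc 0 β) :=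
    continuousOn_const.div₀ hHc.continuousOn fun ψ hψ => (hH0 ψ hψ).ne'
  have hf0 : ∀ ψ ∈ Icc 0 β, 0 < f ψ := fun ψ hψ => one_div_pos.2 (hH0 ψ hψ)
  -- the support function of the polar sector
  set f' : ℝ → ℝ := IccExtend hβ.le ((Icc 0 β).domRestrict f) with hf'
  have hfc' : Continuous f' := hfc.domRestrict.Icc_extend'
  have hff' : ∀ ψ ∈ Icc 0 β, f' ψ = f ψ := fun ψ hψ => IccExtend_of_mem _ _ hψ
  set F₂ : ℝ → ℝ → ℝ := fun φ ψ => f' ψ * Real.cos (ψ - φ) with hF₂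
  have hF₂c : Continuous ↿F₂ := by
    simp only [hF₂, Function.HasUncurry.uncurry, id]
    fun_prop
  set H₂ : ℝ → ℝ := fun φ => sSup (F₂ φ '' Icc 0 β) with hH₂
  have hH₂c : Continuous H₂ := isCompact_Icc.continuous_sSup hF₂c
  have hFH₂ : ∀ φ, ∀ ψ ∈ Icc 0 β, f ψ * Real.cos (ψ - φ) ≤ H₂ φ := fun φ ψ hψ => by
    rw [← hff' ψ hψ]
    exact le_csSup (isCompact_Icc.image (hF₂c.comp (Continuous.prodMk_right φ))).bddAbove
      ⟨ψ, hψ, rfl⟩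
  have hH₂0 : ∀ φ ∈ Icc 0 β, 0 < H₂ φ := fun φ hφ => by
    refine lt_of_lt_of_le ?_ (hFH₂ φ φ hφ)
    simpa using hf0 φ hφ
  set g : ℝ → ℝ := fun φ => 1 / H₂ φ with hg
  have hgc : ContinuousOn g (Icc 0 β) :=
    continuousOn_const.div₀ hH₂c.continuousOn fun ψ hψ => (hH₂0 ψ hψ).ne'
  have hg0 : ∀ φ ∈ Icc 0 β, 0 < g φ := fun φ hφ => one_div_pos.2 (hH₂0 φ hφ)
  have hfg : ∀ x ∈ Icc 0 β, ∀ y ∈ Icc 0 β, f x * g y * Real.cos (x - y) ≤ 1 := by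
    intro x hx y hy
    have : f x * g y * Real.cos (x - y) = f x * Real.cos (x - y) / H₂ y := by
      simp only [hg]; ring
    rw [this, div_le_one (hH₂0 y hy)]
    exact hFH₂ y x hx
  have pos : ∀ u : ℝ → ℝ, ContinuousOn u (Icc 0 β) → (∀ x ∈ Icc 0 β, 0 < u x) →
      0 < ∫ x in 0..β, u x ^ 2 := fun u hu hu0 =>
    intervalIntegral.intervalIntegral_pos_of_pos_on
      (ContinuousOn.intervalIntegrable (by rw [uIcc_of_le hβ.le]; exact hu.pow 2))
      (fun x hx => pow_pos (hu0 x (Ioo_subset_Icc_self hx)) 2) hβ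
  refine ⟨∫ x in 0..β, f x ^ 2, ∫ x in 0..β, g x ^ 2, pos f hfc hf0, pos g hgc hg0,
    integral_sq_mul_integral_sq_le ⟨hβ, hβ2⟩ hfc hgc hf0 hg0 hfg, ?_, ?_⟩
  · have hsub : X ⊆ radialRegion (1 / P) (1 / R) 0 β f := by
      intro x hx
      have h1 := hX hx
      have h2 := fst_nonneg_of_mem_halfCone hsa hca h1
      obtain ⟨r, ψ, hr, hψ, hψ0, e1, e2⟩ := exists_polar_of_abs_le (u := P * x.1) (w := R * x.2)
        (t := Real.tan β) (by rw [Real.tan_eq_sin_div_cos]; positivity) (by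
          rw [abs_of_nonneg (mul_nonneg hR.le h1.1), Real.tan_eq_sin_div_cos, mul_div_assoc',
            le_div_iff₀ hc]
          have h3 := h1.2
          rw [← ePc, ← eRs]
          calc _ = R * P * (x.2 * Real.cos α) := by ring
            _ ≤ R * P * (x.1 * Real.sin α) := by gcongr
            _ = _ := by ring) (mul_nonneg hP.le h2)
      rw [Real.arctan_tan (by linarith [Real.pi_pos]) hβ2] at hψ
      have hψ1 : ψ ∈ Icc 0 β := ⟨hψ0 (mul_nonneg hR.le h1.1), (le_abs_self ψ).trans hψ⟩
      refine ⟨ψ, hψ1, r, ⟨hr, ?_⟩, ?_⟩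
      · simp only [hf]
        rcases hr.eq_or_lt with h0 | h0
        · rw [← h0]; exact (hf0 ψ hψ1).le
        rw [le_div_comm₀ h0 (hH0 ψ hψ1)]
        have hne : (closure Y).Nonempty := ⟨_, subset_closure cY⟩
        refine csSup_le (hne.image _) ?_
        rintro _ ⟨y, hy, rfl⟩
        refine closure_minimal (t := {y | F ψ y ≤ 1 / r}) (fun y hy => ?_) (isClosed_le
          (hFc.comp (Continuous.prodMk_right ψ)) continuous_const) hy
        have h3 := pol x hx y hy
        simp only [mem_ofPred_eq, hF]
        rw [le_div_iff₀ h0]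
        calc _ = y.1 / P * (r * Real.cos ψ) + y.2 / R * (r * Real.sin ψ) := by ring
          _ = x.1 * y.1 + x.2 * y.2 := by rw [← e1, ← e2]; field_simp
          _ ≤ 1 := h3
      · ext <;> simp only
        · rw [← e1]; field_simp
        · rw [← e2]; field_simp
    refine (measure_mono hsub).trans ?_
    rw [volume_radialRegion (by positivity) (by positivity) (by linarith [Real.pi_pos]) hβ.le
      (by linarith) hfc fun x hx => (hf0 x hx).le]
    apply le_of_eq; congr 1; field_simp
  -- Up to the angle `β` the bipolar bounds `Y`; between `β` and `γ` the single inequality at `c ∈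
  -- X` does.
  · have hsub : Y ⊆ radialRegion P R 0 β g ∪
        radialRegion P R β γ (fun x => 1 / Real.cos (x - β)) := by
      intro y hy
      have h1 := hY hy
      have h2 := fst_nonneg_of_mem_halfCone hsa hca h1
      obtain ⟨r, φ, hr, hφ, hφ0, e1, e2⟩ := exists_polar_of_abs_le (u := y.1 / P) (w := y.2 / R)
        (t := Real.sin α ^ 2 * Real.cos β / (Real.cos α ^ 2 * Real.sin β)) (by positivity) (by
          rw [abs_of_nonneg (div_nonneg h1.1 hR.le), ← ePc, ← eRs]
          have h3 := h1.2
          have : y.1 / P * (Real.sin α ^ 2 * (P * Real.cos α) / (Real.cos α ^ 2 *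
            (R * Real.sin α))) = y.1 * Real.sin α / (R * Real.cos α) := by field_simp
          rw [this, div_le_div_iff₀ hR (by positivity)]
          calc _ = R * (y.2 * Real.cos α) := by ring
            _ ≤ R * (y.1 * Real.sin α) := by gcongr
            _ = _ := by ring) (div_nonneg h2 hP.le)
      rw [← hγd] at hφ
      have hφ1 : φ ∈ Icc 0 γ := ⟨hφ0 (div_nonneg h1.1 hR.le), (le_abs_self φ).trans hφ⟩
      have ey : y = (P * (r * Real.cos φ), R * (r * Real.sin φ)) := by
        ext <;> simp only
        · rw [← e1]; field_simp
        · rw [← e2]; field_simp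
      rcases le_total φ β with hle | hle
      · left
        refine ⟨φ, ⟨hφ1.1, hle⟩, r, ⟨hr, ?_⟩, ey⟩
        simp only [hg]
        rcases hr.eq_or_lt with h0 | h0
        · rw [← h0]; exact (hg0 φ ⟨hφ1.1, hle⟩).le
        rw [le_div_comm₀ h0 (hH₂0 φ ⟨hφ1.1, hle⟩)]
        refine csSup_le ((nonempty_Icc.2 hβ.le).image _) ?_
        rintro _ ⟨ψ, hψ, rfl⟩
        simp only [hF₂]
        rw [hff' ψ hψ, le_div_iff₀ h0]
        simp only [hf]
        rw [div_mul_eq_mul_div, div_mul_eq_mul_div, div_le_one (hH0 ψ hψ)]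
        have h3 := hFH ψ y hy
        simp only [hF] at h3
        rw [e1, e2] at h3
        rw [Real.cos_sub]
        linarith
      · right
        refine ⟨φ, ⟨hle, hφ1.2⟩, r, ⟨hr, ?_⟩, ey⟩
        have h3 := pol _ cX y hy
        have hcc : 0 < Real.cos (φ - β) :=
          Real.cos_pos_of_mem_Ioo ⟨by linarith [Real.pi_pos], by linarith [hφ1.2]⟩
        rw [le_div_iff₀ hcc, Real.cos_sub]
        rw [ey] at h3
        simp only at h3
        rw [← ePc, ← eRs]
        linarith
    refine (measure_mono hsub).trans ((measure_union_le _ _).trans ?_)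
    have hcc : ∀ x ∈ Icc β γ, 0 < Real.cos (x - β) := fun x hx =>
      Real.cos_pos_of_mem_Ioo ⟨by linarith [hx.1, Real.pi_pos], by linarith [hx.2]⟩
    rw [volume_radialRegion hP hR (by linarith [Real.pi_pos]) hβ.le
      (by linarith) hgc fun x hx => (hg0 x hx).le,
      volume_radialRegion hP hR (by linarith [Real.pi_pos]) hβγ
      (by linarith) (continuousOn_const.div₀ (by fun_prop) fun x hx => (hcc x hx).ne')
      fun x hx => (one_div_pos.2 (hcc x hx)).le, integral_inv_cos_sq hβγ (by linarith), htg,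
      ← ENNReal.ofReal_add]
    · apply le_of_eq; congr 1; ring
    · have := pos g hgc hg0; positivity
    · have : 0 ≤ s := by
        rw [← htg]
        exact Real.tan_nonneg_of_nonneg_of_le_pi_div_two (by linarith) (by linarith)
      positivity

/-! ### Symmetrization of a polar pair -/

/-- Fubini for a measurable hull of `S`. Only an inequality is needed, so the symmetrized sets never
have to be shown measurable. -/
lemma lintegral_measure_prodMk_le (S : Set (ℝ × ℝ)) :
    ∫⁻ x, volume (Prod.mk x ⁻¹' S) ≤ volume S := by
  rw [← measure_toMeasurable S, Measure.volume_eq_prod,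
    Measure.prod_apply (measurableSet_toMeasurable _ _)]
  exact lintegral_mono fun x => measure_mono (preimage_mono (subset_toMeasurable _ _))

lemma lintegral_measure_prodMk_symm_le (S : Set (ℝ × ℝ)) :
    ∫⁻ y, volume ((fun x => (x, y)) ⁻¹' S) ≤ volume S := by
  rw [← measure_toMeasurable S, Measure.volume_eq_prod,
    Measure.prod_apply_symm (measurableSet_toMeasurable _ _)]
  exact lintegral_mono fun x => measure_mono (preimage_mono (subset_toMeasurable _ _))

/-- The deltoid `Q` in coordinates. -/
def deltoid (α : ℝ) : Set (ℝ × ℝ) :=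
  {x | |x.2| * Real.cos α ≤ x.1 * Real.sin α ∧ x.1 * Real.cos α + |x.2| * Real.sin α ≤ 1}

/-- The part above the axis of the Steiner symmetral of `C` with respect to the axis. -/
def upperSymmetral (C : Set (ℝ × ℝ)) : Set (ℝ × ℝ) :=
  {z | 0 ≤ z.2 ∧ ∃ u v, (z.1, u) ∈ C ∧ (z.1, v) ∈ C ∧ z.2 ≤ (u - v) / 2}

/-- The part above the axis of the average of `D` and its mirror image, formed on horizontal
lines. -/
def upperAverage (α : ℝ) (D : Set (ℝ × ℝ)) : Set (ℝ × ℝ) :=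
  {z | z ∈ halfCone α ∧ ∃ u v, (u, z.2) ∈ D ∧ (v, -z.2) ∈ D ∧ z.1 ≤ (u + v) / 2}

/-- A vertical section of `C` with highest point `u` and lowest point `v` has length at most `u -
v`, and the upper half of its symmetral contains an interval of length `(u - v) / 2`. -/
lemma volume_le_two_mul_upperSymmetral {C : Set (ℝ × ℝ)} (hC : IsCompact C) :
    volume C ≤ 2 * volume (upperSymmetral C) := by
  rw [Measure.volume_eq_prod, Measure.prod_apply hC.measurableSet, ← Measure.volume_eq_prod]
  refine le_trans ?_ (mul_le_mul_right (lintegral_measure_prodMk_le _) 2)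
  rw [← lintegral_const_mul' _ _ (by simp)]
  refine lintegral_mono fun x => ?_
  rcases (Prod.mk x ⁻¹' C).eq_empty_or_nonempty with he | hne
  · rw [he]; simp
  have hK : IsCompact (Prod.mk x ⁻¹' C) :=
    (hC.image continuous_snd).of_isClosed_subset
      (hC.isClosed.preimage (Continuous.prodMk_right x)) fun w hw => ⟨_, hw, rfl⟩
  obtain ⟨u, hu, hmax⟩ := hK.exists_isMaxOn hne continuousOn_id
  obtain ⟨v, hv, hmin⟩ := hK.exists_isMinOn hne continuousOn_id
  have h1 : Prod.mk x ⁻¹' C ⊆ Icc v u := fun w hw => ⟨hmin hw, hmax hw⟩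
  have h2 : Icc 0 ((u - v) / 2) ⊆ Prod.mk x ⁻¹' upperSymmetral C := fun w hw =>
    ⟨hw.1, u, v, hu, hv, hw.2⟩
  refine (measure_mono h1).trans (le_trans ?_ (mul_le_mul_right (measure_mono h2) 2))
  rw [Real.volume_Icc, Real.volume_Icc, ← ENNReal.ofReal_ofNat 2,
    ← ENNReal.ofReal_mul (by norm_num)]
  apply le_of_eq; congr 1; ring

/-- The sections of `D` at heights `y` and `-y` both begin no earlier than the boundary ray of the
cone, at abscissa `l`. If they reach to `u` and `v`, their total length is at most twice that of
`[l, (u + v) / 2]`. The segments `[o, a]` and `[o, c]` in `D` make both sections nonempty. -/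
lemma volume_le_two_mul_upperAverage {α : ℝ} (hs : 0 < Real.sin α) (hc : 0 < Real.cos α)
    {D : Set (ℝ × ℝ)} (hD : IsCompact D) (hQ : D ⊆ deltoid α)
    (hc1 : ∀ t ∈ Icc (0 : ℝ) 1, (t * Real.cos α, t * Real.sin α) ∈ D)
    (hc2 : ∀ t ∈ Icc (0 : ℝ) 1, (t * Real.cos α, -(t * Real.sin α)) ∈ D) :
    volume D ≤ 2 * volume (upperAverage α D) := by
  set φ : ℝ → ENNReal := fun y => volume ((fun x => (x, y)) ⁻¹' D) with hφ
  have hφm : Measurable φ := measurable_measure_prodMk_right hD.measurableSet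
  have e1 : volume D = ∫⁻ y, φ y := by
    rw [Measure.volume_eq_prod, Measure.prod_apply_symm hD.measurableSet]
  have e2 : ∫⁻ y, φ y = ∫⁻ y in Ioi 0, (φ y + φ (-y)) := by
    rw [lintegral_add_left hφm, ← lintegral_add_compl φ measurableSet_Ioi (A := Ioi 0), compl_Ioi]
    congr 1
    rw [setLIntegral_congr Iio_ae_eq_Iic.symm]
    have := (Measure.measurePreserving_neg (volume : Measure ℝ)).setLIntegral_comp_preimage
      (s := Iio 0) measurableSet_Iio hφm
    rw [← this]
    simp
  rw [e1, e2]
  refine le_trans ?_ (mul_le_mul_right (lintegral_measure_prodMk_symm_le _) 2)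
  rw [← lintegral_const_mul' _ _ (by simp)]
  refine le_trans ?_ (setLIntegral_le_lintegral (Ioi 0) _)
  refine setLIntegral_mono' measurableSet_Ioi fun y hy => ?_
  have hy : 0 < y := hy
  by_cases hys : y ≤ Real.sin α
  · have ht : y / Real.sin α ∈ Icc (0 : ℝ) 1 := ⟨by positivity, (div_le_one hs).2 hys⟩
    have d1 := hc1 _ ht
    have d2 := hc2 _ ht
    rw [div_mul_cancel₀ _ hs.ne'] at d1 d2
    have emb : ∀ z : ℝ, IsCompact ((fun x => ((x, z) : ℝ × ℝ)) ⁻¹' D) := fun z =>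
      (hD.image continuous_fst).of_isClosed_subset
        (hD.isClosed.preimage (Continuous.prodMk_left z)) fun w hw => ⟨_, hw, rfl⟩
    obtain ⟨u, hu, hmu⟩ := (emb y).exists_isMaxOn ⟨_, d1⟩ continuousOn_id
    obtain ⟨v, hv, hmv⟩ := (emb (-y)).exists_isMaxOn ⟨_, d2⟩ continuousOn_id
    set l := y / Real.sin α * Real.cos α with hl
    have hls : l * Real.sin α = y * Real.cos α := by rw [hl]; field_simp
    have i1 : (fun x => (x, y)) ⁻¹' D ⊆ Icc l u := fun x hx => by
      refine ⟨?_, hmu hx⟩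
      have := (hQ hx).1
      simp only [abs_of_pos hy] at this
      rw [← hls] at this
      exact le_of_mul_le_mul_right this hs
    have i2 : (fun x => (x, -y)) ⁻¹' D ⊆ Icc l v := fun x hx => by
      refine ⟨?_, hmv hx⟩
      have := (hQ hx).1
      simp only [abs_neg, abs_of_pos hy] at this
      rw [← hls] at this
      exact le_of_mul_le_mul_right this hs
    have i3 : Icc l ((u + v) / 2) ⊆ (fun x => (x, y)) ⁻¹' upperAverage α D := fun x hx => by
      refine ⟨⟨hy.le, ?_⟩, u, v, hu, hv, hx.2⟩
      simp only
      rw [← hls]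
      exact mul_le_mul_of_nonneg_right hx.1 hs.le
    refine (add_le_add (measure_mono i1) (measure_mono i2)).trans
      (le_trans ?_ (mul_le_mul_right (measure_mono i3) 2))
    rw [Real.volume_Icc, Real.volume_Icc, Real.volume_Icc, ← ENNReal.ofReal_ofNat 2,
      ← ENNReal.ofReal_mul (by norm_num), ← ENNReal.ofReal_add]
    · apply le_of_eq; congr 1; ring
    · linarith [(i1 d1).2]
    · linarith [(i2 d2).2]
  -- Above the height `sin α` of `c` the deltoid has no points.
  · have key : ∀ z x : ℝ, |z| = y → (x, z) ∉ D := by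
      rintro z x hz hx
      obtain ⟨h1, h2⟩ := hQ hx
      simp only [hz] at h1 h2
      apply hys
      have h3 := mul_le_mul_of_nonneg_right h1 hc.le
      have h4 := mul_le_mul_of_nonneg_left h2 hs.le
      nlinarith [Real.sin_sq_add_cos_sq α]
    have k1 : (fun x => (x, y)) ⁻¹' D = ∅ :=
      eq_empty_of_forall_notMem fun x => key y x (abs_of_pos hy)
    have k2 : (fun x => (x, -y)) ⁻¹' D = ∅ :=
      eq_empty_of_forall_notMem fun x => key (-y) x (by rw [abs_neg, abs_of_pos hy])
    simp [hφ, k1, k2]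

lemma upperSymmetral_subset {α : ℝ} (hc : 0 < Real.cos α)
    {C : Set (ℝ × ℝ)} (hC : C ⊆ deltoid α) : upperSymmetral C ⊆ halfCone α := by
  rintro z ⟨h0, u, v, hu, hv, h⟩
  refine ⟨h0, ?_⟩
  have h1 := (hC hu).1
  have h2 := (hC hv).1
  simp only at h1 h2
  nlinarith [le_abs_self u, neg_abs_le v]

/-- Add the polarity inequalities of the pairs `(x₁, u), (U, y₂)` and `(x₁, v), (V, -y₂)`: the sum
contains `x₁ (U + V) + (u - v) y₂`, which dominates twice the product of the symmetrized points
since `x₁, y₂ ≥ 0`. -/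
lemma polar_upperSymmetral_upperAverage {α : ℝ} (hs : 0 < Real.sin α) (hc : 0 < Real.cos α)
    {C D : Set (ℝ × ℝ)} (hC : C ⊆ deltoid α)
    (pol : ∀ x ∈ C, ∀ y ∈ D, x.1 * y.1 + x.2 * y.2 ≤ 1) :
    ∀ x ∈ upperSymmetral C, ∀ y ∈ upperAverage α D, x.1 * y.1 + x.2 * y.2 ≤ 1 := by
  rintro x hx y ⟨hy, U, V, hU, hV, h'⟩
  have hx1 := fst_nonneg_of_mem_halfCone hs hc (upperSymmetral_subset hc hC hx)
  obtain ⟨h0, u, v, hu, hv, h⟩ := hx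
  have p1 := pol _ hu _ hU
  have p2 := pol _ hv _ hV
  simp only at p1 p2
  have q1 := mul_le_mul_of_nonneg_left h' hx1
  have q2 := mul_le_mul_of_nonneg_right h hy.1
  linarith

/-- What symmetrization uses of `C` and `C*`. The left set, cut vertically, needs only the points
`a` and `c`; the right set, cut horizontally, needs the whole segments from `o`. -/
structure PolarPair (α : ℝ) (C D : Set (ℝ × ℝ)) : Prop where
  compact_left : IsCompact C
  compact_right : IsCompact D
  left_subset : C ⊆ deltoid α
  right_subset : D ⊆ deltoid α
  a_left : (Real.cos α, -Real.sin α) ∈ C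
  c_left : (Real.cos α, Real.sin α) ∈ C
  a_right : ∀ t ∈ Icc (0 : ℝ) 1, (t * Real.cos α, -(t * Real.sin α)) ∈ D
  c_right : ∀ t ∈ Icc (0 : ℝ) 1, (t * Real.cos α, t * Real.sin α) ∈ D
  polar : ∀ x ∈ C, ∀ y ∈ D, x.1 * y.1 + x.2 * y.2 ≤ 1

lemma PolarPair.exists_halves {α β : ℝ} (h : Angles α β) {C D : Set (ℝ × ℝ)}
    (hCD : PolarPair α C D) : ∃ X Y : Set (ℝ × ℝ), X ⊆ halfCone α ∧ Y ⊆ halfCone α ∧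
      (Real.cos α, Real.sin α) ∈ X ∧ (Real.cos α, Real.sin α) ∈ Y ∧
      (∀ x ∈ X, ∀ y ∈ Y, x.1 * y.1 + x.2 * y.2 ≤ 1) ∧
      volume C ≤ 2 * volume X ∧ volume D ≤ 2 * volume Y := by
  refine ⟨upperSymmetral C, upperAverage α D, upperSymmetral_subset h.cosα hCD.left_subset,
    fun z hz => hz.1, ⟨h.sinα.le, _, _, hCD.c_left, hCD.a_left, by simp⟩,
    ⟨⟨h.sinα.le, (mul_comm _ _).le⟩, Real.cos α, Real.cos α, ?_, ?_, by simp⟩,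
    polar_upperSymmetral_upperAverage h.sinα h.cosα hCD.left_subset hCD.polar,
    volume_le_two_mul_upperSymmetral hCD.compact_left,
    volume_le_two_mul_upperAverage h.sinα h.cosα hCD.compact_right hCD.right_subset
      hCD.c_right hCD.a_right⟩
  · simpa using hCD.c_right 1 (by simp)
  · simpa using hCD.a_right 1 (by simp)

lemma real_le_of_le_two_mul {S X : Set (ℝ × ℝ)} {r : ℝ} (hr : 0 ≤ r)
    (h : volume S ≤ 2 * volume X) (hX : volume X ≤ ENNReal.ofReal (r / 2)) :
    volume.real S ≤ r := by
  refine ENNReal.toReal_le_of_le_ofReal hr (h.trans ((mul_le_mul_right hX 2).trans (le_of_eq ?_)))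
  rw [← ENNReal.ofReal_ofNat 2, ← ENNReal.ofReal_mul (by norm_num)]
  congr 1; ring

/-- In the product inequality the area of `C` forces `x₀ ≥ β`, hence `y₀ ≤ β`. -/
theorem PolarPair.le_of_inner_le {α β : ℝ} (h : Angles α β) {C D : Set (ℝ × ℝ)}
    (hCD : PolarPair α C D) (hv : β / (semiX α β * semiY α β) ≤ volume.real C) :
    volume.real D ≤ semiX α β * semiY α β * (β + tanGap α β) := by
  obtain ⟨X, Y, hX, hY, cX, cY, pol, h1, h2⟩ := hCD.exists_halves h
  obtain ⟨x₀, y₀, hx, hy, hxy, vX, vY⟩ := exists_volume_le_of_polar h hX hY cX cY pol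
  have hk := mul_pos h.semiX_pos h.semiY_pos
  have hg := h.tanGap_nonneg
  have hβ := h.pos
  have h3 : volume.real C ≤ x₀ / (semiX α β * semiY α β) :=
    real_le_of_le_two_mul (by positivity) h1 (by rwa [div_div, mul_comm _ (2 : ℝ)])
  have h4 : β ≤ x₀ := by
    have := hv.trans h3
    rwa [div_le_div_iff_of_pos_right hk] at this
  have h5 : y₀ ≤ β := by nlinarith
  refine (real_le_of_le_two_mul (by positivity) h2 vY).trans ?_
  gcongr

/-- The same product inequality with the halves interchanged: now the half of `C` is the one that
may extend beyond the angle `β`. -/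
theorem PolarPair.le_of_outer_le {α β : ℝ} (h : Angles α β) {C D : Set (ℝ × ℝ)}
    (hCD : PolarPair α C D) (hv : semiX α β * semiY α β * (β + tanGap α β) ≤ volume.real C) :
    volume.real D ≤ β / (semiX α β * semiY α β) := by
  obtain ⟨X, Y, hX, hY, cX, cY, pol, h1, h2⟩ := hCD.exists_halves h
  obtain ⟨x₀, y₀, hx, hy, hxy, vY, vX⟩ := exists_volume_le_of_polar h hY hX cY cX
    fun y hy x hx => by
      have := pol x hx y hy
      linarith
  have hk := mul_pos h.semiX_pos h.semiY_pos
  have hg := h.tanGap_nonneg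
  have hβ := h.pos
  have h3 := real_le_of_le_two_mul (by positivity) h1 vX
  have h4 : β ≤ y₀ := by
    have := le_of_mul_le_mul_left (hv.trans h3) hk
    linarith
  have h5 : x₀ ≤ β := by nlinarith
  refine (real_le_of_le_two_mul (r := x₀ / (semiX α β * semiY α β)) (by positivity) h2
    (by rwa [div_div, mul_comm _ (2 : ℝ)])).trans ?_
  gcongr

/-! ### Coordinates and the deltoid -/

lemma inner_plane (x y : Plane) : ⟪x, y⟫ = x 0 * y 0 + x 1 * y 1 := by
  simp [PiLp.inner_apply, Fin.sum_univ_two, mul_comm]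

lemma plane_eta (x : Plane) : !₂[x 0, x 1] = x := by
  ext i; fin_cases i <;> rfl

lemma plane_ext {x y : Plane} (h0 : x 0 = y 0) (h1 : x 1 = y 1) : x = y := by
  ext i; fin_cases i <;> assumption

/-- The coordinate pairs of the points of a plane set. -/
def toProd (S : Set Plane) : Set (ℝ × ℝ) := {p | !₂[p.1, p.2] ∈ S}

lemma toProd_eq_image (S : Set Plane) : toProd S = (fun x : Plane => (x 0, x 1)) '' S := by
  ext p
  constructor
  · intro h; exact ⟨_, h, by simp⟩
  · rintro ⟨x, hx, rfl⟩
    change !₂[x 0, x 1] ∈ S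
    rwa [plane_eta]

lemma isCompact_toProd {S : Set Plane} (hS : IsCompact S) : IsCompact (toProd S) := by
  rw [toProd_eq_image]
  exact hS.image (by fun_prop)

lemma volume_toProd (S : Set Plane) : volume (toProd S) = volume S := by
  have h1 := (volume_preserving_finTwoArrow ℝ).symm.measure_preimage_equiv
    ((WithLp.toLp 2 : (Fin 2 → ℝ) → Plane) ⁻¹' S)
  have h2 := (PiLp.volume_preserving_toLp (Fin 2)).measure_preimage_equiv
    (f := MeasurableEquiv.toLp 2 (Fin 2 → ℝ)) S
  have h3 : toProd S = (MeasurableEquiv.finTwoArrow (α := ℝ)).symm ⁻¹'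
      ((WithLp.toLp 2 : (Fin 2 → ℝ) → Plane) ⁻¹' S) := by
    ext p
    simp only [toProd, mem_ofPred_eq, mem_preimage]
    exact Iff.of_eq (congrArg (· ∈ S) (by ext i; fin_cases i <;> rfl))
  rw [h3, h1]
  exact h2

lemma area_eq (S : Set Plane) : area S = volume.real (toProd S) := by
  rw [area, Measure.real, Measure.real, volume_toProd]

lemma area_mono {S T : Set Plane} (hT : IsCompact T) (h : S ⊆ T) : area S ≤ area T :=
  measureReal_mono h hT.measure_lt_top.ne

/-- After reflection into the upper half, the point is `l c + m b`; the two inequalities of the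
deltoid say `m ≥ 0` and `l + m ≤ 1`. -/
lemma exists_of_mem_deltoid {α : ℝ} (hs : 0 < Real.sin α) (hc : 0 < Real.cos α) {y : ℝ × ℝ}
    (hy : y ∈ deltoid α) : ∃ l m : ℝ, 0 ≤ l ∧ 0 ≤ m ∧ l + m ≤ 1 ∧ |y.2| = l * Real.sin α ∧
      y.1 = l * Real.cos α + m / Real.cos α := by
  obtain ⟨h1, h2⟩ := hy
  have hsc := Real.sin_sq_add_cos_sq α
  refine ⟨|y.2| / Real.sin α, (y.1 - |y.2| * Real.cos α / Real.sin α) * Real.cos α,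
    by positivity, mul_nonneg ?_ hc.le, ?_, by field_simp, by field_simp; ring⟩
  · rw [sub_nonneg, div_le_iff₀ hs]; exact h1
  · have : |y.2| / Real.sin α + (y.1 - |y.2| * Real.cos α / Real.sin α) * Real.cos α =
        y.1 * Real.cos α + |y.2| * Real.sin α := by
      field_simp; linear_combination (-|y.2|) * hsc
    rwa [this]

lemma convex_deltoid (α : ℝ) (hs : 0 < Real.sin α) (hc : 0 < Real.cos α) :
    Convex ℝ {x : Plane | |x 1| * Real.cos α ≤ x 0 * Real.sin α ∧
      x 0 * Real.cos α + |x 1| * Real.sin α ≤ 1} := by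
  rintro x ⟨hx1, hx2⟩ y ⟨hy1, hy2⟩ a b ha hb hab
  have h := abs_add_le (a * x 1) (b * y 1)
  rw [abs_mul, abs_mul, abs_of_nonneg ha, abs_of_nonneg hb] at h
  simp only [mem_ofPred_eq, PiLp.add_apply, PiLp.smul_apply, smul_eq_mul]
  have m1 := mul_le_mul_of_nonneg_left hx1 ha
  have m2 := mul_le_mul_of_nonneg_left hy1 hb
  have m3 := mul_le_mul_of_nonneg_left hx2 ha
  have m4 := mul_le_mul_of_nonneg_left hy2 hb
  constructor
  · have := mul_le_mul_of_nonneg_right h hc.le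
    linarith
  · have := mul_le_mul_of_nonneg_right h hs.le
    linarith

lemma mem_Q_iff {α : ℝ} (hs : 0 < Real.sin α) (hc : 0 < Real.cos α) {x : Plane} :
    x ∈ Q α ↔ |x 1| * Real.cos α ≤ x 0 * Real.sin α ∧
      x 0 * Real.cos α + |x 1| * Real.sin α ≤ 1 := by
  have hsc := Real.sin_sq_add_cos_sq α
  constructor
  · intro hx
    refine convexHull_min ?_ (convex_deltoid α hs hc) hx
    rintro y (rfl | rfl | rfl | rfl)
    · simp
    · simp only [ptA, mem_ofPred_eq]
      simp [abs_of_pos hs]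
      constructor <;> nlinarith
    · simp only [ptB, mem_ofPred_eq]
      simp [inv_mul_cancel₀ hc.ne']
      positivity
    · simp only [ptC, mem_ofPred_eq]
      simp [abs_of_pos hs]
      constructor <;> nlinarith
  · intro hx
    obtain ⟨l, m, hl, hm, hlm, e1, e0⟩ := exists_of_mem_deltoid hs hc (y := (x 0, x 1)) hx
    simp only at e0 e1
    have hconv : Convex ℝ (Q α) := convex_convexHull ℝ _
    have m0 : (0 : Plane) ∈ Q α := subset_convexHull ℝ _ (by simp)
    have ma : ptA α ∈ Q α := subset_convexHull ℝ _ (by simp)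
    have mb : ptB α ∈ Q α := subset_convexHull ℝ _ (by simp)
    have mc : ptC α ∈ Q α := subset_convexHull ℝ _ (by simp)
    have key : ∀ w ∈ Q α, x = l • w + m • ptB α → x ∈ Q α := by
      intro w hw e
      rcases (add_nonneg hl hm).eq_or_lt with h0 | h0
      · have : l = 0 := by linarith
        have h' : m = 0 := by linarith
        rw [e, this, h']; simpa using m0
      · have h1 : (l / (l + m)) • w + (m / (l + m)) • ptB α ∈ Q α :=
          hconv hw mb (by positivity) (by positivity) (by field_simp)
        have h2 := hconv.smul_mem_of_zero_mem m0 h1 ⟨h0.le, hlm⟩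
        rwa [smul_add, smul_smul, smul_smul, mul_div_cancel₀ _ h0.ne', mul_div_cancel₀ _ h0.ne',
          ← e] at h2
    rcases abs_cases (x 1) with ⟨h, -⟩ | ⟨h, -⟩
    · refine key _ mc (plane_ext ?_ ?_)
      · simp [ptC, ptB]; rw [e0]; rfl
      · simp [ptC, ptB]; linarith
    · refine key _ ma (plane_ext ?_ ?_)
      · simp [ptA, ptB]; rw [e0]; rfl
      · simp [ptA, ptB]; linarith

lemma isCompact_Q (α : ℝ) : IsCompact (Q α) :=
  (Set.toFinite {0, ptA α, ptB α, ptC α}).isCompact_convexHull ℝ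

lemma convex_Q (α : ℝ) : Convex ℝ (Q α) := convex_convexHull ℝ _

lemma zero_mem_Q (α : ℝ) : (0 : Plane) ∈ Q α := subset_convexHull ℝ _ (by simp)

lemma ptA_mem_Q (α : ℝ) : ptA α ∈ Q α := subset_convexHull ℝ _ (by simp)

lemma ptC_mem_Q (α : ℝ) : ptC α ∈ Q α := subset_convexHull ℝ _ (by simp)

/-- A point outside the two opposite angles at `o` spanned by `a` and `c` whose products with `a`
and `c` are at most `1` in absolute value lies in the polar of `Q`. -/
lemma abs_inner_le_one {α : ℝ} (hs : 0 < Real.sin α) (hc : 0 < Real.cos α) {x y : Plane}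
    (hx0 : |x 0| ≤ Real.cos α) (hx : |x 0| * Real.cos α + |x 1| * Real.sin α ≤ 1)
    (hy : y ∈ Q α) : |⟪x, y⟫| ≤ 1 := by
  obtain ⟨l, m, hl, hm, hlm, e1, e0⟩ :=
    exists_of_mem_deltoid hs hc (y := (y 0, y 1)) ((mem_Q_iff hs hc).1 hy)
  simp only at e0 e1
  have hy0 : 0 ≤ y 0 := by rw [e0]; positivity
  rw [inner_plane]
  refine (abs_add_le _ _).trans ?_
  rw [abs_mul, abs_mul, abs_of_nonneg hy0, e0, e1]
  have h1 : |x 0| / Real.cos α ≤ 1 := (div_le_one hc).2 hx0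
  calc _ = l * (|x 0| * Real.cos α + |x 1| * Real.sin α) + m * (|x 0| / Real.cos α) := by ring
    _ ≤ l * 1 + m * 1 := by gcongr
    _ ≤ 1 := by linarith

/-- First coordinates in `Q` are nonnegative and second ones at most `1` in absolute value. This
makes the constraints from `-Q` automatic on `Q`. -/
lemma neg_one_le_inner {α : ℝ} (hs : 0 < Real.sin α) (hc : 0 < Real.cos α) {x y : Plane}
    (hx : x ∈ Q α) (hy : y ∈ Q α) : -1 ≤ ⟪x, y⟫ := by
  have key : ∀ z ∈ Q α, 0 ≤ z 0 ∧ |z 1| ≤ 1 := by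
    intro z hz
    obtain ⟨l, m, hl, hm, hlm, e1, e0⟩ :=
      exists_of_mem_deltoid hs hc (y := (z 0, z 1)) ((mem_Q_iff hs hc).1 hz)
    simp only at e0 e1
    refine ⟨by rw [e0]; positivity, ?_⟩
    rw [e1]
    exact mul_le_one₀ (by linarith) hs.le (Real.sin_le_one α)
  obtain ⟨x0, x1⟩ := key x hx
  obtain ⟨y0, y1⟩ := key y hy
  rw [inner_plane]
  have h1 : |x 1 * y 1| ≤ 1 := by
    rw [abs_mul]; exact mul_le_one₀ x1 (abs_nonneg _) y1
  have := (abs_le.1 h1).1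
  have := mul_nonneg x0 y0
  linarith

lemma inner_ptC (α : ℝ) (x : Plane) : ⟪x, ptC α⟫ = x 0 * Real.cos α + x 1 * Real.sin α := by
  simp [inner_plane, ptC]

lemma inner_ptA (α : ℝ) (x : Plane) : ⟪x, ptA α⟫ = x 0 * Real.cos α - x 1 * Real.sin α := by
  simp [inner_plane, ptA]; ring

lemma inner_circlePt (θ : ℝ) (x : Plane) :
    ⟪circlePt θ, x⟫ = Real.cos θ * x 0 + Real.sin θ * x 1 := by
  simp [inner_plane, circlePt]

lemma ptA_eq (α : ℝ) : ptA α = -circlePt (Real.pi - α) := by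
  apply plane_ext <;> simp [ptA, circlePt]

/-! ### What the arcs force on an admissible body -/

namespace Admissible

lemma zero_mem {α : ℝ} {K : Set Plane} (hK : Admissible α K) : (0 : Plane) ∈ K := by
  obtain ⟨x, hx⟩ := hK.interior_nonempty
  have hx := interior_subset hx
  have hx' : -x ∈ K := by rw [← hK.symmetric]; simpa using hx
  have := hK.convex hx hx' (a := 1 / 2) (b := 1 / 2) (by norm_num) (by norm_num) (by norm_num)
  simpa using this

/-- A supporting functional of `K` at an interior point of the arc has a local maximum along the arc
there. Its derivative along the circle vanishes, so the supporting line is the tangent of the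
circle. -/
lemma inner_circlePt_le_of_mem_Ioo {α : ℝ} {K : Set Plane} (hK : Admissible α K) {θ : ℝ}
    (hθ : θ ∈ Ioo α (Real.pi - α)) {x : Plane} (hx : x ∈ K) : ⟪circlePt θ, x⟫ ≤ 1 := by
  have hf : circlePt θ ∈ frontier K := hK.arc_subset ⟨θ, Ioo_subset_Icc_self hθ, rfl⟩
  obtain ⟨f, hf'⟩ := geometric_hahn_banach_open_point hK.convex.interior isOpen_interior hf.2
  have hle : ∀ y ∈ K, f y ≤ f (circlePt θ) := by
    intro y hy
    have h1 : y ∈ closure (interior K) := by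
      rw [hK.convex.closure_interior_eq_closure_of_nonempty_interior hK.interior_nonempty]
      exact subset_closure hy
    exact closure_minimal (t := {y | f y ≤ f (circlePt θ)}) (fun z hz => (hf' z hz).le)
      (isClosed_le f.continuous continuous_const) h1
  set A := f !₂[1, 0] with hA
  set B := f !₂[0, 1] with hB
  have hfx : ∀ y : Plane, f y = y 0 * A + y 1 * B := by
    intro y
    have : y = y 0 • (!₂[1, 0] : Plane) + y 1 • (!₂[0, 1] : Plane) := by
      apply plane_ext <;> simp
    conv_lhs => rw [this]
    rw [map_add, map_smul, map_smul]; rfl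
  have hfe : ∀ t, f (circlePt t) = Real.cos t * A + Real.sin t * B := fun t => by
    rw [hfx]; simp [circlePt]
  have hmax : IsLocalMax (fun t => Real.cos t * A + Real.sin t * B) θ := by
    filter_upwards [Ioo_mem_nhds hθ.1 hθ.2] with t ht
    rw [← hfe, ← hfe]
    exact hle _ (hK.isCompact.isClosed.frontier_subset
      (hK.arc_subset ⟨t, Ioo_subset_Icc_self ht, rfl⟩))
  have hd := hmax.hasDerivAt_eq_zero
    (((Real.hasDerivAt_cos θ).mul_const A).add ((Real.hasDerivAt_sin θ).mul_const B))
  set L := Real.cos θ * A + Real.sin θ * B with hL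
  have hsc := Real.sin_sq_add_cos_sq θ
  have hAe : A = L * Real.cos θ := by rw [hL]; linear_combination (-A) * hsc - Real.sin θ * hd
  have hBe : B = L * Real.sin θ := by rw [hL]; linear_combination (-B) * hsc + Real.cos θ * hd
  have hfL : ∀ y : Plane, f y = L * ⟪circlePt θ, y⟫ := fun y => by
    rw [hfx, inner_circlePt, hAe, hBe]; ring
  have hfe' : f (circlePt θ) = L := hfe θ
  have hL0 : 0 ≤ L := by
    have := hle 0 hK.zero_mem
    rwa [hfe', map_zero] at this
  have hLpos : 0 < L := by
    refine lt_of_le_of_ne hL0 fun h0 => ?_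
    obtain ⟨y, hy⟩ := hK.interior_nonempty
    have := hf' y hy
    rw [hfe', hfL, ← h0, zero_mul] at this
    exact lt_irrefl _ this
  have := hle x hx
  rw [hfe', hfL] at this
  exact le_of_mul_le_mul_left (by linarith) hLpos

lemma abs_inner_circlePt_le {α : ℝ} (hα : α < Real.pi / 2) {K : Set Plane} (hK : Admissible α K)
    {θ : ℝ} (hθ : θ ∈ Icc α (Real.pi - α)) {x : Plane} (hx : x ∈ K) :
    |⟪circlePt θ, x⟫| ≤ 1 := by
  have key : ∀ x ∈ K, ⟪circlePt θ, x⟫ ≤ 1 := by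
    intro x hx
    rw [← closure_Ioo (by linarith)] at hθ
    refine closure_minimal (t := {θ | ⟪circlePt θ, x⟫ ≤ 1})
      (fun t ht => hK.inner_circlePt_le_of_mem_Ioo ht hx) ?_ hθ
    simp only [inner_circlePt]
    exact isClosed_le (by fun_prop) continuous_const
  rw [abs_le]
  refine ⟨?_, key x hx⟩
  have := key (-x) (by rw [← hK.symmetric]; simpa using hx)
  rw [inner_neg_right] at this
  linarith

lemma abs_add_abs_le {α : ℝ} (hα : α ∈ Ioo 0 (Real.pi / 2))
    {K : Set Plane} (hK : Admissible α K)
    {x : Plane} (hx : x ∈ K) : |x 0| * Real.cos α + |x 1| * Real.sin α ≤ 1 := by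
  have h1 := hK.abs_inner_circlePt_le hα.2 (θ := α) ⟨le_rfl, by linarith [hα.2]⟩ hx
  have h2 := hK.abs_inner_circlePt_le hα.2 (θ := Real.pi - α) ⟨by linarith [hα.2], le_rfl⟩ hx
  rw [inner_circlePt, abs_le] at h1 h2
  rw [Real.cos_pi_sub, Real.sin_pi_sub] at h2
  rcases abs_cases (x 0) with ⟨e0, -⟩ | ⟨e0, -⟩ <;>
    rcases abs_cases (x 1) with ⟨e1, -⟩ | ⟨e1, -⟩ <;> rw [e0, e1] <;> linarith

/-- For a point of `Q` it suffices to test membership in the polar body on `K ∩ Q`. -/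
lemma mem_polarBody {α : ℝ} (hα : α ∈ Ioo 0 (Real.pi / 2)) (hs : 0 < Real.sin α)
    (hc : 0 < Real.cos α) {K : Set Plane} (hK : Admissible α K) {y : Plane} (hy : y ∈ Q α)
    (h : ∀ x ∈ K ∩ Q α, ⟪x, y⟫ ≤ 1) : y ∈ polarBody K := by
  intro x hx
  have hx1 := hK.abs_add_abs_le hα hx
  by_cases hcone : |x 1| * Real.cos α ≤ |x 0| * Real.sin α
  · rcases abs_cases (x 0) with ⟨e0, -⟩ | ⟨e0, -⟩
    · rw [e0] at hcone hx1
      exact h x ⟨hx, (mem_Q_iff hs hc).2 ⟨hcone, hx1⟩⟩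
    · rw [e0] at hcone hx1
      have : -x ∈ Q α := (mem_Q_iff hs hc).2 (by
        simpa only [PiLp.neg_apply, abs_neg] using And.intro hcone hx1)
      have := neg_one_le_inner hs hc this hy
      rw [inner_neg_left] at this
      linarith
  · push Not at hcone
    refine (abs_le.1 (abs_inner_le_one hs hc ?_ hx1 hy)).2
    have h1 := mul_le_mul_of_nonneg_right hcone.le hs.le
    have h2 := mul_le_mul_of_nonneg_left hx1 hc.le
    nlinarith [Real.sin_sq_add_cos_sq α]

lemma isClosed_polarBody (K : Set Plane) : IsClosed (polarBody K) := by
  have : polarBody K = ⋂ x ∈ K, {y | ⟪x, y⟫ ≤ 1} := by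
    ext y; simp [polarBody]
  rw [this]
  exact isClosed_biInter fun x _ => isClosed_le (by fun_prop) continuous_const

lemma ptA_mem {α : ℝ} {K : Set Plane} (hK : Admissible α K) : ptA α ∈ K :=
  hK.isCompact.isClosed.frontier_subset hK.a_mem

lemma ptC_mem {α : ℝ} {K : Set Plane} (hK : Admissible α K) : ptC α ∈ K :=
  hK.isCompact.isClosed.frontier_subset hK.c_mem

/-- The tangents of the circle at `±a` and `±c` bound `K`, because these points end the arcs; hence
`a` and `c` are in the polar as well. -/
lemma smul_mem_polar {α : ℝ} (hα : α ∈ Ioo 0 (Real.pi / 2)) (hs : 0 < Real.sin α)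
    (hc : 0 < Real.cos α) {K : Set Plane} (hK : Admissible α K) {p : Plane}
    (hp : p = ptA α ∨ p = ptC α) {t : ℝ} (ht : t ∈ Icc (0 : ℝ) 1) :
    t • p ∈ polarBody K ∩ Q α := by
  constructor
  · intro x hx
    have h1 := hK.abs_add_abs_le hα hx
    have h2 : ⟪x, p⟫ ≤ 1 := by
      have := mul_le_mul_of_nonneg_right (le_abs_self (x 0)) hc.le
      have := mul_le_mul_of_nonneg_right (le_abs_self (x 1)) hs.le
      have := mul_le_mul_of_nonneg_right (neg_abs_le (x 1)) hs.le
      rcases hp with rfl | rfl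
      · rw [inner_ptA]; linarith
      · rw [inner_ptC]; linarith
    rw [inner_smul_right]
    calc _ ≤ t * 1 := mul_le_mul_of_nonneg_left h2 ht.1
      _ ≤ 1 := by linarith [ht.2]
  · refine (convex_Q α).smul_mem_of_zero_mem (zero_mem_Q α) ?_ ht
    rcases hp with rfl | rfl
    · exact ptA_mem_Q α
    · exact ptC_mem_Q α

lemma polarPair {α : ℝ} (hα : α ∈ Ioo 0 (Real.pi / 2)) (hs : 0 < Real.sin α)
    (hc : 0 < Real.cos α) {K : Set Plane} (hK : Admissible α K) :
    PolarPair α (toProd (K ∩ Q α)) (toProd (polarBody K ∩ Q α)) where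
  compact_left := isCompact_toProd (hK.isCompact.inter (isCompact_Q α))
  compact_right := isCompact_toProd ((isCompact_Q α).inter_left (isClosed_polarBody K))
  left_subset := fun x hx => (mem_Q_iff hs hc (x := !₂[x.1, x.2])).1 hx.2
  right_subset := fun x hx => (mem_Q_iff hs hc (x := !₂[x.1, x.2])).1 hx.2
  a_left := ⟨hK.ptA_mem, ptA_mem_Q α⟩
  c_left := ⟨hK.ptC_mem, ptC_mem_Q α⟩
  a_right := fun t ht => by
    have := hK.smul_mem_polar hα hs hc (Or.inl rfl) ht
    have e : t • ptA α = !₂[t * Real.cos α, -(t * Real.sin α)] := by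
      apply plane_ext <;> simp [ptA]
    rwa [e] at this
  c_right := fun t ht => by
    have := hK.smul_mem_polar hα hs hc (Or.inr rfl) ht
    have e : t • ptC α = !₂[t * Real.cos α, t * Real.sin α] := by
      apply plane_ext <;> simp [ptC]
    rwa [e] at this
  polar := fun x hx y hy => by
    have := hy.1 _ hx.1
    simpa [inner_plane] using this

end Admissible

namespace Angles

lemma mem_Ioo {α β : ℝ} (h : Angles α β) : α ∈ Ioo 0 (Real.pi / 2) :=
  ⟨h.pos.trans_le h.le, h.lt⟩

theorem area_polar_le_of_inner_le {α β : ℝ} (h : Angles α β) {K : Set Plane}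
    (hK : Admissible α K) (hv : β / (semiX α β * semiY α β) ≤ area (K ∩ Q α)) :
    area (polarBody K ∩ Q α) ≤ semiX α β * semiY α β * (β + tanGap α β) := by
  rw [area_eq] at *
  exact (hK.polarPair h.mem_Ioo h.sinα h.cosα).le_of_inner_le h hv

theorem area_polar_le_of_outer_le {α β : ℝ} (h : Angles α β) {K : Set Plane}
    (hK : Admissible α K)
    (hv : semiX α β * semiY α β * (β + tanGap α β) ≤ area (K ∩ Q α)) :
    area (polarBody K ∩ Q α) ≤ β / (semiX α β * semiY α β) := by
  rw [area_eq] at *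
  exact (hK.polarPair h.mem_Ioo h.sinα h.cosα).le_of_outer_le h hv

end Angles

/-! ### The two extremal regions and their areas -/

/-- The point with eccentric angle `φ` on the ellipse that touches the lines `ab` and `cb`. -/
noncomputable def outerPt (α β φ : ℝ) : Plane :=
  !₂[semiX α β * Real.cos φ, semiY α β * Real.sin φ]

/-- The point with eccentric angle `φ` on the polar ellipse, which passes through `a` and `c`. -/
noncomputable def innerPt (α β φ : ℝ) : Plane :=
  !₂[1 / semiX α β * Real.cos φ, 1 / semiY α β * Real.sin φ]

lemma convex_inner_le (y : Plane) : Convex ℝ {x : Plane | ⟪x, y⟫ ≤ 1} := by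
  have e : {x | ⟪x, y⟫ ≤ 1} = {x | innerₛₗ ℝ y x ≤ 1} := by
    ext x; simp [real_inner_comm]
  rw [e]
  exact convex_halfSpace_le (innerₛₗ ℝ y).isLinear 1

/-- The points of `Q` that are polar to the arc `B` of a curve. -/
def polarRegion (α β : ℝ) (B : ℝ → Plane) : Set Plane :=
  {x | x ∈ Q α ∧ ∀ φ ∈ Icc (-β) β, ⟪x, B φ⟫ ≤ 1}

lemma polarRegion_eq (α β : ℝ) (B : ℝ → Plane) :
    polarRegion α β B = Q α ∩ ⋂ φ ∈ Icc (-β) β, {x | ⟪x, B φ⟫ ≤ 1} := by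
  ext; simp [polarRegion]

lemma convex_polarRegion (α β : ℝ) (B : ℝ → Plane) : Convex ℝ (polarRegion α β B) := by
  rw [polarRegion_eq]
  exact (convex_Q α).inter (convex_iInter₂ fun φ _ => convex_inner_le _)

/-- The points of `Q` that are polar to the arc of the outer ellipse. -/
def innerRegion (α β : ℝ) : Set Plane := polarRegion α β (outerPt α β)

/-- The points of `Q` that are polar to the arc of the inner ellipse. -/
def outerRegion (α β : ℝ) : Set Plane := polarRegion α β (innerPt α β)

/-- The radial function of the outer region, relative to its ellipse. -/
noncomputable def outerRadius (β ψ : ℝ) : ℝ := 1 / Real.cos (max 0 (|ψ| - β))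

lemma continuous_outerPt (α β : ℝ) : Continuous (outerPt α β) := by
  unfold outerPt; fun_prop

lemma continuous_innerPt (α β : ℝ) : Continuous (innerPt α β) := by
  unfold innerPt; fun_prop

lemma abs_sin_le_of_abs_le {β φ : ℝ} (hβ : β ≤ Real.pi / 2) (hφ : |φ| ≤ β) :
    |Real.sin φ| ≤ Real.sin β := by
  rw [abs_le] at hφ ⊢
  rw [← Real.sin_neg]
  constructor <;> apply Real.sin_le_sin_of_le_of_le_pi_div_two <;> linarith

lemma cos_le_cos_of_abs_le {β φ : ℝ} (hβ : β ≤ Real.pi) (hφ : |φ| ≤ β) :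
    Real.cos β ≤ Real.cos φ := by
  rw [← Real.cos_abs φ]
  exact Real.cos_le_cos_of_nonneg_of_le_pi (abs_nonneg _) hβ hφ

namespace Angles

variable {α β : ℝ}

lemma lt_pi_div_two (h : Angles α β) : β < Real.pi / 2 := h.le.trans_lt h.lt

lemma inner_outerPt (h : Angles α β) (φ ψ : ℝ) :
    ⟪innerPt α β φ, outerPt α β ψ⟫ = Real.cos (φ - ψ) := by
  have := h.semiX_pos; have := h.semiY_pos
  simp only [inner_plane, innerPt, outerPt, Real.cos_sub, Matrix.cons_val_zero,
    Matrix.cons_val_one]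
  field_simp

lemma innerPt_self (h : Angles α β) : innerPt α β β = ptC α := by
  have := h.semiX_pos; have := h.semiY_pos
  apply plane_ext
  · simp only [innerPt, ptC, Matrix.cons_val_zero]; rw [← h.semiX_mul]; field_simp
  · simp only [innerPt, ptC, Matrix.cons_val_one]; rw [← h.semiY_mul]; field_simp

lemma innerPt_neg_self (h : Angles α β) : innerPt α β (-β) = ptA α := by
  have := h.semiX_pos; have := h.semiY_pos
  apply plane_ext
  · simp only [innerPt, ptA, Matrix.cons_val_zero, Real.cos_neg]; rw [← h.semiX_mul]; field_simp
  · simp only [innerPt, ptA, Matrix.cons_val_one, Real.sin_neg]; rw [← h.semiY_mul]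
    field_simp

/-- With `β ≤ α` the squared distance from `o` grows with `sin² φ` and equals `1` at the ends `a`,
`c` of the arc. -/
lemma innerPt_sq_le (h : Angles α β) {φ : ℝ} (hφ : |φ| ≤ β) :
    (innerPt α β φ 0) ^ 2 + (innerPt α β φ 1) ^ 2 ≤ 1 := by
  have hs := h.sinβ; have hc := h.cosβ; have hsa := h.sinα; have hca := h.cosα
  have h1 := abs_sin_le_of_abs_le h.lt_pi_div_two.le hφ
  have h1 : Real.sin φ ^ 2 ≤ Real.sin β ^ 2 := by
    rw [← sq_abs]; exact pow_le_pow_left₀ (abs_nonneg _) h1 2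
  have h2 : Real.sin β ^ 2 ≤ Real.sin α ^ 2 := pow_le_pow_left₀ hs.le h.sinβ_le 2
  have e1 := Real.sin_sq_add_cos_sq φ
  have e2 := Real.sin_sq_add_cos_sq α
  have e3 := Real.sin_sq_add_cos_sq β
  have e : (innerPt α β φ 0) ^ 2 + (innerPt α β φ 1) ^ 2 =
      (Real.cos α ^ 2 * Real.cos φ ^ 2 * Real.sin β ^ 2 +
        Real.sin α ^ 2 * Real.sin φ ^ 2 * Real.cos β ^ 2) /
      (Real.cos β ^ 2 * Real.sin β ^ 2) := by
    simp only [innerPt, semiX, semiY, Matrix.cons_val_zero, Matrix.cons_val_one]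
    field_simp
  rw [e, div_le_one (by positivity)]
  have c1 : Real.cos α ^ 2 = 1 - Real.sin α ^ 2 := by linarith
  have c2 : Real.cos β ^ 2 = 1 - Real.sin β ^ 2 := by linarith
  have c3 : Real.cos φ ^ 2 = 1 - Real.sin φ ^ 2 := by linarith
  rw [c1, c2, c3]
  nlinarith [mul_nonneg (sub_nonneg.2 h1) (sub_nonneg.2 h2)]

lemma innerPt_mem_Q (h : Angles α β) {φ : ℝ} (hφ : |φ| ≤ β) : innerPt α β φ ∈ Q α := by
  have hs := h.sinβ; have hc := h.cosβ; have hsa := h.sinα; have hca := h.cosα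
  have h1 := abs_sin_le_of_abs_le h.lt_pi_div_two.le hφ
  have h2 := cos_le_cos_of_abs_le (by linarith [h.lt_pi_div_two, Real.pi_pos]) hφ
  rw [mem_Q_iff hsa hca]
  constructor
  · simp only [innerPt, Matrix.cons_val_zero, Matrix.cons_val_one]
    rw [abs_mul, abs_of_pos (one_div_pos.2 h.semiY_pos), semiX, semiY, one_div_div, one_div_div]
    rw [div_mul_eq_mul_div, div_mul_eq_mul_div, div_mul_eq_mul_div, div_mul_eq_mul_div,
      div_le_div_iff₀ hs hc]
    have := mul_le_mul h1 h2 hc.le hs.le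
    nlinarith [mul_pos hsa hca]
  · have h3 := h.innerPt_sq_le hφ
    have h4 := Real.sin_sq_add_cos_sq α
    rw [← sq_abs (innerPt α β φ 1)] at h3
    nlinarith [sq_nonneg (innerPt α β φ 0 - Real.cos α),
      sq_nonneg (|innerPt α β φ 1| - Real.sin α)]

lemma outerPt_mem_Q (h : Angles α β) {φ : ℝ} (hφ : |φ| ≤ β) : outerPt α β φ ∈ Q α := by
  have hs := h.sinβ; have hc := h.cosβ; have hsa := h.sinα; have hca := h.cosα
  have h1 := abs_sin_le_of_abs_le h.lt_pi_div_two.le hφ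
  have h2 := cos_le_cos_of_abs_le (by linarith [h.lt_pi_div_two, Real.pi_pos]) hφ
  rw [mem_Q_iff hsa hca]
  simp only [outerPt, Matrix.cons_val_zero, Matrix.cons_val_one]
  rw [abs_mul, abs_of_pos h.semiY_pos]
  constructor
  · rw [semiX, semiY, div_mul_eq_mul_div, div_mul_eq_mul_div, div_mul_eq_mul_div,
      div_mul_eq_mul_div, div_le_div_iff₀ hsa hca]
    have h4 := h.sinβ_le
    have h5 := h.cosα_le
    calc Real.sin β * |Real.sin φ| * Real.cos α * Real.cos α
        = (Real.sin β * Real.cos α) * (|Real.sin φ| * Real.cos α) := by ring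
      _ ≤ (Real.sin α * Real.cos β) * (Real.sin α * Real.cos φ) := by
        gcongr
        · exact h1.trans h4
        · exact h5.trans h2
      _ = _ := by ring
  · have e : semiX α β * Real.cos φ * Real.cos α + semiY α β * |Real.sin φ| * Real.sin α =
        Real.cos φ * (semiX α β * Real.cos α) + |Real.sin φ| * (semiY α β * Real.sin α) := by ring
    rw [e, h.semiX_mul, h.semiY_mul]
    have e1 := Real.sin_sq_add_cos_sq φ
    have e3 := Real.sin_sq_add_cos_sq β
    rw [← sq_abs (Real.sin φ)] at e1
    nlinarith [sq_nonneg (Real.cos φ - Real.cos β), sq_nonneg (|Real.sin φ| - Real.sin β)]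

lemma exists_smul_innerPt (h : Angles α β) {x : Plane} (hx : x ∈ Q α) :
    ∃ r ψ : ℝ, 0 ≤ r ∧ |ψ| ≤ β ∧ x = r • innerPt α β ψ := by
  have hs := h.sinβ; have hc := h.cosβ; have hsa := h.sinα; have hca := h.cosα
  have hP := h.semiX_pos; have hR := h.semiY_pos
  obtain ⟨h1, -⟩ := (mem_Q_iff hsa hca).1 hx
  have h0 : 0 ≤ x 0 := nonneg_of_mul_nonneg_left ((by positivity : 0 ≤ |x 1| * Real.cos α).trans h1) hsa
  obtain ⟨r, ψ, hr, hψ, -, e0, e1⟩ := exists_polar_of_abs_le (u := semiX α β * x 0)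
    (w := semiY α β * x 1) (t := Real.tan β)
    (by rw [Real.tan_eq_sin_div_cos]; positivity) (by
      rw [abs_mul, abs_of_pos hR, Real.tan_eq_sin_div_cos, mul_div_assoc', le_div_iff₀ hc]
      rw [← h.semiX_mul, ← h.semiY_mul]
      calc _ = semiY α β * semiX α β * (|x 1| * Real.cos α) := by ring
        _ ≤ semiY α β * semiX α β * (x 0 * Real.sin α) := by gcongr
        _ = _ := by ring) (mul_nonneg hP.le h0)
  rw [Real.arctan_tan (by linarith [Real.pi_pos, h.pos]) h.lt_pi_div_two] at hψ
  refine ⟨r, ψ, hr, hψ, plane_ext ?_ ?_⟩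
  · simp only [innerPt, PiLp.smul_apply, smul_eq_mul, Matrix.cons_val_zero]
    rw [mul_left_comm, ← e0]; field_simp
  · simp only [innerPt, PiLp.smul_apply, smul_eq_mul, Matrix.cons_val_one,
      Matrix.cons_val_zero]
    rw [mul_left_comm, ← e1]; field_simp

lemma exists_smul_outerPt (h : Angles α β) {x : Plane} (hx : x ∈ Q α) :
    ∃ r ψ : ℝ, 0 ≤ r ∧ |ψ| ≤ outerAngle α β ∧ x = r • outerPt α β ψ := by
  have hs := h.sinβ; have hc := h.cosβ; have hsa := h.sinα; have hca := h.cosα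
  have hP := h.semiX_pos; have hR := h.semiY_pos
  obtain ⟨h1, -⟩ := (mem_Q_iff hsa hca).1 hx
  have h0 : 0 ≤ x 0 := nonneg_of_mul_nonneg_left ((by positivity : 0 ≤ |x 1| * Real.cos α).trans h1) hsa
  obtain ⟨r, ψ, hr, hψ, -, e0, e1⟩ := exists_polar_of_abs_le (u := x 0 / semiX α β)
    (w := x 1 / semiY α β) (t := Real.sin α ^ 2 * Real.cos β / (Real.cos α ^ 2 * Real.sin β))
    (by positivity) (by
      rw [abs_div, abs_of_pos hR, ← h.semiX_mul, ← h.semiY_mul]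
      have : x 0 / semiX α β * (Real.sin α ^ 2 * (semiX α β * Real.cos α) / (Real.cos α ^ 2 *
        (semiY α β * Real.sin α))) = x 0 * Real.sin α / (semiY α β * Real.cos α) := by field_simp
      rw [this, div_le_div_iff₀ hR (by positivity)]
      calc _ = semiY α β * (|x 1| * Real.cos α) := by ring
        _ ≤ semiY α β * (x 0 * Real.sin α) := by gcongr
        _ = _ := by ring) (div_nonneg h0 hP.le)
  refine ⟨r, ψ, hr, hψ, plane_ext ?_ ?_⟩
  · simp only [outerPt, PiLp.smul_apply, smul_eq_mul, Matrix.cons_val_zero]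
    rw [mul_left_comm, ← e0]; field_simp
  · simp only [outerPt, PiLp.smul_apply, smul_eq_mul, Matrix.cons_val_one,
      Matrix.cons_val_zero]
    rw [mul_left_comm, ← e1]; field_simp

/-- In eccentric polar coordinates the pairing of the two ellipses is `cos (φ - ψ)`, so the
constraint at `φ = ψ` is the strongest and says `r ≤ 1`. -/
lemma mem_innerRegion_iff (h : Angles α β) {x : Plane} :
    x ∈ innerRegion α β ↔ ∃ ψ ∈ Icc (-β) β, ∃ r ∈ Icc (0 : ℝ) 1, x = r • innerPt α β ψ := by
  constructor
  · rintro ⟨hx, hp⟩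
    obtain ⟨r, ψ, hr, hψ, rfl⟩ := h.exists_smul_innerPt hx
    have := hp ψ (abs_le.1 hψ)
    rw [inner_smul_left, h.inner_outerPt] at this
    exact ⟨ψ, abs_le.1 hψ, r, ⟨hr, by simpa using this⟩, rfl⟩
  · rintro ⟨ψ, hψ, r, hr, rfl⟩
    refine ⟨(convex_Q α).smul_mem_of_zero_mem (zero_mem_Q α) (h.innerPt_mem_Q (abs_le.2 hψ)) hr,
      fun φ _ => ?_⟩
    rw [inner_smul_left, h.inner_outerPt]
    calc _ ≤ r * 1 := mul_le_mul_of_nonneg_left (Real.cos_le_one _) hr.1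
      _ ≤ 1 := by linarith [hr.2]

lemma cos_radius_pos (h : Angles α β) {ψ : ℝ} (hψ : |ψ| ≤ outerAngle α β) :
    0 < Real.cos (max 0 (|ψ| - β)) := by
  refine Real.cos_pos_of_mem_Ioo ⟨?_, ?_⟩
  · linarith [le_max_left 0 (|ψ| - β), Real.pi_pos]
  · exact max_lt (by linarith [Real.pi_pos]) (by linarith [outerAngle_lt α β, h.pos])

/-- The side triangle of the outer region, in terms of the eccentric angle. The factor `ε` is `1`
at `c` and `-1` at `a`. -/
lemma smul_outerPt_mem_segment (h : Angles α β) (ε : ℝ) {ψ : ℝ}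
    (hψ : ψ ∈ Icc β (outerAngle α β)) :
    (1 / Real.cos (ψ - β)) • (!₂[semiX α β * Real.cos ψ, ε * (semiY α β * Real.sin ψ)] : Plane) ∈
      segment ℝ (!₂[semiX α β * Real.cos β, ε * (semiY α β * Real.sin β)] : Plane)
        !₂[Real.cos α, ε * Real.sin α] := by
  have hs := h.sinβ; have hc := h.cosβ; have hsa := h.sinα; have hca := h.cosα
  have hcψ : 0 < Real.cos (ψ - β) := Real.cos_pos_of_mem_Ioo
    ⟨by linarith [hψ.1, Real.pi_pos], by linarith [hψ.2, outerAngle_lt α β, h.pos]⟩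
  set σ := Real.tan (ψ - β) with hσ
  have hσ0 : 0 ≤ σ := Real.tan_nonneg_of_nonneg_of_le_pi_div_two (by linarith [hψ.1])
    (by linarith [hψ.2, outerAngle_lt α β, h.pos])
  have hσs : σ ≤ tanGap α β := by
    rw [← h.tan_outerAngle_sub]
    rcases hψ.2.eq_or_lt with e | e
    · rw [hσ, e]
    · exact (Real.tan_lt_tan_of_lt_of_lt_pi_div_two (by linarith [hψ.1, Real.pi_pos])
        (by linarith [outerAngle_lt α β, h.pos]) (by linarith)).le
  have e0 : Real.cos ψ = Real.cos (ψ - β) * (Real.cos β - σ * Real.sin β) := by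
    rw [hσ, Real.tan_eq_sin_div_cos]
    conv_lhs => rw [← sub_add_cancel ψ β, Real.cos_add]
    field_simp
  have e1 : Real.sin ψ = Real.cos (ψ - β) * (Real.sin β + σ * Real.cos β) := by
    rw [hσ, Real.tan_eq_sin_div_cos]
    conv_lhs => rw [← sub_add_cancel ψ β, Real.sin_add]
    field_simp; ring
  have hsc := Real.sin_sq_add_cos_sq β
  have hsc' := Real.sin_sq_add_cos_sq α
  have c0 : Real.cos α = semiX α β * (Real.cos β - tanGap α β * Real.sin β) := by
    rw [semiX, tanGap]; field_simp
    linear_combination (-Real.cos α ^ 2) * hsc + Real.cos β ^ 2 * hsc'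
  have c1 : Real.sin α = semiY α β * (Real.sin β + tanGap α β * Real.cos β) := by
    rw [semiY, tanGap]; field_simp
    linear_combination (-Real.sin α ^ 2) * hsc + Real.sin β ^ 2 * hsc'
  have hg := h.tanGap_nonneg
  refine segment_eq_image ℝ _ (!₂[Real.cos α, ε * Real.sin α] : Plane) ▸
    ⟨σ / tanGap α β, ⟨by positivity, div_le_one_of_le₀ hσs hg⟩, ?_⟩
  -- For `β = α` the gap is `0` and the quotient takes its default value `0`; then `σ = 0` too, so
  -- the identity survives.
  have hσ' : σ / tanGap α β * tanGap α β = σ :=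
    div_mul_cancel_of_imp fun h0 => le_antisymm (h0 ▸ hσs) hσ0
  apply plane_ext
  · simp only [PiLp.add_apply, PiLp.smul_apply, smul_eq_mul, Matrix.cons_val_zero]
    rw [e0, c0]
    field_simp
    linear_combination (-semiX α β * Real.sin β) * hσ'
  · simp only [PiLp.add_apply, PiLp.smul_apply, smul_eq_mul, Matrix.cons_val_one,
      Matrix.cons_val_zero]
    rw [e1, c1]
    field_simp
    linear_combination (ε * semiY α β * Real.cos β) * hσ'

lemma outerRadius_smul_mem (h : Angles α β) {S : Set Plane} (hS : Convex ℝ S)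
    (ha : ptA α ∈ S) (hc : ptC α ∈ S) (hO : ∀ φ ∈ Icc (-β) β, outerPt α β φ ∈ S) {ψ : ℝ}
    (hψ : |ψ| ≤ outerAngle α β) : outerRadius β ψ • outerPt α β ψ ∈ S := by
  rcases le_total |ψ| β with hle | hle
  · rw [outerRadius, max_eq_left (by linarith)]
    simpa using hO ψ (abs_le.1 hle)
  · rw [outerRadius, max_eq_right (by linarith)]
    have hβ := h.pos
    rcases abs_cases ψ with ⟨e, -⟩ | ⟨e, -⟩
    · rw [e] at hle hψ ⊢
      have := h.smul_outerPt_mem_segment 1 ⟨hle, hψ⟩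
      simp only [one_mul] at this
      exact hS.segment_subset (hO β ⟨by linarith, le_rfl⟩) hc this
    · rw [e] at hle hψ ⊢
      have := h.smul_outerPt_mem_segment (-1) ⟨hle, hψ⟩
      simp only [neg_one_mul, Real.sin_neg, Real.cos_neg, mul_neg, neg_neg] at this
      refine hS.segment_subset ?_ ha this
      have := hO (-β) ⟨le_rfl, by linarith⟩
      simpa [outerPt] using this

/-- The strongest constraint comes from the `φ ∈ [-β, β]` nearest to `ψ`: it is `ψ` itself on the
arc, and `±β`, that is `c` or `a`, beyond it. Conversely the points at full radius lie on the arc or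
on the segments from it to `a` and `c`. -/
lemma mem_outerRegion_iff (h : Angles α β) {x : Plane} :
    x ∈ outerRegion α β ↔ ∃ ψ ∈ Icc (-outerAngle α β) (outerAngle α β),
      ∃ r ∈ Icc (0 : ℝ) (outerRadius β ψ), x = r • outerPt α β ψ := by
  have hβ := h.pos
  have hconv : Convex ℝ (outerRegion α β) := convex_polarRegion α β _
  constructor
  · rintro ⟨hx, hp⟩
    obtain ⟨r, ψ, hr, hψ, rfl⟩ := h.exists_smul_outerPt hx
    refine ⟨ψ, abs_le.1 hψ, r, ⟨hr, ?_⟩, rfl⟩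
    have hcos := h.cos_radius_pos hψ
    rw [outerRadius, le_div_iff₀ hcos]
    have key : ∀ φ ∈ Icc (-β) β, r * Real.cos (φ - ψ) ≤ 1 := by
      intro φ hφ
      have := hp φ hφ
      rw [inner_smul_left, real_inner_comm, h.inner_outerPt] at this
      simpa using this
    rcases le_total |ψ| β with hle | hle
    · rw [max_eq_left (by linarith)]
      simpa using key ψ (abs_le.1 hle)
    · rw [max_eq_right (by linarith)]
      rcases abs_cases ψ with ⟨e, -⟩ | ⟨e, -⟩
      · rw [e, ← Real.cos_neg, neg_sub]; exact key β ⟨by linarith, le_rfl⟩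
      · have := key (-β) ⟨le_rfl, by linarith⟩
        rwa [e, show -ψ - β = -β - ψ by ring]
  · rintro ⟨ψ, hψ, r, hr, rfl⟩
    have hψ := abs_le.2 hψ
    have hcos := h.cos_radius_pos hψ
    have hrad : 0 < outerRadius β ψ := one_div_pos.2 hcos
    have h0 : (0 : Plane) ∈ outerRegion α β := ⟨zero_mem_Q α, fun φ _ => by simp⟩
    have key : outerRadius β ψ • outerPt α β ψ ∈ outerRegion α β := by
      have hin : ∀ φ ∈ Icc (-β) β, innerPt α β φ ∈ Q α := fun φ hφ => h.innerPt_mem_Q (abs_le.2 hφ)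
      have hb : ∀ x ∈ Q α, ⟪ptA α, x⟫ ≤ 1 ∧ ⟪ptC α, x⟫ ≤ 1 := by
        intro x hx
        have := ((mem_Q_iff h.sinα h.cosα).1 hx).2
        have h1 := mul_le_mul_of_nonneg_right (le_abs_self (x 1)) h.sinα.le
        have h2 := mul_le_mul_of_nonneg_right (neg_abs_le (x 1)) h.sinα.le
        rw [real_inner_comm, inner_ptA, real_inner_comm, inner_ptC]
        constructor <;> linarith
      refine h.outerRadius_smul_mem hconv ⟨ptA_mem_Q α, fun φ hφ => (hb _ (hin φ hφ)).1⟩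
        ⟨ptC_mem_Q α, fun φ hφ => (hb _ (hin φ hφ)).2⟩
        (fun φ hφ => ⟨h.outerPt_mem_Q (abs_le.2 hφ), fun θ _ => ?_⟩) hψ
      rw [real_inner_comm, h.inner_outerPt]; exact Real.cos_le_one _
    have := hconv.smul_mem_of_zero_mem h0 key (t := r / outerRadius β ψ)
      ⟨div_nonneg hr.1 hrad.le, (div_le_one hrad).2 hr.2⟩
    rwa [smul_smul, div_mul_cancel₀ _ hrad.ne'] at this

lemma innerRegion_subset (h : Angles α β) {S : Set Plane} (hS : Convex ℝ S) (h0 : 0 ∈ S)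
    (hI : ∀ φ ∈ Icc (-β) β, innerPt α β φ ∈ S) : innerRegion α β ⊆ S := by
  intro x hx
  obtain ⟨ψ, hψ, r, hr, rfl⟩ := h.mem_innerRegion_iff.1 hx
  exact hS.smul_mem_of_zero_mem h0 (hI ψ hψ) hr

lemma outerRegion_subset (h : Angles α β) {S : Set Plane} (hS : Convex ℝ S) (h0 : 0 ∈ S)
    (ha : ptA α ∈ S) (hc : ptC α ∈ S) (hO : ∀ φ ∈ Icc (-β) β, outerPt α β φ ∈ S) :
    outerRegion α β ⊆ S := by
  intro x hx
  obtain ⟨ψ, hψ, r, hr, rfl⟩ := h.mem_outerRegion_iff.1 hx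
  have hrad : 0 < outerRadius β ψ := one_div_pos.2 (h.cos_radius_pos (abs_le.2 hψ))
  have := hS.smul_mem_of_zero_mem h0 (h.outerRadius_smul_mem hS ha hc hO (abs_le.2 hψ))
    (t := r / outerRadius β ψ) ⟨div_nonneg hr.1 hrad.le, (div_le_one hrad).2 hr.2⟩
  rwa [smul_smul, div_mul_cancel₀ _ hrad.ne'] at this

lemma toProd_smul (S : Set Plane) {p q a b : ℝ} {ρ : ℝ → ℝ}
    (hS : ∀ x, x ∈ S ↔ ∃ ψ ∈ Icc a b, ∃ r ∈ Icc 0 (ρ ψ),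
      x = r • !₂[p * Real.cos ψ, q * Real.sin ψ]) : toProd S = radialRegion p q a b ρ := by
  ext z
  change !₂[z.1, z.2] ∈ S ↔ _
  rw [hS]
  refine exists_congr fun ψ => and_congr_right fun _ => exists_congr fun r =>
    and_congr_right fun _ => ?_
  constructor
  · intro e
    have e0 := congrFun (congrArg WithLp.ofLp e) 0
    have e1 := congrFun (congrArg WithLp.ofLp e) 1
    simp at e0 e1
    ext
    · simp only [e0]; ring
    · simp only [e1]; ring
  · rintro rfl
    apply plane_ext <;> simp <;> ring

lemma area_innerRegion (h : Angles α β) :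
    area (innerRegion α β) = β / (semiX α β * semiY α β) := by
  have hP := h.semiX_pos; have hR := h.semiY_pos; have hβ := h.pos; have hβ' := h.lt_pi_div_two
  rw [area_eq, toProd_smul _ (ρ := fun _ => 1) (fun x => h.mem_innerRegion_iff), Measure.real,
    volume_radialRegion (one_div_pos.2 hP) (one_div_pos.2 hR) (by linarith [Real.pi_pos])
      (by linarith) (by linarith [Real.pi_pos]) continuousOn_const (fun _ _ => zero_le_one),
    ENNReal.toReal_ofReal]
  · simp; field_simp; ring
  · simp; positivity

lemma integral_outerRadius (h : Angles α β) :
    ∫ x in -outerAngle α β..outerAngle α β, outerRadius β x ^ 2 = 2 * (β + tanGap α β) := by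
  have hβ := h.pos; have hβ' := h.lt_pi_div_two
  have hγ := outerAngle_lt α β
  have hle := h.le_outerAngle
  have hcont : ContinuousOn (fun x => outerRadius β x ^ 2)
      (Icc (-outerAngle α β) (outerAngle α β)) :=
    ContinuousOn.pow (ContinuousOn.div₀ continuousOn_const (by fun_prop)
      fun x hx => (h.cos_radius_pos (abs_le.2 hx)).ne') 2
  have hint : ∀ a b, -outerAngle α β ≤ a → a ≤ b → b ≤ outerAngle α β →
      IntervalIntegrable (fun x => outerRadius β x ^ 2) volume a b := fun a b h1 h2 h3 =>
    ContinuousOn.intervalIntegrable (by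
      rw [uIcc_of_le h2]; exact hcont.mono (Icc_subset_Icc h1 h3))
  have e1 : ∫ x in -outerAngle α β..0, outerRadius β x ^ 2 =
      ∫ x in 0..outerAngle α β, outerRadius β x ^ 2 := by
    have := intervalIntegral.integral_comp_neg (a := 0) (b := outerAngle α β)
      (fun x => outerRadius β x ^ 2)
    rw [neg_zero] at this
    rw [← this]
    simp [outerRadius]
  have e2 : ∫ x in 0..β, outerRadius β x ^ 2 = β := by
    rw [intervalIntegral.integral_congr (g := fun _ => 1)]
    · simp
    · intro x hx
      rw [uIcc_of_le hβ.le] at hx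
      simp only [outerRadius]
      rw [abs_of_nonneg hx.1, max_eq_left (by linarith [hx.2])]
      simp
  have e3 : ∫ x in β..outerAngle α β, outerRadius β x ^ 2 = tanGap α β := by
    rw [← h.tan_outerAngle_sub, ← integral_inv_cos_sq hle (by linarith)]
    refine intervalIntegral.integral_congr fun x hx => ?_
    rw [uIcc_of_le hle] at hx
    simp only [outerRadius]
    rw [abs_of_nonneg (by linarith [hx.1]), max_eq_right (by linarith [hx.1])]
  rw [← intervalIntegral.integral_add_adjacent_intervals (hint _ 0 le_rfl (by linarith)
    (by linarith)) (hint 0 _ (by linarith) (by linarith) le_rfl), e1,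
    ← intervalIntegral.integral_add_adjacent_intervals (hint 0 β (by linarith) hβ.le hle)
    (hint β _ (by linarith) hle le_rfl), e2, e3]
  ring

lemma area_outerRegion (h : Angles α β) :
    area (outerRegion α β) = semiX α β * semiY α β * (β + tanGap α β) := by
  have hP := h.semiX_pos; have hR := h.semiY_pos; have hβ := h.pos; have hβ' := h.lt_pi_div_two
  have hγ := outerAngle_lt α β
  have hle := h.le_outerAngle
  have hg := h.tanGap_nonneg
  rw [area_eq, toProd_smul _ (ρ := outerRadius β) (fun x => h.mem_outerRegion_iff), Measure.real,
    volume_radialRegion (ρ := outerRadius β) hP hR (by linarith [Real.pi_pos])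
      (by linarith) (by linarith [Real.pi_pos])
      (ContinuousOn.div₀ continuousOn_const (by fun_prop)
        fun x hx => (h.cos_radius_pos (abs_le.2 hx)).ne')
      (fun x hx => (one_div_pos.2 (h.cos_radius_pos (abs_le.2 hx))).le),
    h.integral_outerRadius, ENNReal.toReal_ofReal]
  · ring
  · positivity

end Angles

/-! ### Boundaries of the extremal regions -/

lemma inner_ptA_le {α : ℝ} (hs : 0 < Real.sin α) (hc : 0 < Real.cos α) {x : Plane}
    (hx : x ∈ Q α) : ⟪ptA α, x⟫ ≤ 1 := by
  have := ((mem_Q_iff hs hc).1 hx).2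
  have h2 := mul_le_mul_of_nonneg_right (neg_abs_le (x 1)) hs.le
  rw [real_inner_comm, inner_ptA]
  linarith

lemma inner_ptC_le {α : ℝ} (hs : 0 < Real.sin α) (hc : 0 < Real.cos α) {x : Plane}
    (hx : x ∈ Q α) : ⟪ptC α, x⟫ ≤ 1 := by
  have := ((mem_Q_iff hs hc).1 hx).2
  have h2 := mul_le_mul_of_nonneg_right (le_abs_self (x 1)) hs.le
  rw [real_inner_comm, inner_ptC]
  linarith

lemma mem_frontier_of_inner_le {S : Set Plane} {x n : Plane} (hx : x ∈ S) (hn : n ≠ 0)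
    (h : ∀ y ∈ S, ⟪n, y⟫ ≤ ⟪n, x⟫) : x ∈ frontier S := by
  refine ⟨subset_closure hx, fun hi => ?_⟩
  have hcont : ContinuousAt (fun t : ℝ => x + t • n) 0 := by fun_prop
  have h1 : ∀ᶠ t : ℝ in 𝓝 0, x + t • n ∈ S :=
    hcont.eventually (by simpa using mem_interior_iff_mem_nhds.1 hi)
  obtain ⟨t, ht, ht0⟩ := ((h1.filter_mono nhdsWithin_le_nhds).and
    (self_mem_nhdsWithin : Ioi (0 : ℝ) ∈ 𝓝[>] 0)).exists
  have := h _ ht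
  rw [inner_add_right, inner_smul_right] at this
  have hp : 0 < ⟪n, n⟫ := real_inner_self_pos.2 hn
  have := mul_pos (show 0 < t from ht0) hp
  linarith

/-- A nonzero linear functional attains its maximum over a compact set on the boundary. Thus a
description of the boundary of `C` alone decides which points are polar to `C`. -/
lemma inner_le_one_of_frontier {S : Set Plane} (hS : IsCompact S) {y : Plane}
    (h : ∀ x ∈ frontier S, ⟪x, y⟫ ≤ 1) : ∀ x ∈ S, ⟪x, y⟫ ≤ 1 := by
  intro x hx
  by_cases hy : y = 0
  · simp [hy]
  obtain ⟨z, hz, hmax⟩ := hS.exists_isMaxOn ⟨x, hx⟩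
    (f := fun x => ⟪x, y⟫) (by fun_prop)
  refine (hmax hx).trans (h z (mem_frontier_of_inner_le hz hy fun w hw => ?_))
  rw [real_inner_comm, real_inner_comm z]
  exact hmax hw

lemma isClosed_polarRegion (α β : ℝ) (B : ℝ → Plane) : IsClosed (polarRegion α β B) := by
  rw [polarRegion_eq]
  exact (isCompact_Q α).isClosed.inter
    (isClosed_biInter fun φ _ => isClosed_le (by fun_prop) continuous_const)

lemma zero_mem_polarRegion (α β : ℝ) (B : ℝ → Plane) : (0 : Plane) ∈ polarRegion α β B :=
  ⟨zero_mem_Q α, fun φ _ => by simp⟩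

/-- Strict inequalities persist nearby; for the family over `φ` this uses compactness of `[-β, β]`.
-/
lemma mem_interior_polarRegion {α β : ℝ} (hs : 0 < Real.sin α) (hc : 0 < Real.cos α)
    {B : ℝ → Plane} (hB : Continuous B) {x : Plane} (h1 : |x 1| * Real.cos α < x 0 * Real.sin α)
    (h2 : x 0 * Real.cos α + |x 1| * Real.sin α < 1)
    (h3 : ∀ φ ∈ Icc (-β) β, ⟪x, B φ⟫ < 1) : x ∈ interior (polarRegion α β B) := by
  rw [mem_interior_iff_mem_nhds]
  have e1 : ∀ᶠ z : Plane in 𝓝 x, |z 1| * Real.cos α < z 0 * Real.sin α :=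
    ContinuousAt.eventually_lt (by fun_prop) (by fun_prop) h1
  have e2 : ∀ᶠ z : Plane in 𝓝 x, z 0 * Real.cos α + |z 1| * Real.sin α < 1 :=
    ContinuousAt.eventually_lt (by fun_prop) (by fun_prop) h2
  have e3 : ∀ᶠ z : Plane in 𝓝 x, ∀ φ ∈ Icc (-β) β, ⟪z, B φ⟫ < 1 :=
    isCompact_Icc.eventually_forall_of_forall_eventually fun φ hφ =>
      ContinuousAt.eventually_lt (f := fun z : Plane × ℝ => ⟪z.1, B z.2⟫)
        (Continuous.continuousAt (by fun_prop)) continuousAt_const (h3 φ hφ)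
  filter_upwards [e1, e2, e3] with z z1 z2 z3
  exact ⟨(mem_Q_iff hs hc).2 ⟨z1.le, z2.le⟩, fun φ hφ => (z3 φ hφ).le⟩

lemma segments_subset_frontier {α β : ℝ} (hs : 0 < Real.sin α) (hc : 0 < Real.cos α)
    {B : ℝ → Plane} (hB : ∀ φ ∈ Icc (-β) β, B φ ∈ Q α) :
    segment ℝ 0 (ptA α) ∪ segment ℝ 0 (ptC α) ⊆ frontier (polarRegion α β B) := by
  have hconv := convex_polarRegion α β B
  have h0 := zero_mem_polarRegion α β B
  rintro x (hx | hx)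
  · have hxS := hconv.segment_subset h0
      ⟨ptA_mem_Q α, fun φ hφ => inner_ptA_le hs hc (hB φ hφ)⟩ hx
    rw [segment_eq_image] at hx
    obtain ⟨t, ht, rfl⟩ := hx
    refine mem_frontier_of_inner_le (n := !₂[-Real.sin α, -Real.cos α]) hxS ?_ fun y hy => ?_
    · intro h
      have := congrFun (congrArg WithLp.ofLp h) 0
      simp at this
      linarith
    · have := ((mem_Q_iff hs hc).1 hy.1).1
      have h2 := mul_le_mul_of_nonneg_right (neg_abs_le (y 1)) hc.le
      simp [inner_plane, ptA]
      nlinarith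
  · have hxS := hconv.segment_subset h0
      ⟨ptC_mem_Q α, fun φ hφ => inner_ptC_le hs hc (hB φ hφ)⟩ hx
    rw [segment_eq_image] at hx
    obtain ⟨t, ht, rfl⟩ := hx
    refine mem_frontier_of_inner_le (n := !₂[-Real.sin α, Real.cos α]) hxS ?_ fun y hy => ?_
    · intro h
      have := congrFun (congrArg WithLp.ofLp h) 0
      simp at this
      linarith
    · have := ((mem_Q_iff hs hc).1 hy.1).1
      have h2 := mul_le_mul_of_nonneg_right (le_abs_self (y 1)) hc.le
      simp [inner_plane, ptC]
      nlinarith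

lemma mem_segment_of_cone_eq {α : ℝ} (hs : 0 < Real.sin α) (hc : 0 < Real.cos α) {x : Plane}
    (hx : x ∈ Q α) (he : |x 1| * Real.cos α = x 0 * Real.sin α) :
    x ∈ segment ℝ 0 (ptA α) ∪ segment ℝ 0 (ptC α) := by
  have h2 := ((mem_Q_iff hs hc).1 hx).2
  have hsc := Real.sin_sq_add_cos_sq α
  have ht : |x 1| / Real.sin α ∈ Icc (0 : ℝ) 1 := by
    refine ⟨by positivity, (div_le_one hs).2 ?_⟩
    have h3 := mul_le_mul_of_nonneg_left h2 hs.le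
    nlinarith
  have e0 : x 0 = |x 1| / Real.sin α * Real.cos α := by field_simp; linarith
  rw [segment_eq_image, segment_eq_image]
  rcases abs_cases (x 1) with ⟨e, -⟩ | ⟨e, -⟩
  · right
    refine ⟨_, ht, plane_ext ?_ ?_⟩
    · simp [ptC]; exact e0.symm
    · simp [ptC, div_mul_cancel₀ _ hs.ne', e]
  · left
    refine ⟨_, ht, plane_ext ?_ ?_⟩
    · simp [ptA]; exact e0.symm
    · simp [ptA, div_mul_cancel₀ _ hs.ne', e]

namespace Angles

variable {α β : ℝ}

lemma innerPt_ne_zero (h : Angles α β) (φ : ℝ) : innerPt α β φ ≠ 0 := fun e => by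
  have := h.inner_outerPt φ φ
  rw [e] at this
  simp at this

lemma outerPt_ne_zero (h : Angles α β) (φ : ℝ) : outerPt α β φ ≠ 0 := fun e => by
  have := h.inner_outerPt φ φ
  rw [e] at this
  simp at this

lemma innerPt_mem (h : Angles α β) {φ : ℝ} (hφ : φ ∈ Icc (-β) β) :
    innerPt α β φ ∈ innerRegion α β :=
  h.mem_innerRegion_iff.2 ⟨φ, hφ, 1, by simp, by simp⟩

lemma outerPt_mem (h : Angles α β) {φ : ℝ} (hφ : φ ∈ Icc (-β) β) :
    outerPt α β φ ∈ outerRegion α β :=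
  ⟨h.outerPt_mem_Q (abs_le.2 hφ), fun θ _ => by
    rw [real_inner_comm, h.inner_outerPt]; exact Real.cos_le_one _⟩

lemma frontier_innerRegion (h : Angles α β) : frontier (innerRegion α β) =
    segment ℝ 0 (ptA α) ∪ segment ℝ 0 (ptC α) ∪ innerPt α β '' Icc (-β) β := by
  apply Subset.antisymm
  · intro x hx
    have hxS : x ∈ innerRegion α β := (isClosed_polarRegion α β _).frontier_subset hx
    obtain ⟨h1, h2⟩ := (mem_Q_iff h.sinα h.cosα).1 hxS.1
    rcases h1.eq_or_lt with h1 | h1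
    · exact Or.inl (mem_segment_of_cone_eq h.sinα h.cosα hxS.1 h1)
    · right
      obtain ⟨ψ, hψ, r, hr, rfl⟩ := h.mem_innerRegion_iff.1 hxS
      rcases hr.2.eq_or_lt with hr1 | hr1
      · exact ⟨ψ, hψ, by simp [hr1]⟩
      · exfalso
        refine hx.2 (mem_interior_polarRegion h.sinα h.cosα (continuous_outerPt α β) h1 ?_ ?_)
        · have h3 := ((mem_Q_iff h.sinα h.cosα).1 (h.innerPt_mem_Q (abs_le.2 hψ))).2
          simp only [PiLp.smul_apply, smul_eq_mul, abs_mul, abs_of_nonneg hr.1]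
          nlinarith [hr.1]
        · intro φ _
          rw [inner_smul_left, h.inner_outerPt]
          calc _ ≤ r * 1 := mul_le_mul_of_nonneg_left (Real.cos_le_one _) hr.1
            _ < 1 := by linarith
  · refine union_subset (segments_subset_frontier h.sinα h.cosα fun φ hφ =>
      h.outerPt_mem_Q (abs_le.2 hφ)) ?_
    rintro _ ⟨φ, hφ, rfl⟩
    refine mem_frontier_of_inner_le (h.innerPt_mem hφ) (h.outerPt_ne_zero φ) fun y hy => ?_
    rw [real_inner_comm, real_inner_comm (innerPt α β φ), h.inner_outerPt, sub_self, Real.cos_zero]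
    exact hy.2 φ hφ

lemma inner_outerPt_smul (h : Angles α β) (r φ ψ : ℝ) :
    ⟪r • outerPt α β ψ, innerPt α β φ⟫ = r * Real.cos (φ - ψ) := by
  rw [inner_smul_left, real_inner_comm, h.inner_outerPt]; rfl

/-- Equality in some constraint would, for `|ψ| ≤ β`, force `r = 1` and put the point on the arc;
for larger `|ψ|` the constraint at `c` or `a` dominates, and that one is strict. -/
lemma inner_lt_one_of_strict (h : Angles α β) {x : Plane} (hx : x ∈ outerRegion α β)
    (h2 : x 0 * Real.cos α + |x 1| * Real.sin α < 1) (hJ : x ∉ outerPt α β '' Icc (-β) β) :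
    ∀ φ ∈ Icc (-β) β, ⟪x, innerPt α β φ⟫ < 1 := by
  intro φ hφ
  by_contra! hle
  have hβ := h.pos
  have hγ := outerAngle_lt α β
  have hβ' := h.lt_pi_div_two
  obtain ⟨ψ, hψ, r, hr, rfl⟩ := h.mem_outerRegion_iff.1 hx
  rw [h.inner_outerPt_smul] at hle
  have hc : ⟪r • outerPt α β ψ, ptC α⟫ < 1 := by
    rw [inner_ptC]
    have := mul_le_mul_of_nonneg_right (le_abs_self ((r • outerPt α β ψ) 1)) h.sinα.le
    linarith
  have ha : ⟪r • outerPt α β ψ, ptA α⟫ < 1 := by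
    rw [inner_ptA]
    have := mul_le_mul_of_nonneg_right (neg_abs_le ((r • outerPt α β ψ) 1)) h.sinα.le
    linarith
  rw [← h.innerPt_self, h.inner_outerPt_smul] at hc
  rw [← h.innerPt_neg_self, h.inner_outerPt_smul] at ha
  rcases le_total |ψ| β with h3 | h3
  · have h4 := hx.2 ψ (abs_le.1 h3)
    rw [h.inner_outerPt_smul, sub_self, Real.cos_zero, mul_one] at h4
    have h5 : r * Real.cos (φ - ψ) ≤ r * 1 := mul_le_mul_of_nonneg_left (Real.cos_le_one _) hr.1
    have : r = 1 := by linarith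
    exact hJ ⟨ψ, abs_le.1 h3, by simp [this]⟩
  · rcases abs_cases ψ with ⟨e, -⟩ | ⟨e, -⟩
    · rw [e] at h3
      have : Real.cos (φ - ψ) ≤ Real.cos (β - ψ) := by
        rw [← Real.cos_neg, ← Real.cos_neg (β - ψ)]
        exact Real.cos_le_cos_of_nonneg_of_le_pi (by linarith) (by linarith [hφ.1, hψ.2])
          (by linarith [hφ.2])
      have := mul_le_mul_of_nonneg_left this hr.1
      linarith
    · rw [e] at h3
      have : Real.cos (φ - ψ) ≤ Real.cos (-β - ψ) :=
        Real.cos_le_cos_of_nonneg_of_le_pi (by linarith) (by linarith [hφ.2, hψ.1])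
          (by linarith [hφ.1])
      have := mul_le_mul_of_nonneg_left this hr.1
      linarith

/-- For `|ψ| ≤ β` equality leaves only `r = 1`, a point of the arc. Otherwise equality at `c` or `a`
fixes `r` as the reciprocal cosine for which the point lies on the tangent segment. -/
lemma mem_of_outer_side (h : Angles α β) {x : Plane} (hx : x ∈ outerRegion α β)
    (h2 : x 0 * Real.cos α + |x 1| * Real.sin α = 1) :
    x ∈ segment ℝ (ptA α) (outerPt α β (-β)) ∪ segment ℝ (ptC α) (outerPt α β β) ∪
      outerPt α β '' Icc (-β) β := by
  have hβ := h.pos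
  have hγ := outerAngle_lt α β
  have hβ' := h.lt_pi_div_two
  have hR := h.semiY_pos
  obtain ⟨ψ, hψ, r, hr, rfl⟩ := h.mem_outerRegion_iff.1 hx
  have hr0 : 0 < r := by
    refine lt_of_le_of_ne hr.1 fun e => ?_
    rw [← e] at h2
    simp at h2
  have e1 : (r • outerPt α β ψ) 1 = r * (semiY α β * Real.sin ψ) := by simp [outerPt]
  rcases le_total |ψ| β with h3 | h3
  · right
    have h4 := hx.2 ψ (abs_le.1 h3)
    rw [h.inner_outerPt_smul, sub_self, Real.cos_zero, mul_one] at h4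
    have h5 : (1 : ℝ) ≤ r := by
      have key := ((mem_Q_iff h.sinα h.cosα).1 (h.outerPt_mem_Q h3)).2
      simp only [PiLp.smul_apply, smul_eq_mul, abs_mul, abs_of_pos hr0] at h2
      nlinarith
    exact ⟨ψ, abs_le.1 h3, by simp [le_antisymm h4 h5]⟩
  · left
    rcases abs_cases ψ with ⟨e, -⟩ | ⟨e, -⟩
    · right
      rw [e] at h3
      have hs : 0 ≤ Real.sin ψ :=
        Real.sin_nonneg_of_nonneg_of_le_pi (by linarith) (by linarith [hψ.2, Real.pi_pos])
      have h5 : ⟪r • outerPt α β ψ, ptC α⟫ = 1 := by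
        rw [inner_ptC, ← h2, abs_of_nonneg]
        rw [e1]; positivity
      rw [← h.innerPt_self, h.inner_outerPt_smul, ← Real.cos_neg, neg_sub] at h5
      have := h.smul_outerPt_mem_segment 1 ⟨h3, hψ.2⟩
      simp only [one_mul] at this
      rw [segment_symm]
      rwa [← eq_one_div_of_mul_eq_one_left h5] at this
    · left
      rw [e] at h3
      have hs : Real.sin ψ ≤ 0 :=
        Real.sin_nonpos_of_nonpos_of_neg_pi_le (by linarith) (by linarith [hψ.1, Real.pi_pos])
      have h5 : ⟪r • outerPt α β ψ, ptA α⟫ = 1 := by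
        rw [inner_ptA, ← h2, abs_of_nonpos]
        · ring
        · rw [e1]
          exact mul_nonpos_of_nonneg_of_nonpos hr0.le (mul_nonpos_of_nonneg_of_nonpos hR.le hs)
      rw [← h.innerPt_neg_self, h.inner_outerPt_smul] at h5
      have := h.smul_outerPt_mem_segment (-1) ⟨h3, by linarith [hψ.1]⟩
      simp only [neg_one_mul, Real.sin_neg, Real.cos_neg, mul_neg, neg_neg] at this
      rw [show -ψ - β = -β - ψ by ring, ← eq_one_div_of_mul_eq_one_left h5] at this
      rw [segment_symm]
      have e2 : outerPt α β (-β) = !₂[semiX α β * Real.cos β, -(semiY α β * Real.sin β)] := by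
        simp [outerPt]
      rw [e2]
      exact this

lemma ptA_mem_outerRegion (h : Angles α β) : ptA α ∈ outerRegion α β :=
  ⟨ptA_mem_Q α, fun _ hφ => inner_ptA_le h.sinα h.cosα (h.innerPt_mem_Q (abs_le.2 hφ))⟩

lemma ptC_mem_outerRegion (h : Angles α β) : ptC α ∈ outerRegion α β :=
  ⟨ptC_mem_Q α, fun _ hφ => inner_ptC_le h.sinα h.cosα (h.innerPt_mem_Q (abs_le.2 hφ))⟩

lemma inner_ptC_outerPt (h : Angles α β) (φ : ℝ) : ⟪ptC α, outerPt α β φ⟫ = Real.cos (β - φ) := by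
  rw [← h.innerPt_self, h.inner_outerPt]

lemma inner_ptA_outerPt (h : Angles α β) (φ : ℝ) :
    ⟪ptA α, outerPt α β φ⟫ = Real.cos (-β - φ) := by
  rw [← h.innerPt_neg_self, h.inner_outerPt]

lemma inner_ptC_self (α : ℝ) : ⟪ptC α, ptC α⟫ = 1 := by
  rw [inner_ptC]; simp [ptC]; nlinarith [Real.sin_sq_add_cos_sq α]

lemma inner_ptA_self (α : ℝ) : ⟪ptA α, ptA α⟫ = 1 := by
  rw [inner_ptA]; simp [ptA]; nlinarith [Real.sin_sq_add_cos_sq α]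

lemma frontier_outerRegion (h : Angles α β) : frontier (outerRegion α β) =
    segment ℝ 0 (ptA α) ∪ segment ℝ 0 (ptC α) ∪ segment ℝ (ptA α) (outerPt α β (-β)) ∪
      segment ℝ (ptC α) (outerPt α β β) ∪ outerPt α β '' Icc (-β) β := by
  have hβ := h.pos
  apply Subset.antisymm
  · intro x hx
    have hxS : x ∈ outerRegion α β := (isClosed_polarRegion α β _).frontier_subset hx
    obtain ⟨h1, h2⟩ := (mem_Q_iff h.sinα h.cosα).1 hxS.1
    rcases h1.eq_or_lt with h1 | h1
    · have := mem_segment_of_cone_eq h.sinα h.cosα hxS.1 h1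
      exact Or.inl (Or.inl (Or.inl this))
    rcases h2.eq_or_lt with h2 | h2
    · rcases h.mem_of_outer_side hxS h2 with (h3 | h3) | h3
      · exact Or.inl (Or.inl (Or.inr h3))
      · exact Or.inl (Or.inr h3)
      · exact Or.inr h3
    · by_contra hn
      refine hx.2 (mem_interior_polarRegion h.sinα h.cosα (continuous_innerPt α β) h1 h2 ?_)
      exact h.inner_lt_one_of_strict hxS h2 fun h3 => hn (Or.inr h3)
  · have hconv : Convex ℝ (outerRegion α β) := convex_polarRegion α β _
    refine union_subset (union_subset (union_subset (segments_subset_frontier h.sinα h.cosα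
      fun φ hφ => h.innerPt_mem_Q (abs_le.2 hφ)) ?_) ?_) ?_
    · intro x hx
      have hxS := hconv.segment_subset h.ptA_mem_outerRegion
        (h.outerPt_mem ⟨le_rfl, by linarith⟩) hx
      obtain ⟨s, t, -, -, hst, rfl⟩ := hx
      refine mem_frontier_of_inner_le (n := ptA α) hxS ?_ fun y hy => ?_
      · rw [← h.innerPt_neg_self]; exact h.innerPt_ne_zero _
      · rw [inner_add_right, inner_smul_right, inner_smul_right, h.inner_ptA_outerPt, sub_self,
          Real.cos_zero, inner_ptA_self, mul_one, mul_one, hst]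
        exact inner_ptA_le h.sinα h.cosα hy.1
    · intro x hx
      have hxS := hconv.segment_subset h.ptC_mem_outerRegion
        (h.outerPt_mem ⟨by linarith, le_rfl⟩) hx
      obtain ⟨s, t, -, -, hst, rfl⟩ := hx
      refine mem_frontier_of_inner_le (n := ptC α) hxS ?_ fun y hy => ?_
      · rw [← h.innerPt_self]; exact h.innerPt_ne_zero _
      · rw [inner_add_right, inner_smul_right, inner_smul_right, h.inner_ptC_outerPt, sub_self,
          Real.cos_zero, inner_ptC_self, mul_one, mul_one, hst]
        exact inner_ptC_le h.sinα h.cosα hy.1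
    · rintro _ ⟨φ, hφ, rfl⟩
      refine mem_frontier_of_inner_le (h.outerPt_mem hφ) (h.innerPt_ne_zero φ) fun y hy => ?_
      rw [real_inner_comm, h.inner_outerPt, sub_self, Real.cos_zero]
      exact hy.2 φ hφ

end Angles

/-! ### Admissible bodies with a prescribed section -/

/-- The symmetric convex body cut out by the tangents of the arcs `I`, `-I` and by the polars of
the points of `Y` and `-Y`. -/
def bodyOf (α : ℝ) (Y : Set Plane) : Set Plane :=
  {x | (∀ θ ∈ Icc α (Real.pi - α), |⟪circlePt θ, x⟫| ≤ 1) ∧ ∀ y ∈ Y, |⟪y, x⟫| ≤ 1}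

lemma abs_inner_circlePt_le_of_mem_Q {α : ℝ} (hα : α ∈ Ioo 0 (Real.pi / 2)) (hs : 0 < Real.sin α)
    (hc : 0 < Real.cos α) {θ : ℝ} (hθ : θ ∈ Icc α (Real.pi - α)) {y : Plane} (hy : y ∈ Q α) :
    |⟪circlePt θ, y⟫| ≤ 1 := by
  have hcos : |Real.cos θ| ≤ Real.cos α := by
    rw [abs_le]
    constructor
    · rw [← Real.cos_pi_sub]
      exact Real.cos_le_cos_of_nonneg_of_le_pi (by linarith [hα.1, hθ.1])
        (by linarith [hα.1]) hθ.2
    · exact Real.cos_le_cos_of_nonneg_of_le_pi hα.1.le (by linarith [hα.1, hθ.2]) hθ.1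
  refine abs_inner_le_one hs hc (by simpa [circlePt] using hcos) ?_ hy
  have e1 := Real.sin_sq_add_cos_sq θ
  have e2 := Real.sin_sq_add_cos_sq α
  rw [← sq_abs (Real.sin θ), ← sq_abs (Real.cos θ)] at e1
  simp only [circlePt, Matrix.cons_val_zero, Matrix.cons_val_one]
  nlinarith [sq_nonneg (|Real.cos θ| - Real.cos α), sq_nonneg (|Real.sin θ| - Real.sin α)]

lemma convex_abs_inner_le (y : Plane) : Convex ℝ {x : Plane | |⟪y, x⟫| ≤ 1} := by
  have e : {x : Plane | |⟪y, x⟫| ≤ 1} = {x | ⟪x, y⟫ ≤ 1} ∩ {x | ⟪x, -y⟫ ≤ 1} := by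
    ext x
    simp only [mem_ofPred_eq, mem_inter_iff, abs_le, inner_neg_right, real_inner_comm x y]
    constructor <;> rintro ⟨h1, h2⟩ <;> constructor <;> linarith
  rw [e]
  exact (convex_inner_le _).inter (convex_inner_le _)

lemma bodyOf_eq (α : ℝ) (Y : Set Plane) : bodyOf α Y =
    (⋂ θ ∈ Icc α (Real.pi - α), {x | |⟪circlePt θ, x⟫| ≤ 1}) ∩ ⋂ y ∈ Y, {x | |⟪y, x⟫| ≤ 1} := by
  ext; simp [bodyOf]

lemma norm_circlePt (θ : ℝ) : ‖circlePt θ‖ = 1 := by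
  simp [EuclideanSpace.norm_eq, circlePt]

lemma arcI_subset_bodyOf {α : ℝ} (hα : α ∈ Ioo 0 (Real.pi / 2)) (hs : 0 < Real.sin α)
    (hc : 0 < Real.cos α) {Y : Set Plane} (hY : Y ⊆ Q α) : arcI α ⊆ bodyOf α Y := by
  rintro _ ⟨θ, hθ, rfl⟩
  refine ⟨fun φ _ => ?_, fun y hy => ?_⟩
  · refine (abs_real_inner_le_norm _ _).trans ?_
    rw [norm_circlePt, norm_circlePt, one_mul]
  · rw [real_inner_comm]
    exact abs_inner_circlePt_le_of_mem_Q hα hs hc hθ (hY hy)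

lemma neg_mem_bodyOf {α : ℝ} {Y : Set Plane} {x : Plane} (hx : x ∈ bodyOf α Y) :
    -x ∈ bodyOf α Y :=
  ⟨fun θ hθ => by rw [inner_neg_right, abs_neg]; exact hx.1 θ hθ,
    fun y hy => by rw [inner_neg_right, abs_neg]; exact hx.2 y hy⟩

lemma arcI_subset_frontier {α : ℝ} (hα : α ∈ Ioo 0 (Real.pi / 2)) (hs : 0 < Real.sin α)
    (hc : 0 < Real.cos α) {Y : Set Plane} (hY : Y ⊆ Q α) : arcI α ⊆ frontier (bodyOf α Y) := by
  intro x hx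
  have hxS := arcI_subset_bodyOf hα hs hc hY hx
  obtain ⟨θ, hθ, rfl⟩ := hx
  refine mem_frontier_of_inner_le (n := circlePt θ) hxS ?_ fun y hy => ?_
  · rw [← norm_ne_zero_iff, norm_circlePt]; exact one_ne_zero
  · rw [real_inner_self_eq_norm_sq, norm_circlePt, one_pow]
    exact (abs_le.1 (hy.1 θ hθ)).2

lemma neg_arcI_subset_frontier {α : ℝ} (hα : α ∈ Ioo 0 (Real.pi / 2)) (hs : 0 < Real.sin α)
    (hc : 0 < Real.cos α) {Y : Set Plane} (hY : Y ⊆ Q α) : -arcI α ⊆ frontier (bodyOf α Y) := by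
  intro x hx
  have hxS := neg_mem_bodyOf (arcI_subset_bodyOf hα hs hc hY hx)
  rw [neg_neg] at hxS
  obtain ⟨θ, hθ, e⟩ := hx
  obtain rfl : x = -circlePt θ := by rw [e, neg_neg]
  refine mem_frontier_of_inner_le (n := -circlePt θ) hxS ?_ fun y hy => ?_
  · rw [← norm_ne_zero_iff, norm_neg, norm_circlePt]; exact one_ne_zero
  · rw [real_inner_self_eq_norm_sq, norm_neg, norm_circlePt, one_pow, inner_neg_left]
    linarith [(abs_le.1 (hy.1 θ hθ)).1]

lemma admissible_bodyOf {α : ℝ} (hα : α ∈ Ioo 0 (Real.pi / 2)) (hs : 0 < Real.sin α)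
    (hc : 0 < Real.cos α) {Y : Set Plane} (hY : Y ⊆ Q α) : Admissible α (bodyOf α Y) where
  convex := by
    rw [bodyOf_eq]
    exact (convex_iInter₂ fun θ _ => convex_abs_inner_le _).inter
      (convex_iInter₂ fun y _ => convex_abs_inner_le _)
  isCompact := by
    have hcl : IsClosed (bodyOf α Y) := by
      rw [bodyOf_eq]
      exact (isClosed_biInter fun θ _ => isClosed_le (by fun_prop) continuous_const).inter
        (isClosed_biInter fun y _ => isClosed_le (by fun_prop) continuous_const)
    refine Metric.isCompact_of_isClosed_isBounded hcl ?_
    refine (Metric.isBounded_closedBall (x := 0) (r := 1 / Real.cos α + 1 / Real.sin α)).subset ?_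
    intro x hx
    have h1 := abs_le.1 (hx.1 α ⟨le_rfl, by linarith [hα.2]⟩)
    have h2 := abs_le.1 (hx.1 (Real.pi - α) ⟨by linarith [hα.2], le_rfl⟩)
    rw [inner_circlePt] at h1 h2
    rw [Real.cos_pi_sub, Real.sin_pi_sub] at h2
    have b0 : |x 0| ≤ 1 / Real.cos α := by
      rw [le_div_iff₀ hc, ← abs_of_pos hc, ← abs_mul, abs_le]
      constructor <;> linarith
    have b1 : |x 1| ≤ 1 / Real.sin α := by
      rw [le_div_iff₀ hs, ← abs_of_pos hs, ← abs_mul, abs_le]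
      constructor <;> linarith
    rw [mem_closedBall_zero_iff, EuclideanSpace.norm_eq, Fin.sum_univ_two]
    refine Real.sqrt_le_iff.2 ⟨by positivity, ?_⟩
    simp only [Real.norm_eq_abs]
    nlinarith [abs_nonneg (x 0), abs_nonneg (x 1)]
  interior_nonempty := by
    obtain ⟨M, hM⟩ := (isCompact_Q α).isBounded.exists_norm_le
    refine ⟨0, mem_interior.2 ⟨Metric.ball 0 (1 / (max M 1)), ?_, Metric.isOpen_ball,
      Metric.mem_ball_self (by positivity)⟩⟩
    intro x hx
    rw [mem_ball_zero_iff, lt_div_iff₀ (by positivity)] at hx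
    have key : ∀ y : Plane, ‖y‖ ≤ max M 1 → |⟪y, x⟫| ≤ 1 := fun y hy =>
      (abs_real_inner_le_norm _ _).trans (by
        nlinarith [mul_le_mul_of_nonneg_right hy (norm_nonneg x)])
    exact ⟨fun θ _ => key _ (by rw [norm_circlePt]; exact le_max_right _ _),
      fun y hy => key _ ((hM y (hY hy)).trans (le_max_left _ _))⟩
  symmetric := by
    ext x
    exact ⟨fun hx => by simpa using neg_mem_bodyOf hx, fun hx => neg_mem_bodyOf hx⟩
  a_mem := neg_arcI_subset_frontier hα hs hc hY
    ⟨Real.pi - α, ⟨by linarith [hα.2], le_rfl⟩, by rw [ptA_eq, neg_neg]⟩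
  c_mem := arcI_subset_frontier hα hs hc hY ⟨α, ⟨le_rfl, by linarith [hα.2]⟩, rfl⟩
  arc_subset := arcI_subset_frontier hα hs hc hY
  neg_arc_subset := neg_arcI_subset_frontier hα hs hc hY

/-- On `Q` the tangents of the arcs and the constraints from the reflected curve hold by themselves,
so only polarity to the curve remains. -/
lemma bodyOf_inter_Q {α β : ℝ} (hα : α ∈ Ioo 0 (Real.pi / 2)) (hs : 0 < Real.sin α)
    (hc : 0 < Real.cos α) {B : ℝ → Plane} (hB : B '' Icc (-β) β ⊆ Q α) :
    bodyOf α (B '' Icc (-β) β) ∩ Q α = polarRegion α β B := by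
  ext x
  constructor
  · rintro ⟨hx, hQ⟩
    refine ⟨hQ, fun φ hφ => ?_⟩
    rw [real_inner_comm]
    exact (abs_le.1 (hx.2 _ ⟨φ, hφ, rfl⟩)).2
  · rintro ⟨hQ, hx⟩
    refine ⟨⟨fun θ hθ => abs_inner_circlePt_le_of_mem_Q hα hs hc hθ hQ, ?_⟩, hQ⟩
    rintro _ ⟨φ, hφ, rfl⟩
    rw [real_inner_comm]
    exact abs_le.2 ⟨neg_one_le_inner hs hc hQ (hB ⟨φ, hφ, rfl⟩), hx φ hφ⟩

/-! ### Maximality -/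

lemma isCompact_polar_inter (α : ℝ) (K : Set Plane) : IsCompact (polarBody K ∩ Q α) :=
  (isCompact_Q α).inter_left (Admissible.isClosed_polarBody K)

lemma convex_polarBody (K : Set Plane) : Convex ℝ (polarBody K) := by
  have : polarBody K = ⋂ x ∈ K, {y | ⟪y, x⟫ ≤ 1} := by
    ext y; simp [polarBody, real_inner_comm]
  rw [this]
  exact convex_iInter₂ fun x _ => convex_inner_le x

namespace Angles

variable {α β : ℝ}

/-- A squeeze: `C` contains the inner region, so `v` is large enough for the upper bound on every
competitor; and `C*` contains the outer region, whose area is that bound. Containment suffices, and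
`C` need not be identified. -/
theorem isMaximizer_of_innerPt_mem (h : Angles α β) {v : ℝ} {K : Set Plane}
    (hK : K ∈ admissibleWithArea α v) (hin : ∀ φ ∈ Icc (-β) β, innerPt α β φ ∈ K)
    (hout : ∀ φ ∈ Icc (-β) β, outerPt α β φ ∈ polarBody K) : IsMaximizer α v K := by
  refine ⟨hK, fun K' hK' => ?_⟩
  have hv : β / (semiX α β * semiY α β) ≤ v := by
    rw [← hK.2, ← h.area_innerRegion]
    exact area_mono (hK.1.isCompact.inter (isCompact_Q α)) (h.innerRegion_subset
      (hK.1.convex.inter (convex_Q α)) ⟨hK.1.zero_mem, zero_mem_Q α⟩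
      fun φ hφ => ⟨hin φ hφ, h.innerPt_mem_Q (abs_le.2 hφ)⟩)
  refine (h.area_polar_le_of_inner_le hK'.1 (hK'.2.symm ▸ hv)).trans ?_
  rw [← h.area_outerRegion]
  have hs : ∀ p, p = ptA α ∨ p = ptC α → p ∈ polarBody K ∩ Q α := fun p hp => by
    simpa using hK.1.smul_mem_polar h.mem_Ioo h.sinα h.cosα hp (t := 1) (by simp)
  exact area_mono (isCompact_polar_inter α K) (h.outerRegion_subset
    ((convex_polarBody K).inter (convex_Q α)) ⟨fun x _ => by simp, zero_mem_Q α⟩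
    (hs _ (Or.inl rfl)) (hs _ (Or.inr rfl))
    fun φ hφ => ⟨hout φ hφ, h.outerPt_mem_Q (abs_le.2 hφ)⟩)

theorem isMaximizer_of_outerPt_mem (h : Angles α β) {v : ℝ} {K : Set Plane}
    (hK : K ∈ admissibleWithArea α v) (hout : ∀ φ ∈ Icc (-β) β, outerPt α β φ ∈ K)
    (hin : ∀ φ ∈ Icc (-β) β, innerPt α β φ ∈ polarBody K) : IsMaximizer α v K := by
  refine ⟨hK, fun K' hK' => ?_⟩
  have hv : semiX α β * semiY α β * (β + tanGap α β) ≤ v := by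
    rw [← hK.2, ← h.area_outerRegion]
    exact area_mono (hK.1.isCompact.inter (isCompact_Q α)) (h.outerRegion_subset
      (hK.1.convex.inter (convex_Q α)) ⟨hK.1.zero_mem, zero_mem_Q α⟩
      ⟨hK.1.ptA_mem, ptA_mem_Q α⟩ ⟨hK.1.ptC_mem, ptC_mem_Q α⟩
      fun φ hφ => ⟨hout φ hφ, h.outerPt_mem_Q (abs_le.2 hφ)⟩)
  refine (h.area_polar_le_of_outer_le hK'.1 (hK'.2.symm ▸ hv)).trans ?_
  rw [← h.area_innerRegion]
  exact area_mono (isCompact_polar_inter α K) (h.innerRegion_subset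
    ((convex_polarBody K).inter (convex_Q α)) ⟨fun x _ => by simp, zero_mem_Q α⟩
    fun φ hφ => ⟨hin φ hφ, h.innerPt_mem_Q (abs_le.2 hφ)⟩)

lemma inner_le_one_of_mem_segment {p q x y : Plane} (hp : ⟪p, y⟫ ≤ 1) (hq : ⟪q, y⟫ ≤ 1)
    (hx : x ∈ segment ℝ p q) : ⟪x, y⟫ ≤ 1 :=
  (convex_inner_le y).segment_subset hp hq hx

/-- The arc lies in the closed set `C`. The outer arc is polar to each boundary piece of `C`, hence
to `C`, and hence to `K` because points of `Q` need testing only on `C`. -/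
theorem isMaximizer_of_frontier_eq_inner (h : Angles α β) {v : ℝ} {K : Set Plane}
    (hK : K ∈ admissibleWithArea α v) (hf : frontier (K ∩ Q α) =
      segment ℝ 0 (ptA α) ∪ segment ℝ 0 (ptC α) ∪ innerPt α β '' Icc (-β) β) :
    IsMaximizer α v K := by
  have hC : IsCompact (K ∩ Q α) := hK.1.isCompact.inter (isCompact_Q α)
  refine h.isMaximizer_of_innerPt_mem hK (fun φ hφ => ?_) fun φ hφ => ?_
  · exact (hC.isClosed.frontier_subset (hf ▸ Or.inr ⟨φ, hφ, rfl⟩)).1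
  · have hQ := h.outerPt_mem_Q (abs_le.2 hφ)
    refine hK.1.mem_polarBody h.mem_Ioo h.sinα h.cosα hQ (inner_le_one_of_frontier hC ?_)
    rw [hf]
    rintro x ((hx | hx) | ⟨ψ, hψ, rfl⟩)
    · exact inner_le_one_of_mem_segment (by simp) (inner_ptA_le h.sinα h.cosα hQ) hx
    · exact inner_le_one_of_mem_segment (by simp) (inner_ptC_le h.sinα h.cosα hQ) hx
    · rw [h.inner_outerPt]; exact Real.cos_le_one _

theorem isMaximizer_of_frontier_eq_outer (h : Angles α β) {v : ℝ} {K : Set Plane}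
    (hK : K ∈ admissibleWithArea α v) (hf : frontier (K ∩ Q α) =
      segment ℝ 0 (ptA α) ∪ segment ℝ 0 (ptC α) ∪ segment ℝ (ptA α) (outerPt α β (-β)) ∪
        segment ℝ (ptC α) (outerPt α β β) ∪ outerPt α β '' Icc (-β) β) :
    IsMaximizer α v K := by
  have hC : IsCompact (K ∩ Q α) := hK.1.isCompact.inter (isCompact_Q α)
  refine h.isMaximizer_of_outerPt_mem hK (fun φ hφ => ?_) fun φ hφ => ?_
  · exact (hC.isClosed.frontier_subset (hf ▸ Or.inr ⟨φ, hφ, rfl⟩)).1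
  · have hQ := h.innerPt_mem_Q (abs_le.2 hφ)
    have ho : ∀ ψ, ⟪outerPt α β ψ, innerPt α β φ⟫ ≤ 1 := fun ψ => by
      rw [real_inner_comm, h.inner_outerPt]; exact Real.cos_le_one _
    have ha := inner_ptA_le h.sinα h.cosα hQ
    have hc := inner_ptC_le h.sinα h.cosα hQ
    refine hK.1.mem_polarBody h.mem_Ioo h.sinα h.cosα hQ (inner_le_one_of_frontier hC ?_)
    rw [hf]
    rintro x ((((hx | hx) | hx) | hx) | ⟨ψ, hψ, rfl⟩)
    · exact inner_le_one_of_mem_segment (by simp) ha hx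
    · exact inner_le_one_of_mem_segment (by simp) hc hx
    · exact inner_le_one_of_mem_segment ha (ho _) hx
    · exact inner_le_one_of_mem_segment hc (ho _) hx
    · exact ho ψ

lemma exists_isMaximizer_inner (h : Angles α β) :
    ∃ K, IsMaximizer α (β / (semiX α β * semiY α β)) K ∧ K ∩ Q α = innerRegion α β := by
  have hY : outerPt α β '' Icc (-β) β ⊆ Q α := by
    rintro _ ⟨φ, hφ, rfl⟩; exact h.outerPt_mem_Q (abs_le.2 hφ)
  have e : bodyOf α (outerPt α β '' Icc (-β) β) ∩ Q α = innerRegion α β :=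
    bodyOf_inter_Q h.mem_Ioo h.sinα h.cosα hY
  refine ⟨_, h.isMaximizer_of_frontier_eq_inner
    ⟨admissible_bodyOf h.mem_Ioo h.sinα h.cosα hY, ?_⟩ ?_, e⟩
  · rw [e, h.area_innerRegion]
  · rw [e, h.frontier_innerRegion]

lemma exists_isMaximizer_outer (h : Angles α β) :
    ∃ K, IsMaximizer α (semiX α β * semiY α β * (β + tanGap α β)) K ∧
      K ∩ Q α = outerRegion α β := by
  have hY : innerPt α β '' Icc (-β) β ⊆ Q α := by
    rintro _ ⟨φ, hφ, rfl⟩; exact h.innerPt_mem_Q (abs_le.2 hφ)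
  have e : bodyOf α (innerPt α β '' Icc (-β) β) ∩ Q α = outerRegion α β :=
    bodyOf_inter_Q h.mem_Ioo h.sinα h.cosα hY
  refine ⟨_, h.isMaximizer_of_frontier_eq_outer
    ⟨admissible_bodyOf h.mem_Ioo h.sinα h.cosα hY, ?_⟩ ?_, e⟩
  · rw [e, h.area_outerRegion]
  · rw [e, h.frontier_outerRegion]

end Angles

/-! ### Elliptic arcs -/

lemma map_plane (L : Plane →ₗ[ℝ] Plane) (x : Plane) :
    L x = x 0 • L !₂[1, 0] + x 1 • L !₂[0, 1] := by
  have : x = x 0 • (!₂[1, 0] : Plane) + x 1 • (!₂[0, 1] : Plane) := by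
    apply plane_ext <;> simp
  conv_lhs => rw [this]
  rw [map_add, map_smul, map_smul]

/-- A linear map multiplies signed areas by its determinant. -/
lemma cross_map (L : Plane →ₗ[ℝ] Plane) (x y : Plane) :
    L x 0 * L y 1 - L x 1 * L y 0 = LinearMap.det L * (x 0 * y 1 - x 1 * y 0) := by
  set b := (EuclideanSpace.basisFun (Fin 2) ℝ).toBasis with hb
  have b0 : b 0 = !₂[1, 0] := by
    apply plane_ext <;> simp [hb]
  have b1 : b 1 = !₂[0, 1] := by
    apply plane_ext <;> simp [hb]
  have hd : LinearMap.det L = L !₂[1, 0] 0 * L !₂[0, 1] 1 - L !₂[0, 1] 0 * L !₂[1, 0] 1 := by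
    rw [← LinearMap.det_toMatrix b, Matrix.det_fin_two]
    simp only [LinearMap.toMatrix_apply, b0, b1]
    simp [hb]
  rw [hd, map_plane L x, map_plane L y]
  simp only [PiLp.add_apply, PiLp.smul_apply, smul_eq_mul]
  ring

/-- The linear map that stretches the coordinates by `p` and `q`. -/
noncomputable def stretch (p q : ℝ) : Plane →ₗ[ℝ] Plane where
  toFun x := !₂[p * x 0, q * x 1]
  map_add' x y := by apply plane_ext <;> simp [mul_add]
  map_smul' c x := by apply plane_ext <;> simp [mul_left_comm]

lemma stretch_apply (p q : ℝ) (x : Plane) : stretch p q x = !₂[p * x 0, q * x 1] := rfl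

lemma det_stretch (p q : ℝ) : LinearMap.det (stretch p q) = p * q := by
  have := cross_map (stretch p q) !₂[1, 0] !₂[0, 1]
  simp [stretch_apply] at this
  exact this.symm

lemma isEllipticArc_stretch {p q β : ℝ} (hp : 0 < p) (hq : 0 < q) (hβ : β ∈ Ioo 0 Real.pi) :
    IsEllipticArc (stretch p q '' Metric.sphere 0 1)
      ((fun φ => !₂[p * Real.cos φ, q * Real.sin φ]) '' Icc (-β) β)
      !₂[p * Real.cos (-β), q * Real.sin (-β)] !₂[p * Real.cos β, q * Real.sin β] :=
  ⟨stretch p q, by rw [det_stretch]; positivity, rfl, -β, β, by linarith [hβ.1],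
    by linarith [hβ.2], rfl, rfl, rfl⟩

/-- An arc of an ellipse with centre `o` whose ends are mirror images in the axis is an arc of an
ellipse whose axes are the coordinate axes. -/
lemma IsEllipticArc.exists_stretch {E J : Set Plane} {x y : ℝ} (hx : 0 < x) (hy : 0 ≤ y)
    (h : IsEllipticArc E J !₂[x, -y] !₂[x, y]) : ∃ β ∈ Ioo 0 (Real.pi / 2), 0 < y ∧
      (∀ φ, (!₂[x / Real.cos β * Real.cos φ, y / Real.sin β * Real.sin φ] : Plane) ∈ E) ∧
      J = (fun φ => !₂[x / Real.cos β * Real.cos φ, y / Real.sin β * Real.sin φ]) ''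
        Icc (-β) β := by
  obtain ⟨L, hdet, rfl, θ₁, θ₂, h1, h2, e1, e2, rfl⟩ := h
  -- Measured from the middle of the parameter interval, the ends are at `∓β`, and `u`, `w` span
  -- conjugate diameters. Mirror symmetry of the ends puts `u` and `w` on the coordinate axes.
  set m := (θ₁ + θ₂) / 2 with hm
  set β := (θ₂ - θ₁) / 2 with hβ
  set u := L (circlePt m) with hu
  set w := L (circlePt (m + Real.pi / 2)) with hw
  have hL : ∀ φ, L (circlePt (m + φ)) = Real.cos φ • u + Real.sin φ • w := by
    intro φ
    rw [hu, hw, ← map_smul, ← map_smul, ← map_add]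
    congr 1
    apply plane_ext
    · simp [circlePt, Real.cos_add]; ring
    · simp [circlePt, Real.sin_add]; ring
  have hβ0 : 0 < β := by rw [hβ]; linarith
  have hβπ : β < Real.pi := by rw [hβ]; linarith
  have hsin : 0 < Real.sin β := Real.sin_pos_of_pos_of_lt_pi hβ0 hβπ
  have t1 : θ₁ = m + -β := by rw [hm, hβ]; ring
  have t2 : θ₂ = m + β := by rw [hm, hβ]; ring
  rw [t1, hL, Real.cos_neg, Real.sin_neg] at e1
  rw [t2, hL] at e2
  have f10 := congrFun (congrArg WithLp.ofLp e1) 0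
  have f11 := congrFun (congrArg WithLp.ofLp e1) 1
  have f20 := congrFun (congrArg WithLp.ofLp e2) 0
  have f21 := congrFun (congrArg WithLp.ofLp e2) 1
  simp at f10 f11 f20 f21
  have hcr : 0 < u 0 * w 1 - u 1 * w 0 := by
    rw [hu, hw, cross_map]
    refine mul_pos hdet ?_
    simp only [circlePt, Real.cos_add_pi_div_two, Real.sin_add_pi_div_two, Matrix.cons_val_zero,
      Matrix.cons_val_one]
    nlinarith [Real.sin_sq_add_cos_sq m]
  have w0 : w 0 = 0 := by
    have : Real.sin β * w 0 = 0 := by linarith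
    exact (mul_eq_zero.1 this).resolve_left hsin.ne'
  have hyw : y = Real.sin β * w 1 := by linarith
  have hxu : x = Real.cos β * u 0 := by linarith
  have hw1 : 0 ≤ w 1 := nonneg_of_mul_nonneg_right (hyw ▸ hy) hsin
  rw [w0, mul_zero, sub_zero] at hcr
  have hw1' : 0 < w 1 := lt_of_le_of_ne hw1 fun e => by rw [← e] at hcr; simp at hcr
  have hu0 : 0 < u 0 := pos_of_mul_pos_left hcr hw1
  -- The positive determinant fixes the sign of `u 0`; with `x > 0` this makes `β` acute, so the arc
  -- is the one facing `b`.
  have hcos : 0 < Real.cos β := pos_of_mul_pos_left (hxu ▸ hx) hu0.le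
  have u1 : u 1 = 0 := by
    have : Real.cos β * u 1 = 0 := by linarith
    exact (mul_eq_zero.1 this).resolve_left hcos.ne'
  have hβ2 : β < Real.pi / 2 := by
    by_contra! hge
    exact absurd (Real.cos_nonpos_of_pi_div_two_le_of_le hge (by linarith [Real.pi_pos])) hcos.not_ge
  have hform : ∀ φ, L (circlePt (m + φ)) =
      !₂[x / Real.cos β * Real.cos φ, y / Real.sin β * Real.sin φ] := by
    intro φ
    rw [hL]
    apply plane_ext
    · simp [w0]; rw [hxu]; field_simp
    · simp [u1]; rw [hyw]; field_simp
  refine ⟨β, ⟨hβ0, hβ2⟩, by rw [hyw]; positivity, fun φ => ?_, ?_⟩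
  · rw [← hform]
    exact ⟨_, by rw [mem_sphere_zero_iff_norm, norm_circlePt], rfl⟩
  · rw [t1, t2]
    have : Icc (m + -β) (m + β) = (fun φ => m + φ) '' Icc (-β) β := by
      rw [image_const_add_Icc]
    rw [this, image_image]
    exact image_congr fun φ _ => hform φ

/-! ### The extremal regions have the described form -/

namespace Angles

variable {α β : ℝ}

lemma isEllipticSector_innerRegion (h : Angles α β) : IsEllipticSector α (innerRegion α β) := by
  have hP := h.semiX_pos; have hR := h.semiY_pos
  have := isEllipticArc_stretch (one_div_pos.2 hP) (one_div_pos.2 hR)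
    (β := β) ⟨h.pos, by linarith [h.lt_pi_div_two, Real.pi_pos]⟩
  refine ⟨stretch (1 / semiX α β) (1 / semiY α β) '' Metric.sphere 0 1,
    innerPt α β '' Icc (-β) β, ?_, ?_, h.frontier_innerRegion⟩
  · rw [← h.innerPt_neg_self, ← h.innerPt_self]
    exact this
  · rintro _ ⟨φ, hφ, rfl⟩
    rw [mem_closedBall_zero_iff, EuclideanSpace.norm_eq, Fin.sum_univ_two]
    refine Real.sqrt_le_one.2 ?_
    simpa only [Real.norm_eq_abs, sq_abs] using h.innerPt_sq_le (abs_le.2 hφ)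

end Angles

lemma mem_lineAB_iff {α : ℝ} (hs : 0 < Real.sin α) (hc : 0 < Real.cos α) {x : Plane} :
    x ∈ affineSpan ℝ {ptA α, ptB α} ↔ ⟪ptA α, x⟫ = 1 := by
  have hsc := Real.sin_sq_add_cos_sq α
  rw [mem_affineSpan_pair_iff_exists_lineMap_eq, real_inner_comm, inner_ptA]
  constructor
  · rintro ⟨t, rfl⟩
    simp [AffineMap.lineMap_apply, ptA, ptB]
    field_simp
    linear_combination (1 - t) * hsc
  · intro hx
    refine ⟨(x 1 + Real.sin α) / Real.sin α, plane_ext ?_ ?_⟩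
    · simp [AffineMap.lineMap_apply, ptA, ptB]
      field_simp
      linear_combination (-x 1 - Real.sin α) * hsc + (-Real.sin α) * hx + Real.sin α * hsc
    · simp [AffineMap.lineMap_apply, ptA, ptB]
      field_simp; ring

lemma mem_lineCB_iff {α : ℝ} (hs : 0 < Real.sin α) (hc : 0 < Real.cos α) {x : Plane} :
    x ∈ affineSpan ℝ {ptC α, ptB α} ↔ ⟪ptC α, x⟫ = 1 := by
  have hsc := Real.sin_sq_add_cos_sq α
  rw [mem_affineSpan_pair_iff_exists_lineMap_eq, real_inner_comm, inner_ptC]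
  constructor
  · rintro ⟨t, rfl⟩
    simp [AffineMap.lineMap_apply, ptC, ptB]
    field_simp
    linear_combination (1 - t) * hsc
  · intro hx
    refine ⟨(Real.sin α - x 1) / Real.sin α, plane_ext ?_ ?_⟩
    · simp [AffineMap.lineMap_apply, ptC, ptB]
      field_simp
      linear_combination (x 1 - Real.sin α) * hsc + (-Real.sin α) * hx + Real.sin α * hsc
    · simp [AffineMap.lineMap_apply, ptC, ptB]
      field_simp; ring

lemma stretch_mem_sphere (p q φ : ℝ) :
    (!₂[p * Real.cos φ, q * Real.sin φ] : Plane) ∈ stretch p q '' Metric.sphere 0 1 :=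
  ⟨circlePt φ, by rw [mem_sphere_zero_iff_norm, norm_circlePt], rfl⟩

lemma sq_add_sq_of_mem_sphere {z : Plane} (hz : z ∈ Metric.sphere (0 : Plane) 1) :
    z 0 ^ 2 + z 1 ^ 2 = 1 := by
  rw [mem_sphere_zero_iff_norm, EuclideanSpace.norm_eq, Fin.sum_univ_two, Real.sqrt_eq_one] at hz
  simpa only [Real.norm_eq_abs, sq_abs] using hz

namespace Angles

variable {α β : ℝ}

lemma isTangentEllipticSector_outerRegion (h : Angles α β) (hlt : β < α) :
    IsTangentEllipticSector α (outerRegion α β) := by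
  have hP := h.semiX_pos; have hR := h.semiY_pos
  have hs := h.sinα; have hc := h.cosα; have hcβ := h.cosβ; have hsβ := h.sinβ
  have hsc := Real.sin_sq_add_cos_sq β
  refine ⟨outerPt α β (-β), outerPt α β β,
    stretch (semiX α β) (semiY α β) '' Metric.sphere 0 1, outerPt α β '' Icc (-β) β,
    ?_, ?_, ?_, ?_, ?_, ?_, ?_, h.frontier_outerRegion⟩
  · rw [mem_lineAB_iff hs hc, h.inner_ptA_outerPt, sub_self, Real.cos_zero]
  · rw [mem_lineCB_iff hs hc, h.inner_ptC_outerPt, sub_self, Real.cos_zero]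
  · intro e
    have e0 := congrFun (congrArg WithLp.ofLp e) 0
    simp [outerPt, ptA, semiX] at e0
    have hlt' : Real.cos α < Real.cos β :=
      Real.cos_lt_cos_of_nonneg_of_le_pi_div_two h.pos.le h.lt.le hlt
    field_simp at e0
    nlinarith
  · rw [EuclideanSpace.dist_eq, EuclideanSpace.dist_eq, Fin.sum_univ_two, Fin.sum_univ_two]
    simp only [Real.dist_eq, sq_abs]
    congr 1
    simp [ptA, ptC, outerPt]
    ring
  · exact isEllipticArc_stretch hP hR ⟨h.pos, by linarith [h.lt_pi_div_two, Real.pi_pos]⟩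
  · refine ⟨ptA α, 1, ?_, ?_, ?_, outerPt α β (-β), ?_, stretch_mem_sphere _ _ _⟩
    · rw [← h.innerPt_neg_self]; exact h.innerPt_ne_zero _
    · ext x; exact mem_lineAB_iff hs hc
    · rintro _ ⟨z, hz, rfl⟩
      have hz := sq_add_sq_of_mem_sphere hz
      rw [real_inner_comm, inner_ptA, stretch_apply]
      have e : semiX α β * z 0 * Real.cos α - semiY α β * z 1 * Real.sin α =
        z 0 * (semiX α β * Real.cos α) - z 1 * (semiY α β * Real.sin α) := by ring
      simp only [Matrix.cons_val_zero, Matrix.cons_val_one]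
      rw [e, h.semiX_mul, h.semiY_mul]
      nlinarith [sq_nonneg (z 0 - Real.cos β), sq_nonneg (z 1 + Real.sin β)]
    · exact (mem_lineAB_iff hs hc).2 (by rw [h.inner_ptA_outerPt, sub_self, Real.cos_zero])
  · refine ⟨ptC α, 1, ?_, ?_, ?_, outerPt α β β, ?_, stretch_mem_sphere _ _ _⟩
    · rw [← h.innerPt_self]; exact h.innerPt_ne_zero _
    · ext x; exact mem_lineCB_iff hs hc
    · rintro _ ⟨z, hz, rfl⟩
      have hz := sq_add_sq_of_mem_sphere hz
      rw [real_inner_comm, inner_ptC, stretch_apply]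
      have e : semiX α β * z 0 * Real.cos α + semiY α β * z 1 * Real.sin α =
        z 0 * (semiX α β * Real.cos α) + z 1 * (semiY α β * Real.sin α) := by ring
      simp only [Matrix.cons_val_zero, Matrix.cons_val_one]
      rw [e, h.semiX_mul, h.semiY_mul]
      nlinarith [sq_nonneg (z 0 - Real.cos β), sq_nonneg (z 1 - Real.sin β)]
    · exact (mem_lineCB_iff hs hc).2 (by rw [h.inner_ptC_outerPt, sub_self, Real.cos_zero])

end Angles

/-! ### From the described form back to the parameter -/

lemma le_of_cos_le {α β : ℝ} (hα : α ∈ Ioo 0 (Real.pi / 2)) (hβ : β ∈ Ioo 0 (Real.pi / 2))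
    (h : Real.cos α ≤ Real.cos β) : β ≤ α := by
  by_contra! hlt
  exact absurd (Real.cos_lt_cos_of_nonneg_of_le_pi_div_two hα.1.le hβ.2.le hlt) h.not_gt

theorem IsEllipticSector.isMaximizer {α v : ℝ} (hα : α ∈ Ioo 0 (Real.pi / 2))
    (hs : 0 < Real.sin α) (hc : 0 < Real.cos α) {K : Set Plane}
    (hK : K ∈ admissibleWithArea α v) (h : IsEllipticSector α (K ∩ Q α)) :
    IsMaximizer α v K := by
  obtain ⟨E, J, hEJ, hball, hf⟩ := h
  obtain ⟨β, hβ, -, -, rfl⟩ := IsEllipticArc.exists_stretch hc hs.le hEJ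
  have hcβ : 0 < Real.cos β := Real.cos_pos_of_mem_Ioo ⟨by linarith [hβ.1, Real.pi_pos], hβ.2⟩
  -- The arc meets the axis at abscissa `cos α / cos β`; that this point is in the disc gives `β ≤
  -- α`.
  have h0 := hball ⟨0, ⟨by linarith [hβ.1], hβ.1.le⟩, rfl⟩
  simp only [Real.cos_zero, Real.sin_zero, mul_one, mul_zero] at h0
  rw [mem_closedBall_zero_iff, EuclideanSpace.norm_eq, Fin.sum_univ_two, Real.sqrt_le_one] at h0
  simp only [Real.norm_eq_abs, sq_abs, Matrix.cons_val_zero, Matrix.cons_val_one] at h0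
  have hle : Real.cos α ≤ Real.cos β := by
    rw [← div_le_one hcβ]
    nlinarith [div_pos hc hcβ]
  have hang : Angles α β := ⟨hβ.1, le_of_cos_le hα hβ hle, hα.2⟩
  refine hang.isMaximizer_of_frontier_eq_inner hK ?_
  rw [hf]
  congr 1
  refine image_congr fun φ _ => ?_
  simp only [innerPt, semiX, semiY, one_div_div]

/-- An ellipse in axis position that lies on one side of the line `bc` and has a point on it. -/
lemma eq_cos_sin_of_le_one {A B β : ℝ} (h : ∀ φ, A * Real.cos φ + B * Real.sin φ ≤ 1)
    (he : A * Real.cos β + B * Real.sin β = 1) : A = Real.cos β ∧ B = Real.sin β := by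
  have hmax : IsLocalMax (fun φ => A * Real.cos φ + B * Real.sin φ) β :=
    Eventually.of_forall fun φ => by simpa only [he] using h φ
  have hd := hmax.hasDerivAt_eq_zero
    (((Real.hasDerivAt_cos β).const_mul A).add ((Real.hasDerivAt_sin β).const_mul B))
  have hsc := Real.sin_sq_add_cos_sq β
  constructor
  · linear_combination Real.cos β * he - Real.sin β * hd - A * hsc
  · linear_combination Real.sin β * he + Real.cos β * hd - B * hsc

/-- The equation of the line is determined only up to a factor: `u = r c`. The opposite points `z`,
`-z` of `E` lie on the same side, which forces `r > 0`, and the factor cancels. -/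
lemma inner_ptC_le_of_isSupportingLine {α : ℝ} (hs : 0 < Real.sin α) (hc : 0 < Real.cos α)
    {E : Set Plane} (h : IsSupportingLine (affineSpan ℝ {ptC α, ptB α} : Set Plane) E)
    {z : Plane} (hz : z ∈ E) (hz' : -z ∈ E) :
    ∀ x ∈ E, ⟪ptC α, x⟫ ≤ 1 := by
  obtain ⟨u, r, hu, hl, hle, -⟩ := h
  have hsc := Real.sin_sq_add_cos_sq α
  have hmc : ptC α ∈ {x | ⟪u, x⟫ = r} := hl ▸ left_mem_affineSpan_pair ℝ _ _
  have hmb : ptB α ∈ {x | ⟪u, x⟫ = r} := hl ▸ right_mem_affineSpan_pair ℝ _ _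
  simp only [mem_ofPred_eq, inner_ptC] at hmc
  simp [inner_plane, ptB] at hmb
  have e0 : u 0 = r * Real.cos α := by rw [← hmb]; field_simp
  have e1 : u 1 = r * Real.sin α := by
    have : (u 1 - r * Real.sin α) * Real.sin α = 0 := by
      linear_combination hmc - Real.cos α * e0 - r * hsc
    linarith [(mul_eq_zero.1 this).resolve_right hs.ne']
  have hux : ∀ x, ⟪u, x⟫ = r * ⟪ptC α, x⟫ := fun x => by
    rw [real_inner_comm x (ptC α), inner_ptC, inner_plane, e0, e1]; ring
  have h1 := hle z hz
  have h2 := hle (-z) hz'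
  rw [hux] at h1 h2
  rw [inner_neg_right] at h2
  have hr0 : r ≠ 0 := fun e => hu (plane_ext (by simp [e0, e]) (by simp [e1, e]))
  have hr : 0 < r := lt_of_le_of_ne (by linarith) hr0.symm
  intro x hx
  have := hle x hx
  rw [hux] at this
  exact le_of_mul_le_mul_left (by linarith) hr

/-- Equal lengths make `a'` and `c'` mirror images, so the ellipse is in axis position. Tangency to
`bc` at `c'` then determines both semiaxes from the eccentric angle `β`, and the boundary is that of
the outer region. -/
theorem IsTangentEllipticSector.isMaximizer {α v : ℝ} (hα : α ∈ Ioo 0 (Real.pi / 2))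
    (hs : 0 < Real.sin α) (hc : 0 < Real.cos α) {K : Set Plane}
    (hK : K ∈ admissibleWithArea α v) (h : IsTangentEllipticSector α (K ∩ Q α)) :
    IsMaximizer α v K := by
  obtain ⟨a', c', E, J, ha', hc', -, hdist, hEJ, -, hsup, hf⟩ := h
  have hsc := Real.sin_sq_add_cos_sq α
  have hC : IsCompact (K ∩ Q α) := hK.1.isCompact.inter (isCompact_Q α)
  have hsub : frontier (K ∩ Q α) ⊆ Q α := hC.isClosed.frontier_subset.trans inter_subset_right
  have haQ : a' ∈ Q α :=
    hsub (hf ▸ Or.inl (Or.inl (Or.inr (right_mem_segment ℝ _ _))))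
  have hcQ : c' ∈ Q α := hsub (hf ▸ Or.inl (Or.inr (right_mem_segment ℝ _ _)))
  rw [mem_lineAB_iff hs hc, real_inner_comm, inner_ptA] at ha'
  rw [mem_lineCB_iff hs hc, real_inner_comm, inner_ptC] at hc'
  obtain ⟨qa1, qa2⟩ := (mem_Q_iff hs hc).1 haQ
  obtain ⟨qc1, qc2⟩ := (mem_Q_iff hs hc).1 hcQ
  have ya : |a' 1| = -a' 1 := by
    have h1 : |a' 1| * Real.sin α ≤ -a' 1 * Real.sin α := by linarith
    exact le_antisymm (le_of_mul_le_mul_right h1 hs) (neg_le_abs _)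
  have yc : |c' 1| = c' 1 := by
    have h1 : |c' 1| * Real.sin α ≤ c' 1 * Real.sin α := by linarith
    exact le_antisymm (le_of_mul_le_mul_right h1 hs) (le_abs_self _)
  rw [ya] at qa1
  rw [yc] at qc1
  have ya0 : -a' 1 ≤ Real.sin α := by nlinarith
  have yc0 : c' 1 ≤ Real.sin α := by nlinarith
  have xa : a' 0 = (1 + a' 1 * Real.sin α) / Real.cos α := by field_simp; linarith
  have xc : c' 0 = (1 - c' 1 * Real.sin α) / Real.cos α := by field_simp; linarith
  -- On the side lines the lengths are proportional to `sin α + a' 1` and `sin α - c' 1`; both are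
  -- nonnegative, so equality of squares suffices.
  have hsym : a' 1 = -c' 1 := by
    have d1 : dist (ptA α) a' ^ 2 = dist (ptC α) c' ^ 2 := by rw [hdist]
    rw [EuclideanSpace.dist_eq, EuclideanSpace.dist_eq, Real.sq_sqrt (by positivity),
      Real.sq_sqrt (by positivity), Fin.sum_univ_two, Fin.sum_univ_two] at d1
    simp only [Real.dist_eq, sq_abs, ptA, ptC, Matrix.cons_val_zero, Matrix.cons_val_one] at d1
    have k1 : Real.cos α * (Real.cos α - a' 0) = -(Real.sin α * (Real.sin α + a' 1)) := by
      linear_combination hsc - ha'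
    have k2 : Real.cos α * (Real.cos α - c' 0) = -(Real.sin α * (Real.sin α - c' 1)) := by
      linear_combination hsc - hc'
    have s1 := congrArg (· ^ 2) k1
    have s2 := congrArg (· ^ 2) k2
    simp only at s1 s2
    have d2 : (-Real.sin α - a' 1) ^ 2 = (Real.sin α - c' 1) ^ 2 := by
      linear_combination Real.cos α ^ 2 * d1 - s1 + s2 +
        ((Real.sin α - c' 1) ^ 2 - (-Real.sin α - a' 1) ^ 2) * hsc
    have d3 : Real.sin α + a' 1 = Real.sin α - c' 1 := by
      refine (pow_left_inj₀ (by linarith) (by linarith) two_ne_zero).1 ?_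
      linear_combination d2
    linarith
  have hc0 : 0 < c' 0 := by
    rw [xc]
    refine div_pos ?_ hc
    nlinarith [pow_pos hc 2]
  have ea : a' = !₂[c' 0, -c' 1] := by
    apply plane_ext
    · simp only [Matrix.cons_val_zero]; rw [xa, xc, hsym]; ring
    · simpa using hsym
  have ec : c' = !₂[c' 0, c' 1] := (plane_eta c').symm
  have hy0 : 0 ≤ c' 1 := yc ▸ abs_nonneg _
  have hEJ' := hEJ
  rw [ea, ec] at hEJ'
  simp only [Matrix.cons_val_zero, Matrix.cons_val_one] at hEJ'
  obtain ⟨β, hβ, hy, hE, rfl⟩ := hEJ'.exists_stretch hc0 hy0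
  have hcβ : 0 < Real.cos β := Real.cos_pos_of_mem_Ioo ⟨by linarith [hβ.1, Real.pi_pos], hβ.2⟩
  have hsβ : 0 < Real.sin β := Real.sin_pos_of_pos_of_lt_pi hβ.1 (by linarith [hβ.2, Real.pi_pos])
  have hcE : !₂[c' 0, c' 1] ∈ E := by
    have := hE β
    rwa [div_mul_cancel₀ _ hcβ.ne', div_mul_cancel₀ _ hsβ.ne'] at this
  have hncE : -!₂[c' 0, c' 1] ∈ E := by
    have := hE (β + Real.pi)
    rw [Real.cos_add_pi, Real.sin_add_pi, mul_neg, mul_neg, div_mul_cancel₀ _ hcβ.ne',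
      div_mul_cancel₀ _ hsβ.ne'] at this
    convert this using 1
    apply plane_ext <;> simp
  have hle := inner_ptC_le_of_isSupportingLine hs hc hsup hcE hncE
  obtain ⟨hA, hB⟩ := eq_cos_sin_of_le_one (A := c' 0 / Real.cos β * Real.cos α)
    (B := c' 1 / Real.sin β * Real.sin α) (β := β) (fun φ => by
      have := hle _ (hE φ)
      rw [real_inner_comm, inner_ptC] at this
      simp only [Matrix.cons_val_zero, Matrix.cons_val_one] at this
      linarith) (by field_simp; linarith)
  have hX : c' 0 / Real.cos β = semiX α β := by rw [semiX, eq_div_iff hc.ne', hA]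
  have hY : c' 1 / Real.sin β = semiY α β := by rw [semiY, eq_div_iff hs.ne', hB]
  -- The height of the contact point is `sin² β / sin α`, and it does not exceed the height `sin α`
  -- of `c`.
  have hge : Real.sin β ≤ Real.sin α := by
    have h1 : c' 1 = Real.sin β ^ 2 / Real.sin α := by
      rw [div_eq_iff hsβ.ne'] at hY
      rw [hY, semiY]; ring
    rw [h1, div_le_iff₀ hs] at yc0
    nlinarith
  have hang : Angles α β := by
    refine ⟨hβ.1, ?_, hα.2⟩
    by_contra! hlt
    exact absurd (Real.sin_lt_sin_of_lt_of_le_pi_div_two (by linarith [hα.1, Real.pi_pos])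
      hβ.2.le hlt) hge.not_gt
  have hc0' : c' = outerPt α β β := by
    apply plane_ext
    · simp only [outerPt, Matrix.cons_val_zero]; rw [← hX]; field_simp
    · simp only [outerPt, Matrix.cons_val_one, Matrix.cons_val_zero]; rw [← hY]; field_simp
  have ha0' : a' = outerPt α β (-β) := by
    rw [ea, hc0']; simp [outerPt]
  rw [hX, hY] at hf
  rw [hc0', ha0'] at hf
  exact hang.isMaximizer_of_frontier_eq_outer hK hf

/-! ### Every admissible area is attained -/

lemma exists_angle_of_lt {α v : ℝ} (hα : α ∈ Ioo 0 (Real.pi / 2)) (hs : 0 < Real.sin α)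
    (hc : 0 < Real.cos α) (hv : Real.cos α * Real.sin α < v) (hvα : v < α) :
    ∃ β, Angles α β ∧ β / (semiX α β * semiY α β) = v := by
  -- The area equation with denominators cleared has the spurious root `β = 0`. The derivative `v -
  -- sin α cos α > 0` there yields a positive value to the right of it, from which the intermediate
  -- value theorem starts.
  set g : ℝ → ℝ := fun β => v * (Real.sin β * Real.cos β) - β * (Real.sin α * Real.cos α) with hg
  have hgc : Continuous g := by fun_prop
  have hd : HasDerivAt g (v - Real.sin α * Real.cos α) 0 := by
    have := (((Real.hasDerivAt_sin 0).mul (Real.hasDerivAt_cos 0)).const_mul v).sub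
      ((hasDerivAt_id 0).mul_const (Real.sin α * Real.cos α))
    refine this.congr_deriv ?_
    simp
  have hpos : ∀ᶠ β in 𝓝[>] 0, 0 < g β := by
    have h1 := (hasDerivAt_iff_tendsto_slope.1 hd).eventually
      (lt_mem_nhds (show 0 < v - Real.sin α * Real.cos α by linarith))
    have h2 := h1.filter_mono (nhdsWithin_mono 0 fun x (hx : x ∈ Ioi (0 : ℝ)) => ne_of_gt hx)
    filter_upwards [h2, self_mem_nhdsWithin] with β h3 h4
    have h4 : 0 < β := h4
    rw [slope_def_field] at h3
    have g0 : g 0 = 0 := by simp [hg]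
    rw [g0, sub_zero, sub_zero] at h3
    exact (div_pos_iff_of_pos_right h4).1 h3
  obtain ⟨β₀, h0, hβ₀⟩ := (hpos.and (Ioo_mem_nhdsGT hα.1)).exists
  have hgα : g α < 0 := by
    have : g α = (v - α) * (Real.sin α * Real.cos α) := by simp only [hg]; ring
    rw [this]
    exact mul_neg_of_neg_of_pos (by linarith) (mul_pos hs hc)
  obtain ⟨β, hβ, hβe⟩ := intermediate_value_Icc' hβ₀.2.le hgc.continuousOn
    (show (0 : ℝ) ∈ Icc (g α) (g β₀) from ⟨hgα.le, h0.le⟩)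
  have hang : Angles α β := ⟨hβ₀.1.trans_le hβ.1, hβ.2, hα.2⟩
  refine ⟨β, hang, ?_⟩
  have h1 := hang.sinβ
  have h2 := hang.cosβ
  rw [semiX, semiY, div_eq_iff (by positivity)]
  simp only [hg] at hβe
  field_simp
  linarith

lemma exists_angle_of_gt {α v : ℝ} (hα : α ∈ Ioo 0 (Real.pi / 2)) (hs : 0 < Real.sin α)
    (hc : 0 < Real.cos α) (hv : v < Real.tan α) (hvα : α < v) :
    ∃ β, Angles α β ∧ β < α ∧ semiX α β * semiY α β * (β + tanGap α β) = v := by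
  -- The cleared equation is already positive at `β = 0`, by `v < tan α`. The open form of the
  -- intermediate value theorem gives `β < α`, which makes the side segments nondegenerate.
  set g : ℝ → ℝ := fun β => β * (Real.sin β * Real.cos β) + (Real.sin α ^ 2 * Real.cos β ^ 2 -
    Real.cos α ^ 2 * Real.sin β ^ 2) - v * (Real.sin α * Real.cos α) with hg
  have hgc : Continuous g := by fun_prop
  have h0 : 0 < g 0 := by
    rw [Real.tan_eq_sin_div_cos, lt_div_iff₀ hc] at hv
    simp [hg]
    nlinarith
  have hgα : g α < 0 := by
    have : g α = (α - v) * (Real.sin α * Real.cos α) := by simp only [hg]; ring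
    rw [this]
    exact mul_neg_of_neg_of_pos (by linarith) (mul_pos hs hc)
  obtain ⟨β, hβ, hβe⟩ := intermediate_value_Ioo' hα.1.le hgc.continuousOn
    (show (0 : ℝ) ∈ Ioo (g α) (g 0) from ⟨hgα, h0⟩)
  have hang : Angles α β := ⟨hβ.1, hβ.2.le, hα.2⟩
  refine ⟨β, hang, hβ.2, ?_⟩
  have h1 := hang.sinβ
  have h2 := hang.cosβ
  simp only [hg] at hβe
  rw [semiX, semiY, tanGap]
  field_simp
  linarith

lemma angles_self {α : ℝ} (hα : α ∈ Ioo 0 (Real.pi / 2)) : Angles α α := ⟨hα.1, le_rfl, hα.2⟩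

lemma innerRegion_self {α : ℝ} (hα : α ∈ Ioo 0 (Real.pi / 2)) :
    innerRegion α α = Metric.closedBall 0 1 ∩ Q α := by
  have h := angles_self hα
  have hX : semiX α α = 1 := div_self h.cosα.ne'
  have hY : semiY α α = 1 := div_self h.sinα.ne'
  have e1 : ∀ φ, innerPt α α φ = circlePt φ := fun φ => by
    simp [innerPt, hX, hY, circlePt]
  have e2 : ∀ φ, outerPt α α φ = circlePt φ := fun φ => by
    simp [outerPt, hX, hY, circlePt]
  ext x
  constructor
  · intro hx
    refine ⟨?_, hx.1⟩
    obtain ⟨ψ, -, r, hr, rfl⟩ := h.mem_innerRegion_iff.1 hx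
    rw [e1, mem_closedBall_zero_iff, norm_smul, norm_circlePt, mul_one, Real.norm_eq_abs,
      abs_of_nonneg hr.1]
    exact hr.2
  · rintro ⟨hx, hQ⟩
    refine ⟨hQ, fun φ _ => ?_⟩
    rw [e2]
    refine (real_inner_le_norm _ _).trans ?_
    rw [norm_circlePt, mul_one]
    exact mem_closedBall_zero_iff.1 hx

end Deltoid

theorem mainTheorem5 (α : ℝ) (hα : α ∈ Set.Ioo 0 (Real.pi / 2)) (v : ℝ)
    (hv : v ∈ Set.Ioo (Real.cos α * Real.sin α) (Real.tan α)) :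
    (v < α →
      (∃ K, Deltoid.IsMaximizer α v K ∧ Deltoid.IsEllipticSector α (K ∩ Deltoid.Q α)) ∧
      (∀ K ∈ Deltoid.admissibleWithArea α v,
        Deltoid.IsEllipticSector α (K ∩ Deltoid.Q α) → Deltoid.IsMaximizer α v K)) ∧
    (v = α →
      (∃ K, Deltoid.IsMaximizer α v K ∧
        K ∩ Deltoid.Q α = Metric.closedBall 0 1 ∩ Deltoid.Q α) ∧
      (∀ K ∈ Deltoid.admissibleWithArea α v,
        K ∩ Deltoid.Q α = Metric.closedBall 0 1 ∩ Deltoid.Q α → Deltoid.IsMaximizer α v K)) ∧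
    (α < v →
      (∃ K, Deltoid.IsMaximizer α v K ∧ Deltoid.IsTangentEllipticSector α (K ∩ Deltoid.Q α)) ∧
      (∀ K ∈ Deltoid.admissibleWithArea α v,
        Deltoid.IsTangentEllipticSector α (K ∩ Deltoid.Q α) → Deltoid.IsMaximizer α v K)) := by
  have hself := Deltoid.angles_self hα
  have hs := hself.sinα
  have hc := hself.cosα
  refine ⟨fun hlt => ⟨?_, fun K hK h => h.isMaximizer hα hs hc hK⟩, fun heq => ⟨?_, fun K hK h => ?_⟩,
    fun hgt => ⟨?_, fun K hK h => h.isMaximizer hα hs hc hK⟩⟩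
  · obtain ⟨β, hβ, rfl⟩ := Deltoid.exists_angle_of_lt hα hs hc hv.1 hlt
    obtain ⟨K, hK, hKQ⟩ := hβ.exists_isMaximizer_inner
    exact ⟨K, hK, hKQ ▸ hβ.isEllipticSector_innerRegion⟩
  · obtain ⟨K, hK, hKQ⟩ := hself.exists_isMaximizer_inner
    have e : α / (Deltoid.semiX α α * Deltoid.semiY α α) = v := by
      rw [Deltoid.semiX, Deltoid.semiY, div_self hc.ne', div_self hs.ne', heq]; simp
    exact ⟨K, e ▸ hK, hKQ.trans (Deltoid.innerRegion_self hα)⟩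
  · refine hself.isMaximizer_of_frontier_eq_inner hK ?_
    rw [h, ← Deltoid.innerRegion_self hα, hself.frontier_innerRegion]
  · obtain ⟨β, hβ, hlt, rfl⟩ := Deltoid.exists_angle_of_gt hα hs hc hv.2 hgt
    obtain ⟨K, hK, hKQ⟩ := hβ.exists_isMaximizer_outer
    exact ⟨K, hK, hKQ ▸ hβ.isTangentEllipticSector_outerRegion hlt⟩
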